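/- Let $(M^{2n+1},J,\theta)$ be a pseudohermitian manifold: $\theta$ is a contact form with contact bundle $\xi=\ker\theta$, and $J$ is an integrable almost complex structure on $\xi$ (if $X,Y$ are sections of $\xi_{1,0}$ then so is $[X,Y]$) such that the Levi metric $L_\theta(X,Y)=\tfrac12 d\theta(X,JY)$ is positive definite on $\xi$, where $d\theta(X,Y)=X\theta(Y)-Y\theta(X)-\theta([X,Y])$. Let $T$ be the Reeb field ($\theta(T)=1$, $\iota_Td\theta=0$), and let $\nabla^{p.h.}$ be the Tanaka–Webster connection: $\theta$-unitary coframes $\theta^\beta$ with $\theta^\beta(T)=0$ satisfy $d\theta^\beta=\theta^\alpha\wedge\theta_\alpha{}^\beta+\theta\wedge\tau^\beta$, $\theta_\alpha{}^\beta+\overline{\theta_\beta{}^\alpha}=0$, $\overline{\tau^\beta}\wedge\theta^\beta=0$, and $\nabla^{p.h.}T=0$; equivalently, $\nabla^{p.h.}$ preserves $\xi$, $J$, $L_\theta$ and $T$, its torsion is $\mathbb T(X,Y)=d\theta(X,Y)T$ for $X,Y\in\xi$, and $\mathbb T(T,\cdot)$ is symmetric on $\xi$ and anticommutes with $J$. Let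 $R_\alpha{}^\beta{}_{\rho\bar\sigma}$ be the coefficient of $\theta^\rho\wedge\theta^{\bar\sigma}$ in $d\theta_\alpha{}^\beta-\theta_\alpha{}^\gamma\wedge\theta_\gamma{}^\beta$ and let $W=\sum_{\beta,\gamma}R_\gamma{}^\gamma{}_{\beta\bar\beta}$ be the Tanaka–Webster scalar curvature. Let $\xi$, with the metric $L_\theta$ and the orientation given by the frames $(e_1,\dots,e_n,Je_1,\dots,Je_n)$, carry a spin structure $Spin(\xi)$, and let $\mathbb S=Spin(\xi)\times_{\mathcal N}\Lambda^*_{\mathbb C}(n)$ be its spinor bundle, with Clifford multiplication normalized by $v\cdot v\cdot=-L_\theta(v,v)$. Let $\nabla$ be the spin connection induced by $\nabla^{p.h.}$: for a local section $\sigma$ of $Spin(\xi)$ over the orthonormal frame $(e_1,\dots,e_{2n})$ and $\varphi=(\sigma,f)$, $$\nabla_X\varphi=\Big(\sigma,\;Xf+\tfrac14\sum_{a,b=1}^{2n}\langle\nabla^{p.h.}_Xe_a,e_b\rangle\, e_ae_b\cdot f\Big).$$ Define $D_\xi\varphi=\sum_{a=1}^{2n}e_a\cdot\nabla_{e_a}\varphi$,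 and let $\nabla^*\nabla\varphi=-\sum_{a=1}^{2n}\nabla^2_{e_a,e_a}\varphi$ be the connection Laplacian along $\xi$, where $\nabla^2_{V,Z}\varphi=\nabla_V\nabla_Z\varphi-\nabla_{\nabla^{p.h.}_VZ}\varphi$. Then for every smooth section $\varphi$ of $\mathbb S$ and every orthonormal basis of the form $e_1,\dots,e_n,\ e_{n+\beta}=Je_\beta$ of $\xi$ at a point, one has at that point $$D_\xi^2\varphi=\nabla^*\nabla\varphi+W\varphi-2\sum_{\beta=1}^n e_\beta\cdot e_{n+\beta}\cdot\nabla_T\varphi .$$ -/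

import Mathlib

namespace CRSpin

noncomputable section

/-! ### The spin representation on `Λ*_ℂ(n)` -/

/-- The spinor module `S(2n) = Λ*_ℂ`, in coordinates: `f s` is the coefficient of
`ω^{j₁} ∧ ⋯ ∧ ω^{jₖ}`, where `s = {j₁ < ⋯ < jₖ}`. -/
abbrev Spinor (n : ℕ) : Type := Finset (Fin n) → ℂ

/-- `ω^j ∧ ω^{s \ j} = wedgeSign j s • ω^s` for `j ∈ s`. -/
def wedgeSign {n : ℕ} (j : Fin n) (s : Finset (Fin n)) : ℂ :=
  (-1) ^ (s.filter (fun k => k < j)).card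

/-- `ε_j`: exterior multiplication by `ω^j`. -/
def wedgeOp {n : ℕ} (j : Fin n) : Spinor n →ₗ[ℂ] Spinor n where
  toFun f s := if j ∈ s then wedgeSign j s * f (s.erase j) else 0
  map_add' f g := by
    funext s
    by_cases h : j ∈ s <;> simp [h, mul_add]
  map_smul' c f := by
    funext s
    by_cases h : j ∈ s <;> simp [h, mul_left_comm]

/-- `ι_j`: contraction, `ι_j (ω^{j₁} ∧ ⋯ ∧ ω^{jₖ}) = ∑ (-1)^{s-1} δ_{j jₛ} ω^{j₁} ∧ ⋯ (omit jₛ) ⋯ ∧ ω^{jₖ}`. -/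
def contractOp {n : ℕ} (j : Fin n) : Spinor n →ₗ[ℂ] Spinor n where
  toFun f s := if j ∈ s then 0 else wedgeSign j s * f (insert j s)
  map_add' f g := by
    funext s
    by_cases h : j ∈ s <;> simp [h, mul_add]
  map_smul' c f := by
    funext s
    by_cases h : j ∈ s <;> simp [h, mul_left_comm]

theorem wedgeSign_mul_self {n : ℕ} (j : Fin n) (s : Finset (Fin n)) :
    wedgeSign j s * wedgeSign j s = 1 := by
  unfold wedgeSign
  rw [← mul_pow]; norm_num

theorem wedgeSign_insert_self {n : ℕ} (j : Fin n) (s : Finset (Fin n)) :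
    wedgeSign j (insert j s) = wedgeSign j s := by
  unfold wedgeSign
  rw [Finset.filter_insert]; simp

theorem wedgeSign_erase_self {n : ℕ} (j : Fin n) (s : Finset (Fin n)) :
    wedgeSign j (s.erase j) = wedgeSign j s := by
  unfold wedgeSign
  congr 2
  ext k; simp only [Finset.mem_filter, Finset.mem_erase]
  constructor
  · rintro ⟨⟨_, h⟩, h'⟩; exact ⟨h, h'⟩
  · rintro ⟨h, h'⟩; exact ⟨⟨h'.ne, h⟩, h'⟩

theorem wedgeSign_insert {n : ℕ} {j k : Fin n} {s : Finset (Fin n)} (h : k ∉ s) :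
    wedgeSign j (insert k s) = (if k < j then -1 else 1) * wedgeSign j s := by
  unfold wedgeSign
  rw [Finset.filter_insert]
  split_ifs with hk
  · rw [Finset.card_insert_of_notMem (by simp [h]), pow_succ]; ring
  · simp

theorem wedgeSign_erase {n : ℕ} {j k : Fin n} {s : Finset (Fin n)} (h : k ∈ s) :
    wedgeSign j (s.erase k) = (if k < j then -1 else 1) * wedgeSign j s := by
  conv_rhs => rw [← Finset.insert_erase h, wedgeSign_insert (Finset.notMem_erase k s)]
  split_ifs <;> simp

theorem wedgeOp_anticomm {n : ℕ} (j k : Fin n) :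
    wedgeOp j * wedgeOp k + wedgeOp k * wedgeOp j = 0 := by
  refine LinearMap.ext fun f => funext fun s => ?_
  rcases eq_or_ne j k with rfl | hjk
  · simp [wedgeOp]
  · by_cases hj : j ∈ s <;> by_cases hk : k ∈ s <;>
      simp [wedgeOp, hj, hk, hjk, hjk.symm, wedgeSign_erase, Finset.erase_right_comm (a := k) (b := j)]
    rcases lt_or_gt_of_ne hjk with h | h <;> simp [h, not_lt.2 h.le] <;> ring

theorem contractOp_anticomm {n : ℕ} (j k : Fin n) :
    contractOp j * contractOp k + contractOp k * contractOp j = 0 := by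
  refine LinearMap.ext fun f => funext fun s => ?_
  rcases eq_or_ne j k with rfl | hjk
  · simp [contractOp]
  · by_cases hj : j ∈ s <;> by_cases hk : k ∈ s <;>
      simp [contractOp, hj, hk, hjk, hjk.symm, wedgeSign_insert, Finset.insert_comm k j]
    rcases lt_or_gt_of_ne hjk with h | h <;> simp [h, not_lt.2 h.le] <;> ring

theorem wedgeOp_contractOp {n : ℕ} (j k : Fin n) :
    wedgeOp j * contractOp k + contractOp k * wedgeOp j = if j = k then 1 else 0 := by
  refine LinearMap.ext fun f => funext fun s => ?_
  rcases eq_or_ne j k with rfl | hjk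
  · by_cases hj : j ∈ s <;>
      simp [wedgeOp, contractOp, hj, ← mul_assoc, wedgeSign_erase_self, wedgeSign_insert_self,
        wedgeSign_mul_self]
  · by_cases hj : j ∈ s <;> by_cases hk : k ∈ s <;>
      simp [wedgeOp, contractOp, hj, hk, hjk, hjk.symm, wedgeSign_insert, wedgeSign_erase]
    rw [Finset.erase_insert_of_ne hjk.symm]
    rcases lt_or_gt_of_ne hjk with h | h <;> simp [h, not_lt.2 h.le] <;> ring

/-- `E_{2j-1} = ε_j - ι_j` and `E_{2j} = i (ε_j + ι_j)`; here the index starts at `0`. -/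
def gamma {n : ℕ} (a : Fin (2 * n)) : Module.End ℂ (Spinor n) :=
  if a.val % 2 = 0 then wedgeOp ⟨a.val / 2, by omega⟩ - contractOp ⟨a.val / 2, by omega⟩
  else Complex.I • (wedgeOp ⟨a.val / 2, by omega⟩ + contractOp ⟨a.val / 2, by omega⟩)

theorem gamma_anticomm {n : ℕ} (a b : Fin (2 * n)) :
    gamma a * gamma b + gamma b * gamma a = if a = b then (-2 : ℂ) • (1 : Module.End ℂ (Spinor n)) else 0 := by
  have key : ∀ j k : Fin n,
      wedgeOp j * contractOp k = (if j = k then 1 else 0) - contractOp k * wedgeOp j :=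
    fun j k => eq_sub_of_add_eq (wedgeOp_contractOp j k)
  have hw : ∀ j k : Fin n, wedgeOp j * wedgeOp k = - (wedgeOp k * wedgeOp j) :=
    fun j k => eq_neg_of_add_eq_zero_left (wedgeOp_anticomm j k)
  have hc : ∀ j k : Fin n, contractOp j * contractOp k = - (contractOp k * contractOp j) :=
    fun j k => eq_neg_of_add_eq_zero_left (contractOp_anticomm j k)
  have hI : ∀ X : Module.End ℂ (Spinor n), Complex.I • Complex.I • X = -X := fun X => by
    rw [smul_smul, Complex.I_mul_I, neg_one_smul]
  have hab : a = b ↔ (a.val / 2 = b.val / 2 ∧ a.val % 2 = b.val % 2) := by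
    rw [Fin.ext_iff]; omega
  unfold gamma
  set j : Fin n := ⟨a.val / 2, by omega⟩
  set k : Fin n := ⟨b.val / 2, by omega⟩
  have hjk : (j = k) ↔ a.val / 2 = b.val / 2 := by simp [j, k, Fin.ext_iff]
  have hjk' : (k = j) ↔ a.val / 2 = b.val / 2 := by rw [eq_comm, hjk]
  rcases Nat.mod_two_eq_zero_or_one a.val with ha | ha <;>
    rcases Nat.mod_two_eq_zero_or_one b.val with hb | hb <;>
    by_cases h : a.val / 2 = b.val / 2 <;>
    simp only [hab, ha, hb, h, if_true, if_false, mul_add, add_mul, mul_sub, sub_mul, smul_mul_assoc,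
      mul_smul_comm, hI, key, hw j k, hc j k, hjk, hjk', and_true, and_false, one_ne_zero, zero_ne_one,
      smul_add, smul_sub, and_self, smul_neg] <;>
    module

/-- Clifford multiplication by a vector of `ℝ²ⁿ`, `v ↦ ∑ v_a E_a`. -/
def gammaVec (n : ℕ) : (Fin (2 * n) → ℝ) →ₗ[ℝ] Module.End ℂ (Spinor n) where
  toFun v := ∑ a, v a • gamma a
  map_add' v w := by simp [add_smul, Finset.sum_add_distrib]
  map_smul' c v := by simp [Finset.smul_sum, mul_smul]

/-- `v ↦ -|v|²` on `ℝ²ⁿ`, so that `v * v = -|v|²` in the Clifford algebra. -/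
def cliffordForm (n : ℕ) : QuadraticForm ℝ (Fin (2 * n) → ℝ) :=
  QuadraticMap.weightedSumSquares ℝ (fun _ : Fin (2 * n) => (-1 : ℝ))

theorem gammaVec_mul_self (n : ℕ) (v : Fin (2 * n) → ℝ) :
    gammaVec n v * gammaVec n v
      = algebraMap ℝ (Module.End ℂ (Spinor n)) (cliffordForm n v) := by
  have h1 : gammaVec n v * gammaVec n v
      = ∑ a, ∑ b, (v a * v b) • (gamma a * gamma b) := by
    simp only [gammaVec, LinearMap.coe_mk, AddHom.coe_mk, Finset.sum_mul_sum, smul_mul_smul_comm]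
  have h2 : (2 : ℝ) • (gammaVec n v * gammaVec n v)
      = ∑ a, ∑ b, (v a * v b) • (gamma a * gamma b + gamma b * gamma a) := by
    simp only [smul_add, Finset.sum_add_distrib]
    rw [h1, two_smul]
    congr 1
    rw [Finset.sum_comm]
    exact Finset.sum_congr rfl fun a _ => Finset.sum_congr rfl fun b _ => by rw [mul_comm (v a)]
  have h3 : (2 : ℝ) • (gammaVec n v * gammaVec n v)
      = (2 : ℝ) • algebraMap ℝ (Module.End ℂ (Spinor n)) (cliffordForm n v) := by
    rw [h2]
    simp only [gamma_anticomm, smul_ite, smul_zero, Finset.sum_ite_eq, Finset.mem_univ, if_true]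
    refine LinearMap.ext fun f => funext fun s => ?_
    simp [cliffordForm, QuadraticMap.weightedSumSquares_apply, Algebra.algebraMap_eq_smul_one,
      Finset.sum_neg_distrib, ← Finset.sum_mul]
    ring
  exact smul_right_injective _ (two_ne_zero' ℝ) h3

/-- The representation of the Clifford algebra `C_{2n}(-1)` on `Λ*_ℂ` with `e_a ↦ E_a`. -/
def spinRep (n : ℕ) : CliffordAlgebra (cliffordForm n) →ₐ[ℝ] Module.End ℂ (Spinor n) :=
  CliffordAlgebra.lift (cliffordForm n) ⟨gammaVec n, gammaVec_mul_self n⟩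


/-! ### Pseudohermitian manifolds -/

open Bundle VectorField
open scoped Manifold ContDiff

/-- Vector fields on `M`, without regularity. -/
abbrev VField (n : ℕ) (M : Type*) [TopologicalSpace M]
    [ChartedSpace (EuclideanSpace ℝ (Fin (2 * n + 1))) M] : Type _ :=
  Π x : M, TangentSpace (𝓡 (2 * n + 1)) x

variable {n : ℕ} {M : Type*} [TopologicalSpace M]
  [ChartedSpace (EuclideanSpace ℝ (Fin (2 * n + 1))) M] [IsManifold (𝓡 (2 * n + 1)) ∞ M]

/-- Extension of a tangent vector to a vector field that is smooth near the base point. -/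
def ext {x : M} (v : TangentSpace (𝓡 (2 * n + 1)) x) : VField n M :=
  FiberBundle.extend (EuclideanSpace ℝ (Fin (2 * n + 1))) v

def SmoothFieldOn (X : VField n M) (U : Set M) : Prop :=
  ContMDiffOn (𝓡 (2 * n + 1)) (𝓡 (2 * n + 1)).tangent ∞
    (fun x => (⟨x, X x⟩ : TangentBundle (𝓡 (2 * n + 1)) M)) U

/-- The exterior derivative of a one-form,
`dθ(X, Y) = X (θ Y) - Y (θ X) - θ [X, Y]`. -/
def extDeriv₁ (θ : Π x : M, TangentSpace (𝓡 (2 * n + 1)) x →L[ℝ] ℝ) (x : M)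
    (u v : TangentSpace (𝓡 (2 * n + 1)) x) : ℝ :=
  mvfderiv (𝓡 (2 * n + 1)) (fun y => θ y (ext v y)) x u
    - mvfderiv (𝓡 (2 * n + 1)) (fun y => θ y (ext u y)) x v
    - θ x (mlieBracket (𝓡 (2 * n + 1)) (ext u) (ext v) x)

variable (n M) in
/-- A pseudohermitian structure on a manifold of dimension `2n+1`: a contact form `θ` with contact
bundle `ξ = ker θ`, and an integrable almost complex structure `J` on `ξ` whose Levi form is
positive definite. Only the restriction of `J` to `ξ` carries information; its values on vectors
outside `ξ` are never used. Nondegeneracy of `dθ` on `ξ`, that is `θ ∧ (dθ)ⁿ ≠ 0`, is part of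
`levi_pos`. -/
structure PseudohermitianStructure where
  θ : Π x : M, TangentSpace (𝓡 (2 * n + 1)) x →L[ℝ] ℝ
  smooth_θ : ∀ (U : Set M), IsOpen U → ∀ X : VField n M, SmoothFieldOn X U →
    ContMDiffOn (𝓡 (2 * n + 1)) 𝓘(ℝ, ℝ) ∞ (fun x => θ x (X x)) U
  θ_ne_zero : ∀ x, θ x ≠ 0
  J : Π x : M, TangentSpace (𝓡 (2 * n + 1)) x →L[ℝ] TangentSpace (𝓡 (2 * n + 1)) x
  J_mem : ∀ x v, θ x v = 0 → θ x (J x v) = 0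
  J_sq : ∀ x v, θ x v = 0 → J x (J x v) = -v
  smooth_J : ∀ (U : Set M), IsOpen U → ∀ X : VField n M, SmoothFieldOn X U →
    (∀ x ∈ U, θ x (X x) = 0) → SmoothFieldOn (fun x => J x (X x)) U
  /-- `[X - iJX, Y - iJY]` is again of the form `V - iJV` with `V ∈ ξ`, that is
  `[ξ₁₀, ξ₁₀] ⊆ ξ₁₀`. -/
  integrable : ∀ (U : Set M), IsOpen U → ∀ X Y : VField n M,
    SmoothFieldOn X U → SmoothFieldOn Y U →
    (∀ x ∈ U, θ x (X x) = 0) → (∀ x ∈ U, θ x (Y x) = 0) → ∀ x ∈ U,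
    θ x (mlieBracket (𝓡 (2 * n + 1)) X Y x
        - mlieBracket (𝓡 (2 * n + 1)) (fun y => J y (X y)) (fun y => J y (Y y)) x) = 0 ∧
    mlieBracket (𝓡 (2 * n + 1)) X (fun y => J y (Y y)) x
        + mlieBracket (𝓡 (2 * n + 1)) (fun y => J y (X y)) Y x
      = J x (mlieBracket (𝓡 (2 * n + 1)) X Y x
        - mlieBracket (𝓡 (2 * n + 1)) (fun y => J y (X y)) (fun y => J y (Y y)) x)
  levi_pos : ∀ x v, θ x v = 0 → v ≠ 0 → 0 < extDeriv₁ θ x v (J x v)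

namespace PseudohermitianStructure

variable (S : PseudohermitianStructure n M)

/-- The Levi metric `L_θ(u, v) = ½ dθ(u, Jv)` on `ξ`. -/
def levi (x : M) (u v : TangentSpace (𝓡 (2 * n + 1)) x) : ℝ :=
  (1 / 2) * extDeriv₁ S.θ x u (S.J x v)

/-- `X` is a smooth section of `ξ` over `U`. -/
def HorizontalOn (X : VField n M) (U : Set M) : Prop :=
  SmoothFieldOn X U ∧ ∀ x ∈ U, S.θ x (X x) = 0

/-- `T` is the Reeb vector field: `θ(T) = 1` and `L_T θ = ι_T dθ = 0`. -/
structure IsReebField (T : VField n M) : Prop where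
  smooth : SmoothFieldOn T Set.univ
  theta : ∀ x, S.θ x (T x) = 1
  contract : ∀ x v, extDeriv₁ S.θ x (T x) v = 0

/-- `e_1, …, e_n, Je_1, …, Je_n` is an orthonormal basis of `ξ_x`. -/
structure IsUnitaryBasis (x : M) (u : Fin n → TangentSpace (𝓡 (2 * n + 1)) x) : Prop where
  horizontal : ∀ β, S.θ x (u β) = 0
  orthonormal : ∀ α β, S.levi x (u α) (u β) = if α = β then 1 else 0
  orthogonal_J : ∀ α β, S.levi x (u α) (S.J x (u β)) = 0

/-- The real basis `e_1, …, e_n, e_{n+1} = Je_1, …, e_{2n} = Je_n`. -/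
def realBasis (x : M) (u : Fin n → TangentSpace (𝓡 (2 * n + 1)) x) (a : Fin (2 * n)) :
    TangentSpace (𝓡 (2 * n + 1)) x :=
  if h : a.val < n then u ⟨a.val, h⟩ else S.J x (u ⟨a.val - n, by omega⟩)

/-- `cov` is the pseudohermitian (Tanaka-Webster) connection `∇`, where `T` is the Reeb field: `T`,
`ξ`, `J` and `L_θ` are parallel, and the torsion `𝕋(X, Y) = ∇_X Y - ∇_Y X - [X, Y]` is
`dθ(X, Y) T` for `X, Y ∈ ξ`, while `τ = 𝕋(T, ·)` anticommutes with `J` and is symmetric on `ξ`. In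
a local unitary coframe with connection forms `θ_α^β` these are the structure equations
`dθ^β = θ^α ∧ θ_α^β + θ ∧ τ^β`, `θ_α^β + conj θ_β^α = 0`, `τ_β ∧ θ^β = 0`. These conditions determine
the connection. -/
structure IsTanakaWebster (T : VField n M)
    (cov : CovariantDerivative (𝓡 (2 * n + 1)) (EuclideanSpace ℝ (Fin (2 * n + 1)))
      (TangentSpace (𝓡 (2 * n + 1)) : M → Type _)) : Prop where
  smooth : CovariantDerivative.ContMDiffCovariantDerivative cov ∞
  reeb_parallel : ∀ x v, cov T x v = 0
  horizontal : ∀ (U : Set M), IsOpen U → ∀ X : VField n M, S.HorizontalOn X U →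
    ∀ x ∈ U, ∀ v, S.θ x (cov X x v) = 0
  J_parallel : ∀ (U : Set M), IsOpen U → ∀ X : VField n M, S.HorizontalOn X U →
    ∀ x ∈ U, ∀ v, cov (fun y => S.J y (X y)) x v = S.J x (cov X x v)
  metric : ∀ (U : Set M), IsOpen U → ∀ X Y : VField n M, S.HorizontalOn X U →
    S.HorizontalOn Y U → ∀ x ∈ U, ∀ v,
    mvfderiv (𝓡 (2 * n + 1)) (fun y => S.levi y (X y) (Y y)) x v
      = S.levi x (cov X x v) (Y x) + S.levi x (X x) (cov Y x v)
  torsion_horizontal : ∀ x u v, S.θ x u = 0 → S.θ x v = 0 →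
    cov.torsion x u v = extDeriv₁ S.θ x u v • T x
  torsion_J : ∀ x v, S.θ x v = 0 →
    cov.torsion x (T x) (S.J x v) = -S.J x (cov.torsion x (T x) v)
  torsion_symm : ∀ x u v, S.θ x u = 0 → S.θ x v = 0 →
    S.levi x (cov.torsion x (T x) u) v = S.levi x (cov.torsion x (T x) v) u

/-- The curvature `R(u, v) w = ∇_u ∇_v w - ∇_v ∇_u w - ∇_{[u, v]} w`. -/
def curvature
    (cov : CovariantDerivative (𝓡 (2 * n + 1)) (EuclideanSpace ℝ (Fin (2 * n + 1)))
      (TangentSpace (𝓡 (2 * n + 1)) : M → Type _))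
    (x : M) (u v w : TangentSpace (𝓡 (2 * n + 1)) x) : TangentSpace (𝓡 (2 * n + 1)) x :=
  cov (fun y => cov (ext w) y (ext v y)) x u - cov (fun y => cov (ext w) y (ext u y)) x v
    - cov (ext w) x (mlieBracket (𝓡 (2 * n + 1)) (ext u) (ext v) x)

/-- The `ℂ`-linear extension of a real-linear map `F : V → ℂ` to `V ⊗ ℂ`, where `a + ib` is
written `(a, b)`. -/
def complexExt {V : Type*} (F : V → ℂ) (z : V × V) : ℂ := F z.1 + Complex.I * F z.2

/-- The coframe `θ^β = ω^β + i ω^{n+β}` dual to `Z_β`, on real vectors of `ξ`. -/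
def coframe (x : M) (u : Fin n → TangentSpace (𝓡 (2 * n + 1)) x) (β : Fin n)
    (v : TangentSpace (𝓡 (2 * n + 1)) x) : ℂ :=
  (S.levi x v (u β) : ℂ) + Complex.I * (S.levi x v (S.J x (u β)) : ℂ)

/-- `Z_α = ½ (e_α - i Je_α)`. -/
def frameZ (x : M) (u : Fin n → TangentSpace (𝓡 (2 * n + 1)) x) (α : Fin n) :
    TangentSpace (𝓡 (2 * n + 1)) x × TangentSpace (𝓡 (2 * n + 1)) x :=
  ((1 / 2 : ℝ) • u α, (-1 / 2 : ℝ) • S.J x (u α))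

/-- The complex conjugate of `Z_α`. -/
def frameZbar (x : M) (u : Fin n → TangentSpace (𝓡 (2 * n + 1)) x) (α : Fin n) :
    TangentSpace (𝓡 (2 * n + 1)) x × TangentSpace (𝓡 (2 * n + 1)) x :=
  ((1 / 2 : ℝ) • u α, (1 / 2 : ℝ) • S.J x (u α))

/-- The curvature coefficient `R_α^β_{ρ σ̄} = θ^β (R(Z_ρ, conj Z_σ) Z_α)`, the coefficient of
`θ^ρ ∧ conj θ^σ` in `dθ_α^β - θ_α^γ ∧ θ_γ^β`. -/
def websterCurvature
    (cov : CovariantDerivative (𝓡 (2 * n + 1)) (EuclideanSpace ℝ (Fin (2 * n + 1)))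
      (TangentSpace (𝓡 (2 * n + 1)) : M → Type _))
    (x : M) (u : Fin n → TangentSpace (𝓡 (2 * n + 1)) x) (α β ρ σ : Fin n) : ℂ :=
  complexExt (fun a => complexExt (fun b => complexExt (fun c =>
    S.coframe x u β (curvature cov x a b c)) (S.frameZ x u α)) (S.frameZbar x u σ)) (S.frameZ x u ρ)

/-- The pseudohermitian Ricci tensor `R_{α σ̄} = R_γ^γ_{α σ̄}`. -/
def websterRicci
    (cov : CovariantDerivative (𝓡 (2 * n + 1)) (EuclideanSpace ℝ (Fin (2 * n + 1)))
      (TangentSpace (𝓡 (2 * n + 1)) : M → Type _))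
    (x : M) (u : Fin n → TangentSpace (𝓡 (2 * n + 1)) x) (α σ : Fin n) : ℂ :=
  ∑ γ, S.websterCurvature cov x u γ γ α σ

/-- The Tanaka-Webster scalar curvature `W = R_β^β` at `x`, computed in a unitary basis `u`. -/
def websterScalar
    (cov : CovariantDerivative (𝓡 (2 * n + 1)) (EuclideanSpace ℝ (Fin (2 * n + 1)))
      (TangentSpace (𝓡 (2 * n + 1)) : M → Type _))
    (x : M) (u : Fin n → TangentSpace (𝓡 (2 * n + 1)) x) : ℂ :=
  ∑ β, S.websterRicci cov x u β β

/-! ### Spin structures and spinor fields -/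

/-- A spin structure on `ξ`: a lift of the bundle `SO(ξ)` of oriented orthonormal frames to a
principal `Spin(2n)`-bundle, given by local sections `σ_i` over an open cover `U i`. The frame of `ξ`
below `σ_i` is `e i`, and `σ_j = σ_i · g i j` on overlaps, so that `e j = e i · ρ(g i j)`. Here `ξ` is
oriented by the frames `e_1, …, e_n, Je_1, …, Je_n`. -/
structure SpinStructure where
  ι : Type*
  U : ι → Set M
  isOpen_U : ∀ i, IsOpen (U i)
  cover : ∀ x, ∃ i, x ∈ U i
  e : ι → Fin (2 * n) → VField n M
  horizontal : ∀ i a, S.HorizontalOn (e i a) (U i)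
  orthonormal : ∀ i, ∀ x ∈ U i, ∀ a b, S.levi x (e i a x) (e i b x) = if a = b then 1 else 0
  oriented : ∀ i, ∀ x ∈ U i, ∀ u, S.IsUnitaryBasis x u →
    0 < (Matrix.of fun a b => S.levi x (e i a x) (S.realBasis x u b)).det
  g : ι → ι → M → CliffordAlgebra (cliffordForm n)
  g_mem : ∀ i j, ∀ x ∈ U i ∩ U j, g i j x ∈ spinGroup (cliffordForm n)
  smooth_g : ∀ i j ψ,
    ContMDiffOn (𝓡 (2 * n + 1)) 𝓘(ℝ, Spinor n) ∞ (fun x => spinRep n (g i j x) ψ) (U i ∩ U j)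
  cocycle : ∀ i j k, ∀ x ∈ U i ∩ U j ∩ U k, g i j x * g j k x = g i k x
  /-- `e j a = ρ(g i j) (e_a)` in the frame `e i`, where `ρ(g) v = g v g⁻¹`. -/
  lift : ∀ i j, ∀ x ∈ U i ∩ U j, ∀ a,
    g i j x * CliffordAlgebra.ι (cliffordForm n) (Pi.single a 1)
      = CliffordAlgebra.ι (cliffordForm n) (fun b => S.levi x (e j a x) (e i b x)) * g i j x

namespace SpinStructure

variable {S} (P : S.SpinStructure)
  (cov : CovariantDerivative (𝓡 (2 * n + 1)) (EuclideanSpace ℝ (Fin (2 * n + 1)))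
    (TangentSpace (𝓡 (2 * n + 1)) : M → Type _))

/-- A section of the spinor bundle `𝕊 = Spin(ξ) ×_𝒩 S(2n)`: it equals `(σ_i, φ i)` over `U i`, and
`(σ_i · g, f) = (σ_i, g f)`. -/
structure IsSpinorField (φ : P.ι → M → Spinor n) : Prop where
  smooth : ∀ i, ContMDiffOn (𝓡 (2 * n + 1)) 𝓘(ℝ, Spinor n) ∞ (φ i) (P.U i)
  compatible : ∀ i j, ∀ x ∈ P.U i ∩ P.U j, φ i x = spinRep n (P.g i j x) (φ j x)

/-- Clifford multiplication by `v ∈ ξ_x` on spinors at `x`, with respect to `σ_i`. -/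
def clifford (i : P.ι) (x : M) (v : TangentSpace (𝓡 (2 * n + 1)) x) : Module.End ℂ (Spinor n) :=
  spinRep n (CliffordAlgebra.ι (cliffordForm n) (fun a => S.levi x v (P.e i a x)))

/-- The form `¼ ∑ ⟨∇_v e_a, e_b⟩ e_a e_b` of the spin connection with respect to `σ_i`. -/
def connectionForm (i : P.ι) (x : M) (v : TangentSpace (𝓡 (2 * n + 1)) x) :
    Module.End ℂ (Spinor n) :=
  (1 / 4 : ℝ) • ∑ a, ∑ b,
    S.levi x (cov (P.e i a) x v) (P.e i b x) • (P.clifford i x (P.e i a x) * P.clifford i x (P.e i b x))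

/-- The spin connection, `∇_X (σ_i, f) = (σ_i, X f + ω_i(X) f)`. -/
def nabla (X : VField n M) (φ : P.ι → M → Spinor n) : P.ι → M → Spinor n := fun i x =>
  mvfderiv (𝓡 (2 * n + 1)) (φ i) x (X x) + P.connectionForm cov i x (X x) (φ i x)

/-- The invariant second derivative `∇²_{V,W} φ = ∇_V ∇_W φ - ∇_{∇_V W} φ`. -/
def secondDerivative (V W : VField n M) (φ : P.ι → M → Spinor n) : P.ι → M → Spinor n :=
  P.nabla cov V (P.nabla cov W φ) - P.nabla cov (fun x => cov W x (V x)) φ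

/-- The connection Laplacian `∇*∇ φ = -∑ ∇²_{e_a, e_a} φ` along `ξ`. -/
def connectionLaplacian (φ : P.ι → M → Spinor n) : P.ι → M → Spinor n := fun i x =>
  -∑ a, P.secondDerivative cov (P.e i a) (P.e i a) φ i x

/-- The contact Dirac operator `D_ξ φ = ∑ e_a · ∇_{e_a} φ`. -/
def dirac (φ : P.ι → M → Spinor n) : P.ι → M → Spinor n := fun i x =>
  ∑ a, P.clifford i x (P.e i a x) (P.nabla cov (P.e i a) φ i x)

end SpinStructure

end PseudohermitianStructure

end

end CRSpin

/-! The formula is a Lichnerowicz–Weitzenböck formula for a metric connection with torsion. In a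
local orthonormal frame of `ξ`, Clifford multiplication is parallel, so the square of the Dirac
operator is the Clifford contraction of the second derivative, `∑ e_a e_b ∇²_{a,b}`
(`frameDirac_frameDirac`). The Clifford relations split this double sum into minus the trace, which
is the connection Laplacian, and half the contraction of `∇²_{a,b} - ∇²_{b,a}`. By the Ricci
identity (`spinHessian_sub`) that commutator is the spin curvature minus the derivative along the
torsion `dθ(e_a, e_b) T = 2 ⟨J e_a, e_b⟩ T`. The torsion part is the `∇_T` term, since `∑ ⟨J e_a,
e_b⟩ e_a e_b = 2 ∑ e_β · J e_β` (`sum_clifford_J`).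

It remains to contract the curvature, where the torsion enters a second time: the first Bianchi
identity (`bianchi`) has right-hand side the cyclic sum of `dθ(e_a, e_b) ⟨τ e_c, e_d⟩`. These terms
leave no trace in the Clifford contraction, because `τ` is symmetric, trace-free and anticommutes
with `J`. This makes `τ` contract to zero, and also `Jτ`, which is again symmetric and trace-free
(`IsCliffordSystem.sum_curvature`). As in the Riemannian case the contraction is therefore a
multiple of `s = ∑ ⟨R(e_a, e_b) e_b, e_a⟩`, and the curvature term is `s / 4`.

Finally `W = s / 4`. The scalar `W` is a trace of `R` against `J` in both pairs of slots, and since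
`R` commutes with `J`, the Bianchi identity converts that trace into `-2 s`; its torsion terms drop
out because `J` is skew and `τ` symmetric (`sum_curvature_complex`, `websterScalar_eq`).

The frame of a spin structure need not be of the form `(u, Ju)`. All computations therefore use a
general orthonormal frame with the matrix `jCoeff` of `J`, and the unitary basis enters only through
the expansion of that matrix (`jCoeff_eq_sum`). -/

namespace CRSpin

open Bundle VectorField Filter FiberBundle
open scoped Manifold ContDiff Topology

/-! ### Vector fields as derivations, and the Lie bracket. -/

section Fields

variable {E : Type*} [NormedAddCommGroup E] [NormedSpace ℝ E]
  {H : Type*} [TopologicalSpace H] {I : ModelWithCorners ℝ E H}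
  {M : Type*} [TopologicalSpace M] [ChartedSpace H M]
  {F : Type*} [NormedAddCommGroup F] [NormedSpace ℝ F]

theorem mvfderiv_congr {f g : M → F} {x : M} (h : f =ᶠ[𝓝 x] g) :
    mvfderiv I f x = mvfderiv I g x := by
  ext v
  have h1 : mfderiv I 𝓘(ℝ, F) f x = mfderiv I 𝓘(ℝ, F) g x := h.mfderiv_eq
  have h2 := congrArg (fun L => (L v : F)) h1
  exact h2

theorem mvfderiv_clm_comp {G : Type*} [NormedAddCommGroup G] [NormedSpace ℝ G] (L : F →L[ℝ] G)
    {f : M → F} {x : M} (hf : MDifferentiableAt I 𝓘(ℝ, F) f x) (v : TangentSpace I x) :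
    mvfderiv I (fun y => L (f y)) x v = L (mvfderiv I f x v) := by
  have h := (L.hasMFDerivAt (x := f x)).comp x hf.hasMFDerivAt
  have h2 := congrArg (fun A => (A v : G)) h.mfderiv
  exact h2

variable [IsManifold I ∞ M]

theorem contMDiffAt_mvfderiv_apply {f : M → F} {X : Π x : M, TangentSpace I x} {x : M}
    (hf : ContMDiffAt I 𝓘(ℝ, F) ∞ f x) (hX : CMDiffAt ∞ (T% X) x) :
    ContMDiffAt I 𝓘(ℝ, F) ∞ (fun y => mvfderiv I f y (X y)) x := by
  have h1 := hf.mfderiv_const (m := ∞) (by simp)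
  have h2 := ContMDiffAt.clm_apply_of_inCoordinates (b₁ := id) (b₂ := f)
    (ϕ := fun y => mfderiv I 𝓘(ℝ, F) f y) (v := X) h1 hX hf
  exact ((contMDiff_snd_tangentBundle_modelSpace F 𝓘(ℝ, F)).contMDiffAt).comp x h2

theorem eventually_mdifferentiableAt {X : Π x : M, TangentSpace I x} {x : M}
    (hX : CMDiffAt ∞ (T% X) x) : ∀ᶠ y in 𝓝 x, MDiffAt (T% X) y :=
  ((contMDiffAt_iff_contMDiffAt_nhds (n := 1) (by simp)).1 (hX.of_le (by simp))).mono
    fun _ h => h.mdifferentiableAt one_ne_zero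

variable [CompleteSpace E]

theorem contMDiffAt_mlieBracket {X Y : Π x : M, TangentSpace I x} {x : M}
    (hX : CMDiffAt ∞ (T% X) x) (hY : CMDiffAt ∞ (T% Y) x) :
    CMDiffAt ∞ (T% (mlieBracket I X Y)) x := by
  have : IsManifold I (((⊤ : ℕ∞) : ℕ∞ω) + 1) M := by simpa
  have : IsManifold I (minSmoothness ℝ 2) M := by
    simp only [minSmoothness_of_isRCLikeNormedField]; infer_instance
  exact ContMDiffAt.mlieBracket_vectorField (m := ⊤) (n := ⊤) hX hY (by simp)

/-- The Jacobi identity for `X`, `Y`, `f • W` contains this identity as the coefficient of `W`. Once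
the brackets are expanded by the Leibniz rule, the first-order terms in `f` match, the terms without
derivatives of `f` cancel by the Jacobi identity for `X`, `Y`, `W`, and what is left is a multiple
of `W x`. It suffices that `W x ≠ 0`. -/
theorem mvfderiv_mlieBracket_real [Nontrivial E] {f : M → ℝ} {X Y : Π x : M, TangentSpace I x}
    {x : M} (hf : CMDiffAt ∞ f x) (hX : CMDiffAt ∞ (T% X) x) (hY : CMDiffAt ∞ (T% Y) x) :
    mvfderiv I (fun y => mvfderiv I f y (Y y)) x (X x)
      - mvfderiv I (fun y => mvfderiv I f y (X y)) x (Y x)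
      = mvfderiv I f x (mlieBracket I X Y x) := by
  have : IsManifold I (minSmoothness ℝ 2) M := by
    simp only [minSmoothness_of_isRCLikeNormedField]; infer_instance
  have : IsManifold I (minSmoothness ℝ 3) M := by
    simp only [minSmoothness_of_isRCLikeNormedField]
    exact IsManifold.of_le (n := ∞) ENat.LEInfty.out
  obtain ⟨w, hw⟩ := exists_ne (0 : E)
  let w' : TangentSpace I x := w
  set W : Π x : M, TangentSpace I x := extend E w'
  have hW : CMDiffAt ∞ (T% W) x := contMDiffAt_extend ..
  have hWx : W x = w' := extend_apply_self ..
  have d {Z : Π x : M, TangentSpace I x} (h : CMDiffAt ∞ (T% Z) x) : MDiffAt (T% Z) x :=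
    h.mdifferentiableAt (by simp)
  have df : MDiffAt f x := hf.mdifferentiableAt (by simp)
  have hfev : ∀ᶠ y in 𝓝 x, MDiffAt f y :=
    ((contMDiffAt_iff_contMDiffAt_nhds (n := 1) (by simp)).1 (hf.of_le (by simp))).mono
      fun _ h => h.mdifferentiableAt one_ne_zero
  have key {A B : Π x : M, TangentSpace I x} (hA : CMDiffAt ∞ (T% A) x)
      (hB : CMDiffAt ∞ (T% B) x) :
      mlieBracket I A (mlieBracket I B (f • W)) x
        = mvfderiv I (fun y => mvfderiv I f y (B y)) x (A x) • W x
          + mvfderiv I f x (B x) • mlieBracket I A W x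
          + (mvfderiv I f x (A x) • mlieBracket I B W x
          + f x • mlieBracket I A (mlieBracket I B W) x) := by
    have h1 : mlieBracket I B (f • W)
        =ᶠ[𝓝 x] ((fun y => mvfderiv I f y (B y)) • W + f • mlieBracket I B W) := by
      filter_upwards [hfev, eventually_mdifferentiableAt hW] with y h h'
      rw [mlieBracket_smul_right h h']
      rfl
    have hfB := contMDiffAt_mvfderiv_apply hf hB
    have hBW := contMDiffAt_mlieBracket hB hW
    rw [EventuallyEq.rfl.mlieBracket_vectorField_eq h1,
      mlieBracket_add_right (d (hfB.smul_section hW)) (d (hf.smul_section hBW)),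
      mlieBracket_smul_right (hfB.mdifferentiableAt (by simp)) (d hW),
      mlieBracket_smul_right df (d hBW)]
  have m2 : (2 : ℕ∞ω) ≤ ∞ := ENat.LEInfty.out
  have lt {Z : Π x : M, TangentSpace I x} (h : CMDiffAt ∞ (T% Z) x) :
      CMDiffAt (minSmoothness ℝ 2) (T% Z) x := h.of_le (by simpa using m2)
  have J1 := leibniz_identity_mlieBracket_apply (lt hX) (lt hY) (lt (hf.smul_section hW))
  have J2 := leibniz_identity_mlieBracket_apply (lt hX) (lt hY) (lt hW)
  rw [key hX hY, key hY hX, mlieBracket_smul_right df (d hW), J2] at J1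
  have h0 : (mvfderiv I (fun y => mvfderiv I f y (Y y)) x (X x)
      - mvfderiv I (fun y => mvfderiv I f y (X y)) x (Y x)
      - mvfderiv I f x (mlieBracket I X Y x)) • W x = 0 := by
    rw [sub_smul, sub_smul, sub_eq_zero, sub_eq_iff_eq_add]
    have J3 := sub_eq_zero.2 J1
    rw [← sub_eq_zero, ← J3]
    module
  rw [hWx] at h0
  have := (smul_eq_zero.1 h0).resolve_right hw
  linarith

/-- Continuous functionals separate points of `F` and commute with differentiation, which reduces
the claim to real-valued functions. -/
theorem mvfderiv_mlieBracket [Nontrivial E] {f : M → F} {X Y : Π x : M, TangentSpace I x} {x : M}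
    (hf : CMDiffAt ∞ f x) (hX : CMDiffAt ∞ (T% X) x) (hY : CMDiffAt ∞ (T% Y) x) :
    mvfderiv I (fun y => mvfderiv I f y (Y y)) x (X x)
      - mvfderiv I (fun y => mvfderiv I f y (X y)) x (Y x)
      = mvfderiv I f x (mlieBracket I X Y x) := by
  rw [SeparatingDual.eq_iff_forall_dual_eq (R := ℝ)]
  intro L
  have hfev : ∀ᶠ y in 𝓝 x, MDiffAt f y :=
    ((contMDiffAt_iff_contMDiffAt_nhds (n := 1) (by simp)).1 (hf.of_le (by simp))).mono
      fun _ h => h.mdifferentiableAt one_ne_zero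
  have hLf : CMDiffAt ∞ (fun y => L (f y)) x := L.contMDiff.contMDiffAt.comp x hf
  have key {A B : Π x : M, TangentSpace I x} (hB : CMDiffAt ∞ (T% B) x) :
      mvfderiv I (fun y => mvfderiv I (fun y => L (f y)) y (B y)) x (A x)
        = L (mvfderiv I (fun y => mvfderiv I f y (B y)) x (A x)) := by
    rw [← mvfderiv_clm_comp L ((contMDiffAt_mvfderiv_apply hf hB).mdifferentiableAt (by simp))]
    rw [mvfderiv_congr (g := fun y => L (mvfderiv I f y (B y)))]
    filter_upwards [hfev] with y h using mvfderiv_clm_comp L h _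
  rw [map_sub, ← key hX, ← key hY, ← mvfderiv_clm_comp L (hf.mdifferentiableAt (by simp))]
  exact mvfderiv_mlieBracket_real hLf hX hY

end Fields
end CRSpin

/-! ### Curvature of a connection on the tangent bundle and its tensoriality. -/

namespace CRSpin

open Bundle VectorField Filter FiberBundle
open scoped Manifold ContDiff Topology

section Connection

variable {E : Type*} [NormedAddCommGroup E] [NormedSpace ℝ E]
  {H : Type*} [TopologicalSpace H] {I : ModelWithCorners ℝ E H}
  {M : Type*} [TopologicalSpace M] [ChartedSpace H M] [IsManifold I ∞ M]
  (cov : CovariantDerivative I E (TangentSpace I : M → Type _))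

theorem cov_congr {X Y : Π x : M, TangentSpace I x} {x : M} (hX : MDiffAt (T% X) x)
    (h : ∀ᶠ y in 𝓝 x, X y = Y y) : cov X x = cov Y x := by
  have hY : MDiffAt (T% Y) x := hX.congr_of_eventuallyEq (h.mono fun y hy => by simp [hy])
  exact cov.isCovariantDerivativeOn.congr_of_eventuallyEq hX hY univ_mem h

theorem contMDiffOn_mdifferentiableAt {X : Π x : M, TangentSpace I x} {U : Set M} (hU : IsOpen U)
    (hX : CMDiff[U] ∞ (T% X)) {x : M} (hx : x ∈ U) : MDiffAt (T% X) x :=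
  (hX.contMDiffAt (hU.mem_nhds hx)).mdifferentiableAt (by simp)

/-- The curvature `∇_X ∇_Y Z - ∇_Y ∇_X Z - ∇_{[X, Y]} Z` of vector fields. -/
noncomputable def fieldCurvature (X Y Z : Π x : M, TangentSpace I x) (x : M) : TangentSpace I x :=
  cov (fun y => cov Z y (Y y)) x (X x) - cov (fun y => cov Z y (X y)) x (Y x)
    - cov Z x (mlieBracket I X Y x)

theorem fieldCurvature_swap (X Y Z : Π x : M, TangentSpace I x) (x : M) :
    fieldCurvature cov X Y Z x = -fieldCurvature cov Y X Z x := by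
  simp only [fieldCurvature]
  rw [mlieBracket_swap_apply, map_neg]
  abel

theorem fieldCurvature_congr {Z Z' X Y : Π x : M, TangentSpace I x} {U : Set M} (hU : IsOpen U)
    (hZ : CMDiff[U] ∞ (T% Z)) {x : M} (hx : x ∈ U) (h : ∀ y ∈ U, Z y = Z' y)
    (hX : MDiffAt (T% fun y => cov Z y (X y)) x) (hY : MDiffAt (T% fun y => cov Z y (Y y)) x) :
    fieldCurvature cov X Y Z x = fieldCurvature cov X Y Z' x := by
  have h1 {y} (hy : y ∈ U) : cov Z y = cov Z' y :=
    cov_congr cov (contMDiffOn_mdifferentiableAt hU hZ hy)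
      (by filter_upwards [hU.mem_nhds hy] using h)
  simp only [fieldCurvature, h1 hx]
  rw [cov_congr cov hX (Y := fun y => cov Z' y (X y)), cov_congr cov hY (Y := fun y => cov Z' y (Y y))]
  all_goals filter_upwards [hU.mem_nhds hx] with y hy using by rw [h1 hy]

variable [FiniteDimensional ℝ E] [T2Space M] {cov}

/-- Smoothness of the connection is available for globally smooth fields, while frames are only
local. A bump function supported in `U` and equal to one near `x` makes the field global without
changing its covariant derivative near `x`. -/
theorem contMDiffAt_cov_hom
    (hcov : CovariantDerivative.ContMDiffCovariantDerivative cov ∞)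
    {Z : Π x : M, TangentSpace I x} {U : Set M} (hU : IsOpen U)
    (hZ : CMDiff[U] ∞ (T% Z)) {x : M} (hx : x ∈ U) :
    ContMDiffAt I (I.prod 𝓘(ℝ, E →L[ℝ] E)) ∞ (fun y => TotalSpace.mk' (E →L[ℝ] E)
      (E := fun z : M => TangentSpace I z →L[ℝ] TangentSpace I z) y (cov Z y)) x := by
  obtain ⟨f, -, hf⟩ := (SmoothBumpFunction.nhds_basis_tsupport (I := I) x).mem_iff.1
    (hU.mem_nhds hx)
  have hfZ : CMDiff ∞ (T% ((f : M → ℝ) • Z)) :=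
    f.contMDiff.contMDiffOn.smul_section_of_tsupport hU hf hZ
  have h1 := (hcov.contMDiff.contMDiff (σ := (f : M → ℝ) • Z) (by simpa using hfZ.contMDiffOn))
  have h2 := h1.contMDiffAt (x := x) univ_mem
  refine h2.congr_of_eventuallyEq ?_
  have h3 : ∀ᶠ y in 𝓝 x, Z y = ((f : M → ℝ) • Z) y := by
    filter_upwards [f.eventuallyEq_one] with y hy
    simp [hy]
  filter_upwards [h3.eventually_nhds, hU.mem_nhds hx] with y hy hyU
  rw [cov_congr cov (contMDiffOn_mdifferentiableAt hU hZ hyU) hy]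

theorem contMDiffAt_cov
    (hcov : CovariantDerivative.ContMDiffCovariantDerivative cov ∞)
    {Z X : Π x : M, TangentSpace I x} {U : Set M} (hU : IsOpen U)
    (hZ : CMDiff[U] ∞ (T% Z)) {x : M} (hx : x ∈ U) (hX : CMDiffAt ∞ (T% X) x) :
    CMDiffAt ∞ (T% (fun y => cov Z y (X y))) x :=
  (contMDiffAt_cov_hom hcov hU hZ hx).clm_bundle_apply hX

theorem mdifferentiableAt_cov
    (hcov : CovariantDerivative.ContMDiffCovariantDerivative cov ∞)
    {Z X : Π x : M, TangentSpace I x} {U : Set M} (hU : IsOpen U)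
    (hZ : CMDiff[U] ∞ (T% Z)) {x : M} (hx : x ∈ U) (hX : MDiffAt (T% X) x) :
    MDiffAt (T% (fun y => cov Z y (X y))) x :=
  ((contMDiffAt_cov_hom hcov hU hZ hx).mdifferentiableAt (by simp)).clm_bundle_apply hX

theorem contMDiffOn_cov
    (hcov : CovariantDerivative.ContMDiffCovariantDerivative cov ∞)
    {Z X : Π x : M, TangentSpace I x} {U : Set M} (hU : IsOpen U)
    (hZ : CMDiff[U] ∞ (T% Z)) (hX : CMDiff[U] ∞ (T% X)) :
    CMDiff[U] ∞ (T% (fun y => cov Z y (X y))) := fun _ hx =>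
  (contMDiffAt_cov hcov hU hZ hx (hX.contMDiffAt (hU.mem_nhds hx))).contMDiffWithinAt

/-- The Leibniz term `-(Y f) ∇_X Z` coming from `∇_Y (f ∇_X Z)` is cancelled by the one in `[f X, Y]
= f [X, Y] - (Y f) X`. -/
theorem fieldCurvature_tensorialAt_left
    (hcov : CovariantDerivative.ContMDiffCovariantDerivative cov ∞)
    {Z : Π x : M, TangentSpace I x} {U : Set M} (hU : IsOpen U)
    (hZ : CMDiff[U] ∞ (T% Z)) {x : M} (hx : x ∈ U) (Y : Π x : M, TangentSpace I x) :
    TensorialAt I E (fun X => fieldCurvature cov X Y Z x) x where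
  smul {f X} hf hX := by
    have h1 : (fun y => cov Z y ((f • X) y)) = f • fun y => cov Z y (X y) := by
      funext y; simp
    have h2 := cov.isCovariantDerivativeOn.leibniz (s := Set.univ)
      (mdifferentiableAt_cov hcov hU hZ hx hX) hf
    simp only [fieldCurvature, h1, h2, mlieBracket_smul_left hf hX]
    simp
    module
  add {X X'} hX hX' := by
    have h1 : (fun y => cov Z y ((X + X') y)) = (fun y => cov Z y (X y)) + fun y => cov Z y (X' y) := by
      funext y; simp
    have h2 := cov.isCovariantDerivativeOn.add (s := Set.univ)
      (mdifferentiableAt_cov hcov hU hZ hx hX) (mdifferentiableAt_cov hcov hU hZ hx hX')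
    simp only [fieldCurvature, h1, h2, mlieBracket_add_left hX hX']
    simp
    abel

theorem fieldCurvature_tensorialAt_right
    (hcov : CovariantDerivative.ContMDiffCovariantDerivative cov ∞)
    {Z : Π x : M, TangentSpace I x} {U : Set M} (hU : IsOpen U)
    (hZ : CMDiff[U] ∞ (T% Z)) {x : M} (hx : x ∈ U) (X : Π x : M, TangentSpace I x) :
    TensorialAt I E (fun Y => fieldCurvature cov X Y Z x) x where
  smul {f Y} hf hY := by
    simp only [fieldCurvature_swap cov X]
    rw [(fieldCurvature_tensorialAt_left hcov hU hZ hx X).smul hf hY, smul_neg]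
  add {Y Y'} hY hY' := by
    simp only [fieldCurvature_swap cov X]
    rw [(fieldCurvature_tensorialAt_left hcov hU hZ hx X).add hY hY', neg_add]

/-- The curvature of a connection, applied to a fixed smooth local vector field. -/
noncomputable def curvatureHom
    (hcov : CovariantDerivative.ContMDiffCovariantDerivative cov ∞)
    {Z : Π x : M, TangentSpace I x} {U : Set M} (hU : IsOpen U)
    (hZ : CMDiff[U] ∞ (T% Z)) {x : M} (hx : x ∈ U) :
    TangentSpace I x →L[ℝ] TangentSpace I x →L[ℝ] TangentSpace I x :=
  TensorialAt.mkHom₂ (fun X Y => fieldCurvature cov X Y Z x) x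
    (fun Y _ => fieldCurvature_tensorialAt_left hcov hU hZ hx Y)
    (fun X _ => fieldCurvature_tensorialAt_right hcov hU hZ hx X)

theorem curvatureHom_apply
    (hcov : CovariantDerivative.ContMDiffCovariantDerivative cov ∞)
    {Z : Π x : M, TangentSpace I x} {U : Set M} (hU : IsOpen U)
    (hZ : CMDiff[U] ∞ (T% Z)) {x : M} (hx : x ∈ U) {X Y : Π x : M, TangentSpace I x}
    (hX : MDiffAt (T% X) x) (hY : MDiffAt (T% Y) x) :
    curvatureHom hcov hU hZ hx (X x) (Y x) = fieldCurvature cov X Y Z x :=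
  TensorialAt.mkHom₂_apply _ _ hX hY

theorem fieldCurvature_add
    (hcov : CovariantDerivative.ContMDiffCovariantDerivative cov ∞)
    {Z Z' X Y : Π x : M, TangentSpace I x} {U : Set M} (hU : IsOpen U)
    (hZ : CMDiff[U] ∞ (T% Z)) (hZ' : CMDiff[U] ∞ (T% Z')) {x : M} (hx : x ∈ U)
    (hX : MDiffAt (T% X) x) (hY : MDiffAt (T% Y) x) :
    fieldCurvature cov X Y (Z + Z') x = fieldCurvature cov X Y Z x + fieldCurvature cov X Y Z' x := by
  have key {A B : Π x : M, TangentSpace I x} (hA : MDiffAt (T% A) x) :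
      cov (fun y => cov (Z + Z') y (A y)) x (B x)
        = cov (fun y => cov Z y (A y)) x (B x) + cov (fun y => cov Z' y (A y)) x (B x) := by
    have h1 : ∀ᶠ y in 𝓝 x, ((fun y => cov Z y (A y)) + fun y => cov Z' y (A y)) y
        = cov (Z + Z') y (A y) := by
      filter_upwards [hU.mem_nhds hx] with y hy
      rw [cov.isCovariantDerivativeOn.add (s := Set.univ)
        (contMDiffOn_mdifferentiableAt hU hZ hy) (contMDiffOn_mdifferentiableAt hU hZ' hy)]
      simp
    have d1 := mdifferentiableAt_cov hcov hU hZ hx hA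
    have d2 := mdifferentiableAt_cov hcov hU hZ' hx hA
    rw [← cov_congr cov (mdifferentiableAt_add_section d1 d2) h1,
      cov.isCovariantDerivativeOn.add (s := Set.univ) d1 d2]
    simp
  simp only [fieldCurvature, key hX, key hY]
  rw [cov.isCovariantDerivativeOn.add (s := Set.univ)
        (contMDiffOn_mdifferentiableAt hU hZ hx) (contMDiffOn_mdifferentiableAt hU hZ' hx)]
  simp
  abel

/-- The mixed first-order terms are symmetric in `X` and `Y` and cancel; the second-order terms
cancel because `X (Y f) - Y (X f) = [X, Y] f`. -/
theorem fieldCurvature_smul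
    (hcov : CovariantDerivative.ContMDiffCovariantDerivative cov ∞)
    [Nontrivial E] {f : M → ℝ} {Z X Y : Π x : M, TangentSpace I x} {U : Set M}
    (hU : IsOpen U) (hf : CMDiff[U] ∞ f)
    (hZ : CMDiff[U] ∞ (T% Z)) {x : M} (hx : x ∈ U)
    (hX : CMDiffAt ∞ (T% X) x) (hY : CMDiffAt ∞ (T% Y) x) :
    fieldCurvature cov X Y (f • Z) x = f x • fieldCurvature cov X Y Z x := by
  have hfa {y} (hy : y ∈ U) : CMDiffAt ∞ f y := hf.contMDiffAt (hU.mem_nhds hy)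
  have dfa {y} (hy : y ∈ U) : MDiffAt f y := (hfa hy).mdifferentiableAt (by simp)
  have dZ {y} (hy : y ∈ U) : MDiffAt (T% Z) y := contMDiffOn_mdifferentiableAt hU hZ hy
  have key {A B : Π x : M, TangentSpace I x} (hA : CMDiffAt ∞ (T% A) x) :
      cov (fun y => cov (f • Z) y (A y)) x (B x)
        = f x • cov (fun y => cov Z y (A y)) x (B x) + mvfderiv I f x (B x) • cov Z x (A x)
          + (mvfderiv I f x (A x) • cov Z x (B x)
          + mvfderiv I (fun y => mvfderiv I f y (A y)) x (B x) • Z x) := by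
    have h1 : ∀ᶠ y in 𝓝 x, ((f • fun y => cov Z y (A y)) + (fun y => mvfderiv I f y (A y)) • Z) y
        = cov (f • Z) y (A y) := by
      filter_upwards [hU.mem_nhds hx] with y hy
      rw [cov.isCovariantDerivativeOn.leibniz (s := Set.univ) (dZ hy) (dfa hy)]
      simp
    have d1 := mdifferentiableAt_cov hcov hU hZ hx (hA.mdifferentiableAt (by simp))
    have d2 := (contMDiffAt_mvfderiv_apply (hfa hx) hA).mdifferentiableAt (by simp)
    have d3 := (dfa hx).smul_section d1
    have d4 := d2.smul_section (dZ hx)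
    rw [← cov_congr cov (mdifferentiableAt_add_section d3 d4) h1,
      cov.isCovariantDerivativeOn.add (s := Set.univ) d3 d4,
      cov.isCovariantDerivativeOn.leibniz (s := Set.univ) d1 (dfa hx),
      cov.isCovariantDerivativeOn.leibniz (s := Set.univ) (dZ hx) d2]
    simp
  have hc := mvfderiv_mlieBracket (hfa hx) hX hY
  simp only [fieldCurvature, key hX, key hY]
  rw [cov.isCovariantDerivativeOn.leibniz (s := Set.univ) (dZ hx) (dfa hx)]
  simp only [_root_.add_apply, _root_.smul_apply,
    ContinuousLinearMap.smulRight_apply, ← hc]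
  module

theorem fieldCurvature_sum
    (hcov : CovariantDerivative.ContMDiffCovariantDerivative cov ∞)
    [Nontrivial E] {ι : Type*} {s : Finset ι} {f : ι → M → ℝ}
    {Z : ι → Π x : M, TangentSpace I x} {X Y : Π x : M, TangentSpace I x} {U : Set M}
    (hU : IsOpen U) (hf : ∀ i, CMDiff[U] ∞ (f i))
    (hZ : ∀ i, CMDiff[U] ∞ (T% (Z i))) {x : M} (hx : x ∈ U)
    (hX : CMDiffAt ∞ (T% X) x) (hY : CMDiffAt ∞ (T% Y) x) :
    fieldCurvature cov X Y (fun y => ∑ i ∈ s, f i y • Z i y) x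
      = ∑ i ∈ s, f i x • fieldCurvature cov X Y (Z i) x := by
  classical
  induction s using Finset.induction_on with
  | empty =>
    have h0 : (fun y : M => (0 : TangentSpace I y)) = 0 := rfl
    have h1 : cov 0 = 0 := cov.zero
    simp [fieldCurvature, h0, h1]
  | insert a s ha ih =>
    simp only [Finset.sum_insert ha]
    rw [← ih, ← fieldCurvature_smul hcov hU (hf a) (hZ a) hx hX hY]
    exact fieldCurvature_add hcov hU ((hf a).smul_section (hZ a))
      (.sum_section fun i _ => (hf i).smul_section (hZ i)) hx
      (hX.mdifferentiableAt (by simp)) (hY.mdifferentiableAt (by simp))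

end Connection
end CRSpin

/-! ### Algebra of Clifford contractions. -/

namespace CRSpin

section CliffordIdentities

variable {ι A : Type*} [Ring A] [Algebra ℝ A]

/-- The relations `g_a g_b + g_b g_a = -2 δ_ab` of an orthonormal system in a Clifford algebra. -/
def IsCliffordSystem [DecidableEq ι] (g : ι → A) : Prop :=
  ∀ a b, g a * g b + g b * g a = if a = b then (-2 : ℝ) • (1 : A) else 0

section

variable [Fintype ι]

/-- The image `¼ ∑ M_ab g_a g_b` of a matrix under the spin representation. -/
noncomputable def spinOf (g : ι → A) (M : ι → ι → ℝ) : A :=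
  (1 / 4 : ℝ) • ∑ a, ∑ b, M a b • (g a * g b)

theorem sum_rotate {B : Type*} [AddCommMonoid B] (f : ι → ι → ι → B) :
    ∑ a, ∑ b, ∑ c, f b c a = ∑ a, ∑ b, ∑ c, f a b c := by
  rw [Finset.sum_comm]
  exact Finset.sum_congr rfl fun b _ => Finset.sum_comm

end

namespace IsCliffordSystem

variable {g : ι → A} [DecidableEq ι]

theorem mul_swap (hg : IsCliffordSystem g) (a b : ι) :
    g a * g b = -(g b * g a) + if a = b then (-2 : ℝ) • (1 : A) else 0 := by
  rw [← hg a b]; abel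

theorem mul_mul_comm (hg : IsCliffordSystem g) (a b c : ι) :
    g a * g b * g c = g c * (g a * g b) + (2 : ℝ) • (if a = c then g b else 0)
      - (2 : ℝ) • (if b = c then g a else 0) := by
  have h1 : g a * g b * g c = g a * (g b * g c) := mul_assoc ..
  have h2 : g a * (g c * g b) = g a * g c * g b := (mul_assoc ..).symm
  rw [h1, hg.mul_swap b c, mul_add, mul_neg, h2, hg.mul_swap a c]
  split_ifs <;> simp [add_mul, mul_assoc] <;> module

variable [Fintype ι]

/-- Adding the sum to its transpose replaces `g a * g b` by half the anticommutator, which is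
supported on the diagonal. -/
theorem sum_symm (hg : IsCliffordSystem g) {S : ι → ι → ℝ} (hS : ∀ a b, S a b = S b a) :
    ∑ a, ∑ b, S a b • (g a * g b) = (-∑ a, S a a) • (1 : A) := by
  have h : (2 : ℝ) • ∑ a, ∑ b, S a b • (g a * g b) = (2 : ℝ) • ((-∑ a, S a a) • (1 : A)) := by
    have h1 : ∑ a, ∑ b, S a b • (g a * g b) = ∑ a, ∑ b, S a b • (g b * g a) := by
      rw [Finset.sum_comm]
      exact Finset.sum_congr rfl fun a _ => Finset.sum_congr rfl fun b _ => by rw [hS]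
    rw [two_smul]
    nth_rewrite 2 [h1]
    simp only [← Finset.sum_add_distrib, ← smul_add, hg _ _, smul_ite, smul_zero,
      Finset.sum_ite_eq, Finset.mem_univ, if_true, smul_smul, ← Finset.sum_smul]
    rw [← Finset.sum_mul]
    ring_nf
  exact smul_right_injective _ (two_ne_zero' ℝ) h

/-- This is the infinitesimal double covering: the commutator with the spin image of a skew matrix
acts on vectors as the matrix itself. It makes Clifford multiplication parallel. -/
theorem spinOf_mul (hg : IsCliffordSystem g) {M : ι → ι → ℝ} (hM : ∀ a b, M a b = -M b a) (e : ι) :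
    spinOf g M * g e = g e * spinOf g M + ∑ c, M e c • g c := by
  have h1 : ∑ c, ∑ d, M c d • (2 : ℝ) • (if c = e then g d else 0) = (2 : ℝ) • ∑ c, M e c • g c := by
    rw [Finset.sum_comm]
    simp [Finset.smul_sum, smul_smul, mul_comm]
  have h2 : ∑ c, ∑ d, M c d • (2 : ℝ) • (if d = e then g c else 0) = (-2 : ℝ) • ∑ c, M e c • g c := by
    simp [Finset.smul_sum, smul_smul, mul_comm, hM _ e]
  simp only [spinOf, smul_mul_assoc, mul_smul_comm, Finset.sum_mul, Finset.mul_sum,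
    hg.mul_mul_comm _ _ e, smul_add, smul_sub, Finset.sum_add_distrib, Finset.sum_sub_distrib, h1, h2]
  module

/-- The commutator with `spinOf g M` is a derivation, so its action on vectors determines its action
on the products in `spinOf g N`. The result is the image of `N M - M N`: the order is reversed
because row `a` of a matrix holds the image of the vector `a`. -/
theorem spinOf_commutator (hg : IsCliffordSystem g) {M N : ι → ι → ℝ} (hM : ∀ a b, M a b = -M b a) :
    spinOf g M * spinOf g N - spinOf g N * spinOf g M
      = spinOf g fun c d => ∑ e, (N c e * M e d - M c e * N e d) := by
  have h (e f : ι) : spinOf g M * (g e * g f) = (g e * g f) * spinOf g M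
      + (∑ d, M f d • (g e * g d) + ∑ c, M e c • (g c * g f)) := by
    rw [← mul_assoc, hg.spinOf_mul hM, add_mul, mul_assoc, hg.spinOf_mul hM, mul_add]
    simp only [Finset.mul_sum, Finset.sum_mul, mul_smul_comm, smul_mul_assoc, mul_assoc]
    abel
  have h0 : spinOf g N = (1 / 4 : ℝ) • ∑ a, ∑ b, N a b • (g a * g b) := rfl
  have h1 : ∑ e, ∑ f, N e f • ∑ d, M f d • (g e * g d)
      = ∑ c, ∑ d, (∑ e, N c e * M e d) • (g c * g d) := by
    refine Finset.sum_congr rfl fun c _ => ?_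
    simp only [Finset.smul_sum, Finset.sum_smul, smul_smul]
    exact Finset.sum_comm
  have h2 : ∑ e, ∑ f, N e f • ∑ c, M e c • (g c * g f)
      = ∑ c, ∑ d, (-∑ e, M c e * N e d) • (g c * g d) := by
    simp only [Finset.smul_sum, smul_smul, Finset.sum_smul, ← Finset.sum_neg_distrib]
    rw [← sum_rotate]
    refine Finset.sum_congr rfl fun c _ => ?_
    rw [Finset.sum_comm]
    refine Finset.sum_congr rfl fun d _ => Finset.sum_congr rfl fun e _ => ?_
    rw [hM c e]; ring_nf
  rw [h0]
  simp only [mul_smul_comm, smul_mul_assoc, Finset.mul_sum, Finset.sum_mul, h, smul_add,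
    Finset.sum_add_distrib, h1, h2]
  have h3 : spinOf g (fun c d => ∑ e, (N c e * M e d - M c e * N e d))
      = (1 / 4 : ℝ) • (∑ c, ∑ d, (∑ e, N c e * M e d) • (g c * g d)
        + ∑ c, ∑ d, (-∑ e, M c e * N e d) • (g c * g d)) := by
    simp only [spinOf, ← Finset.sum_add_distrib, ← add_smul, ← sub_eq_add_neg,
      Finset.sum_sub_distrib]
  rw [h3]
  module

/-- A cyclic permutation of three Clifford factors changes the product only by terms with a single
factor. Averaging over the three rotations exposes the cyclic sum of `X`, which the Bianchi identity
evaluates, at the price of the trace `∑ X a b b • g a`. Skewness in the first two indices kills the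
trace `X a a b` and identifies the others up to sign. -/
theorem sum_mul_mul (hg : IsCliffordSystem g) {X : ι → ι → ι → ℝ} (hX : ∀ a b c, X a b c = -X b a c) :
    (3 : ℝ) • ∑ a, ∑ b, ∑ c, X a b c • (g a * g b * g c)
      = ∑ a, ∑ b, ∑ c, (X a b c + X b c a + X c a b) • (g a * g b * g c)
        - (6 : ℝ) • ∑ a, ∑ b, X a b b • g a := by
  have r1 (a b c : ι) : g b * g c * g a = g a * g b * g c + (2 : ℝ) • (if b = a then g c else 0)
      - (2 : ℝ) • (if c = a then g b else 0) := by
    rw [hg.mul_mul_comm b c a, ← mul_assoc]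
  have r2 (a b c : ι) : g c * g a * g b = g a * g b * g c - (2 : ℝ) • (if a = c then g b else 0)
      + (2 : ℝ) • (if b = c then g a else 0) := by
    rw [hg.mul_mul_comm a b c, ← mul_assoc]; abel
  have s1 : ∑ a, ∑ b, ∑ c, X a b c • (g a * g b * g c)
      = ∑ a, ∑ b, ∑ c, X b c a • (g a * g b * g c) - (4 : ℝ) • ∑ a, ∑ b, X a b b • g a := by
    have r (a b c : ι) : X b c a • (g b * g c * g a) = X b c a • (g a * g b * g c)
        + X b c a • (2 : ℝ) • (if b = a then g c else 0)
        - X b c a • (2 : ℝ) • (if c = a then g b else 0) := by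
      rw [r1 a b c, smul_sub, smul_add]
    rw [← sum_rotate]
    simp only [r, Finset.sum_add_distrib, Finset.sum_sub_distrib]
    have t1 : ∑ a, ∑ b, ∑ c, X b c a • (2 : ℝ) • (if b = a then g c else 0)
        = (-2 : ℝ) • ∑ a, ∑ b, X a b b • g a := by
      have t (a : ι) : ∑ b, ∑ c, X b c a • (2 : ℝ) • (if b = a then g c else 0)
          = (-2 : ℝ) • ∑ c, X c a a • g c := by
        rw [Finset.sum_comm]
        simp [Finset.smul_sum, smul_smul, hX a _ a, mul_comm]
      simp only [t, ← Finset.smul_sum]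
      rw [Finset.sum_comm]
    have t2 : ∑ a, ∑ b, ∑ c, X b c a • (2 : ℝ) • (if c = a then g b else 0)
        = (2 : ℝ) • ∑ a, ∑ b, X a b b • g a := by
      simp only [smul_ite, smul_zero, Finset.sum_ite_eq', Finset.mem_univ, if_true]
      rw [Finset.sum_comm]
      simp only [Finset.smul_sum, smul_comm (2 : ℝ)]
    rw [t1, t2]
    module
  have s2 : ∑ a, ∑ b, ∑ c, X a b c • (g a * g b * g c)
      = ∑ a, ∑ b, ∑ c, X c a b • (g a * g b * g c) - (2 : ℝ) • ∑ a, ∑ b, X a b b • g a := by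
    have r (a b c : ι) : X c a b • (g c * g a * g b) = X c a b • (g a * g b * g c)
        - X c a b • (2 : ℝ) • (if a = c then g b else 0)
        + X c a b • (2 : ℝ) • (if b = c then g a else 0) := by
      rw [r2 a b c, smul_add, smul_sub]
    rw [← sum_rotate, ← sum_rotate]
    simp only [r, Finset.sum_add_distrib, Finset.sum_sub_distrib]
    have t1 : ∑ a, ∑ b, ∑ c, X c a b • (2 : ℝ) • (if b = c then g a else 0)
        = (-2 : ℝ) • ∑ a, ∑ b, X a b b • g a := by
      simp only [smul_ite, smul_zero, Finset.sum_ite_eq, Finset.mem_univ, if_true, Finset.smul_sum]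
      refine Finset.sum_congr rfl fun a _ => Finset.sum_congr rfl fun b _ => ?_
      rw [hX b a b]
      module
    have t2 : ∑ a, ∑ b, ∑ c, X c a b • (2 : ℝ) • (if a = c then g b else 0) = 0 := by
      have h0 (a b : ι) : X a a b = 0 := by have := hX a a b; linarith
      simp [h0]
    rw [t1, t2]
    module
  simp only [add_smul, Finset.sum_add_distrib]
  set Q := ∑ a, ∑ b, X a b b • g a
  set S := ∑ a, ∑ b, ∑ c, X a b c • (g a * g b * g c)
  set S₁ := ∑ a, ∑ b, ∑ c, X b c a • (g a * g b * g c)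
  set S₂ := ∑ a, ∑ b, ∑ c, X c a b • (g a * g b * g c)
  calc (3 : ℝ) • S = S + S + S := by module
    _ = S + (S₁ - (4 : ℝ) • Q) + (S₂ - (2 : ℝ) • Q) := by rw [← s1, ← s2]
    _ = _ := by module

/-- The Clifford contraction of a curvature tensor with torsion. -/
theorem sum_curvature (hg : IsCliffordSystem g) {R : ι → ι → ι → ι → ℝ} {w t : ι → ι → ℝ}
    (hR : ∀ a b c d, R a b c d = -R b a c d) (hR' : ∀ a b c d, R a b c d = -R a b d c)
    (hw : ∀ a b, w a b = -w b a) (ht : ∀ a b, t a b = t b a) (ht0 : ∑ a, t a a = 0)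
    (hwt : ∀ a b, ∑ c, w a c * t c b = -∑ c, t a c * w c b)
    (bianchi : ∀ a b c d, R a b c d + R b c a d + R c a b d
      = w a b * t c d + w b c * t a d + w c a * t b d) :
    ∑ a, ∑ b, ∑ c, ∑ d, R a b c d • (g a * g b * g c * g d)
      = (2 * ∑ a, ∑ b, R a b b a) • (1 : A) := by
  -- The product of a skew and a symmetric matrix that anticommute is symmetric; its trace vanishes
  -- because `tr (w t) = -tr (t w)`.
  have hwt' (a b : ι) : ∑ c, w a c * t c b = ∑ c, w b c * t c a := by
    rw [hwt a b, ← Finset.sum_neg_distrib]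
    exact Finset.sum_congr rfl fun c _ => by rw [ht a c, hw c b]; ring
  have htr : ∑ a, ∑ c, w a c * t c a = 0 := by
    have h1 : ∑ a, ∑ c, w a c * t c a = -∑ a, ∑ c, t a c * w c a := by
      simp only [hwt, Finset.sum_neg_distrib]
    have h2 : ∑ a, ∑ c, t a c * w c a = ∑ a, ∑ c, w a c * t c a := by
      rw [Finset.sum_comm]
      exact Finset.sum_congr rfl fun a _ => Finset.sum_congr rfl fun c _ => mul_comm ..
    linarith
  -- With torsion, symmetry of the Ricci contraction is not automatic. The trace of the Bianchi
  -- identity leaves `tr t` and a difference of the products `w t` and its transpose, and both are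
  -- zero.
  have hric (a d : ι) : ∑ b, R a b b d = ∑ b, R d b b a := by
    have h1 : ∑ b, (R a d b b + R d b a b + R b a d b)
        = ∑ b, (w a d * t b b + w d b * t a b + w b a * t d b) :=
      Finset.sum_congr rfl fun b _ => bianchi a d b b
    have h2 : ∑ b, (w a d * t b b + w d b * t a b + w b a * t d b) = 0 := by
      rw [Finset.sum_add_distrib, Finset.sum_add_distrib, ← Finset.mul_sum, ht0, mul_zero, zero_add]
      have e1 : ∑ b, w d b * t a b = ∑ b, w d b * t b a :=
        Finset.sum_congr rfl fun b _ => by rw [ht]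
      have e2 : ∑ b, w b a * t d b = -∑ b, w a b * t b d := by
        rw [← Finset.sum_neg_distrib]
        exact Finset.sum_congr rfl fun b _ => by rw [ht, hw]; ring
      rw [e1, e2, hwt' d a]; ring
    rw [h2] at h1
    have h3 : ∑ b, (R a d b b + R d b a b + R b a d b) = ∑ b, (R a b b d - R d b b a) := by
      refine Finset.sum_congr rfl fun b _ => ?_
      have e1 := hR' a d b b
      have e2 := hR' d b a b
      have e3 := hR b a d b
      have e4 := hR' a b d b
      linarith
    rw [h3, Finset.sum_sub_distrib] at h1
    linarith
  have htt : ∑ c, ∑ d, t c d • (g c * g d) = 0 := by rw [hg.sum_symm ht, ht0]; simp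
  have hwts : ∑ a, ∑ d, (∑ c, w a c * t c d) • (g a * g d) = 0 := by
    rw [hg.sum_symm hwt', htr]; simp
  have hO : ∑ a, ∑ b, w a b • (g a * g b) = (4 : ℝ) • spinOf g w := by
    rw [spinOf, smul_smul]; norm_num
  have T1 : ∑ a, ∑ b, ∑ c, ∑ d, (w a b * t c d) • (g a * g b * g c * g d) = 0 := by
    have : ∑ a, ∑ b, ∑ c, ∑ d, (w a b * t c d) • (g a * g b * g c * g d)
        = (∑ a, ∑ b, w a b • (g a * g b)) * ∑ c, ∑ d, t c d • (g c * g d) := by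
      simp only [Finset.sum_mul]
      simp only [Finset.mul_sum, smul_mul_smul_comm, mul_assoc]
    rw [this, htt, mul_zero]
  -- The factor `w` sits between the two indices of `t`. Moving it to the left past `g d` leaves the
  -- contraction of `t`, which is zero, and a commutator term that is the contraction of `t w = -w
  -- t`, symmetric and trace-free.
  have T2 : ∑ a, ∑ b, ∑ c, ∑ d, (w b c * t a d) • (g a * g b * g c * g d) = 0 := by
    have e1 : ∑ a, ∑ b, ∑ c, ∑ d, (w b c * t a d) • (g a * g b * g c * g d)
        = ∑ a, ∑ d, t a d • (g a * ((∑ b, ∑ c, w b c • (g b * g c)) * g d)) := by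
      refine Finset.sum_congr rfl fun a _ => ?_
      simp only [Finset.sum_mul, Finset.mul_sum, Finset.smul_sum, smul_mul_assoc, mul_smul_comm,
        smul_smul, mul_assoc]
      rw [← sum_rotate]
      exact Finset.sum_congr rfl fun d _ => Finset.sum_congr rfl fun b _ =>
        Finset.sum_congr rfl fun c _ => by rw [mul_comm (w b c)]
    have e2 : ∑ a, ∑ d, t a d • (g a * ((∑ b, ∑ c, w b c • (g b * g c)) * g d))
        = (∑ a, ∑ d, t a d • (g a * g d)) * ((4 : ℝ) • spinOf g w)
          + (4 : ℝ) • ∑ a, ∑ d, ∑ c, (t a d * w d c) • (g a * g c) := by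
      simp only [hO, smul_mul_assoc, hg.spinOf_mul hw, Finset.sum_mul, Finset.smul_sum,
        ← Finset.sum_add_distrib]
      refine Finset.sum_congr rfl fun a _ => Finset.sum_congr rfl fun d _ => ?_
      rw [mul_smul_comm, mul_add, Finset.mul_sum, mul_smul_comm, ← mul_assoc]
      simp only [mul_smul_comm, smul_add, Finset.smul_sum, smul_smul]
      simp only [mul_comm, mul_left_comm, mul_assoc]
    have e3 : ∑ a, ∑ d, ∑ c, (t a d * w d c) • (g a * g c)
        = -∑ a, ∑ d, (∑ c, w a c * t c d) • (g a * g d) := by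
      rw [← Finset.sum_neg_distrib]
      refine Finset.sum_congr rfl fun a _ => ?_
      rw [Finset.sum_comm, ← Finset.sum_neg_distrib]
      refine Finset.sum_congr rfl fun c _ => ?_
      rw [← Finset.sum_smul, hwt a c, neg_smul, neg_neg]
    rw [e1, e2, e3, htt, hwts]; simp
  -- Here the indices of `w` and `t` interlace. Exchanging `g b` and `g c` gives a product of
  -- separate contractions plus a diagonal term, which is again the contraction of `w t`.
  have T3 : ∑ a, ∑ b, ∑ c, ∑ d, (w c a * t b d) • (g a * g b * g c * g d) = 0 := by
    have r (a b c d : ι) : (w c a * t b d) • (g a * g b * g c * g d)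
        = (w a c * t b d) • (g a * g c * (g b * g d))
          + if b = c then (2 * (w a c * t b d)) • (g a * g d) else 0 := by
      have : g a * g b * g c = -(g a * g c * g b) + if b = c then (-2 : ℝ) • g a else 0 := by
        rw [mul_assoc, hg.mul_swap b c, mul_add, mul_neg, mul_assoc]
        split_ifs <;> simp
      rw [this, add_mul, hw c a, neg_mul (g a * g c * g b), mul_assoc (g a * g c)]
      split_ifs
      · rw [smul_mul_assoc]; module
      · simp
    have e1 : ∑ a, ∑ b, ∑ c, ∑ d, (w a c * t b d) • (g a * g c * (g b * g d))
        = (∑ a, ∑ c, w a c • (g a * g c)) * ∑ b, ∑ d, t b d • (g b * g d) := by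
      simp only [Finset.sum_mul]
      simp only [Finset.mul_sum, smul_mul_smul_comm]
      exact Finset.sum_congr rfl fun a _ => Finset.sum_comm
    have e2 : ∑ a, ∑ b, ∑ c, ∑ d, (if b = c then (2 * (w a c * t b d)) • (g a * g d) else 0)
        = (2 : ℝ) • ∑ a, ∑ d, (∑ c, w a c * t c d) • (g a * g d) := by
      rw [Finset.smul_sum]
      refine Finset.sum_congr rfl fun a _ => ?_
      have (b : ι) : ∑ c, ∑ d, (if b = c then (2 * (w a c * t b d)) • (g a * g d) else 0)
          = ∑ d, (2 * (w a b * t b d)) • (g a * g d) := by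
        rw [Finset.sum_comm]; simp
      simp only [this]
      rw [Finset.sum_comm, Finset.smul_sum]
      refine Finset.sum_congr rfl fun d _ => ?_
      rw [← Finset.sum_smul, ← Finset.mul_sum, mul_smul]
    simp only [r, Finset.sum_add_distrib, e1, e2, htt, hwts]
    simp
  -- The last index `d` is a spectator while the first three are rotated.
  have main (d : ι) := congrArg (· * g d) (hg.sum_mul_mul (X := fun a b c => R a b c d)
    fun a b c => hR a b c d)
  simp only [bianchi, sub_mul, smul_mul_assoc, Finset.sum_mul] at main
  have rot4 (f : ι → ι → ι → ι → A) :
      ∑ d, ∑ a, ∑ b, ∑ c, f a b c d = ∑ a, ∑ b, ∑ c, ∑ d, f a b c d := by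
    rw [Finset.sum_comm]
    refine Finset.sum_congr rfl fun a _ => ?_
    rw [Finset.sum_comm]
    exact Finset.sum_congr rfl fun b _ => Finset.sum_comm
  have total : (3 : ℝ) • ∑ a, ∑ b, ∑ c, ∑ d, R a b c d • (g a * g b * g c * g d)
      = ∑ a, ∑ b, ∑ c, ∑ d, (w a b * t c d + w b c * t a d + w c a * t b d)
          • (g a * g b * g c * g d) - (6 : ℝ) • ∑ d, ∑ a, ∑ b, R a b b d • (g a * g d) := by
    rw [← rot4 fun a b c d => R a b c d • (g a * g b * g c * g d),
      ← rot4 fun a b c d => (w a b * t c d + w b c * t a d + w c a * t b d)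
        • (g a * g b * g c * g d), Finset.smul_sum, Finset.smul_sum, ← Finset.sum_sub_distrib]
    exact Finset.sum_congr rfl fun d _ => main d
  simp only [add_smul, Finset.sum_add_distrib, T1, T2, T3] at total
  have e : ∑ d, ∑ a, ∑ b, R a b b d • (g a * g d)
      = (-∑ a, ∑ b, R a b b a) • (1 : A) := by
    rw [← hg.sum_symm hric, Finset.sum_comm]
    simp only [Finset.sum_smul]
  rw [e] at total
  refine smul_right_injective A (three_ne_zero' ℝ) ?_
  simp only [total]
  module

end IsCliffordSystem
/-- The two traces of a curvature tensor of Kähler type, with torsion. -/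
theorem sum_curvature_complex {ι : Type*} [Fintype ι] [DecidableEq ι] {R : ι → ι → ι → ι → ℝ} {j t : ι → ι → ℝ}
    (hR : ∀ a b c d, R a b c d = -R b a c d) (hR' : ∀ a b c d, R a b c d = -R a b d c)
    (hj : ∀ a b, j a b = -j b a) (ht : ∀ a b, t a b = t b a)
    (hj2 : ∀ a b, ∑ c, j a c * j c b = if a = b then -1 else 0)
    (hRj : ∀ a b c d, ∑ e, j c e * R a b e d = -∑ e, j d e * R a b c e)
    (bianchi : ∀ a b c d, R a b c d + R b c a d + R c a b d
      = 2 * j a b * t c d + 2 * j b c * t a d + 2 * j c a * t b d) :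
    ∑ a, ∑ b, ∑ c, ∑ d, j a b * j c d * R a b c d = -2 * ∑ a, ∑ b, R a b b a := by
  have swap (f : ι → ι → ι → ι → ℝ) :
      ∑ a, ∑ b, ∑ c, ∑ d, f a b c d = ∑ b, ∑ c, ∑ a, ∑ d, f a b c d := by
    rw [Finset.sum_comm]
    exact Finset.sum_congr rfl fun b _ => Finset.sum_comm
  have hjt : ∑ c, ∑ d, j c d * t c d = 0 := by
    have h1 : ∑ c, ∑ d, j c d * t c d = ∑ c, ∑ d, j d c * t d c := Finset.sum_comm
    have h2 : ∑ c, ∑ d, j d c * t d c = -∑ c, ∑ d, j c d * t c d := by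
      simp only [← Finset.sum_neg_distrib]
      exact Finset.sum_congr rfl fun c _ => Finset.sum_congr rfl fun d _ => by rw [hj d c, ht d c]; ring
    linarith
  -- If `J` can be moved from the first index of `f` to the second, where it meets the other factor
  -- `j`, then `J² = -1` removes both.
  have contr (b c : ι) (f : ι → ι → ℝ) (k : ι → ℝ) (hf : ∀ d, ∑ a, j a b * f a d = ∑ e, j d e * k e) :
      ∑ a, ∑ d, j a b * j c d * f a d = -k c := by
    rw [Finset.sum_comm]
    have h1 (d : ι) : ∑ a, j a b * j c d * f a d = ∑ e, j c d * j d e * k e := by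
      simp only [mul_comm _ (j c d), mul_assoc, ← Finset.mul_sum, hf]
    simp only [h1]
    rw [Finset.sum_comm]
    simp only [← Finset.sum_mul, hj2]
    simp
  -- The commutation of `R` with `J` moves one factor of `j` onto the index of the other, so that
  -- the double trace with `J` becomes an ordinary scalar contraction.
  have S1 : ∑ a, ∑ b, ∑ c, ∑ d, j a b * j c d * R b c a d = ∑ a, ∑ b, R a b b a := by
    rw [swap]
    refine Finset.sum_congr rfl fun b _ => Finset.sum_congr rfl fun c _ => ?_
    rw [contr b c (fun a d => R b c a d) (fun e => R b c b e) fun d => ?_]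
    · rw [hR' b c b c, neg_neg]
    · have h1 := hRj b c b d
      have h2 : ∑ a, j a b * R b c a d = -∑ a, j b a * R b c a d := by
        rw [← Finset.sum_neg_distrib]
        exact Finset.sum_congr rfl fun a _ => by rw [hj a b]; ring
      rw [h2, h1, neg_neg]
  have S2 : ∑ a, ∑ b, ∑ c, ∑ d, j a b * j c d * R c a b d = ∑ a, ∑ b, R a b b a := by
    have h0 : ∑ a, ∑ b, ∑ c, ∑ d, j a b * j c d * R c a b d
        = ∑ a, ∑ c, ∑ b, ∑ d, j b a * j c d * -R c a b d := by
      refine Finset.sum_congr rfl fun a _ => ?_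
      rw [Finset.sum_comm]
      exact Finset.sum_congr rfl fun c _ => Finset.sum_congr rfl fun b _ =>
        Finset.sum_congr rfl fun d _ => by rw [hj a b]; ring
    rw [h0]
    refine Finset.sum_congr rfl fun a _ => Finset.sum_congr rfl fun c _ => ?_
    rw [contr a c (fun b d => -R c a b d) (fun e => -R c a a e) fun d => ?_]
    · rw [hR c a a c, neg_neg, hR' a c a c, neg_neg]
    · have h1 := hRj c a a d
      have h2 : ∑ b, j b a * -R c a b d = ∑ b, j a b * R c a b d :=
        Finset.sum_congr rfl fun b _ => by rw [hj b a]; ring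
      rw [h2, h1, ← Finset.sum_neg_distrib]
      exact Finset.sum_congr rfl fun b _ => by ring
  -- Each torsion term reduces to a multiple of `∑ j c d * t c d`, the pairing of a skew with a
  -- symmetric matrix; in the next two, `J² = -1` is applied first.
  have B1 : ∑ a, ∑ b, ∑ c, ∑ d, j a b * j c d * (2 * j a b * t c d) = 0 := by
    have : ∑ a, ∑ b, ∑ c, ∑ d, j a b * j c d * (2 * j a b * t c d)
        = (∑ a, ∑ b, 2 * (j a b * j a b)) * ∑ c, ∑ d, j c d * t c d := by
      simp only [Finset.sum_mul]
      simp only [Finset.mul_sum]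
      exact Finset.sum_congr rfl fun a _ => Finset.sum_congr rfl fun b _ =>
        Finset.sum_congr rfl fun c _ => Finset.sum_congr rfl fun d _ => by ring
    rw [this, hjt, mul_zero]
  have B2 : ∑ a, ∑ b, ∑ c, ∑ d, j a b * j c d * (2 * j b c * t a d) = 0 := by
    have : ∑ a, ∑ b, ∑ c, ∑ d, j a b * j c d * (2 * j b c * t a d)
        = -2 * ∑ a, ∑ d, j a d * t a d := by
      rw [Finset.mul_sum]
      refine Finset.sum_congr rfl fun a _ => ?_
      rw [Finset.sum_comm]
      have h1 (c : ι) : ∑ b, ∑ d, j a b * j c d * (2 * j b c * t a d)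
          = (∑ b, j a b * j b c) * ∑ d, 2 * (j c d * t a d) := by
        simp only [Finset.sum_mul]
        simp only [Finset.mul_sum]
        exact Finset.sum_congr rfl fun b _ => Finset.sum_congr rfl fun d _ => by ring
      simp only [h1, hj2]
      simp [Finset.mul_sum]
    rw [this, hjt, mul_zero]
  have B3 : ∑ a, ∑ b, ∑ c, ∑ d, j a b * j c d * (2 * j c a * t b d) = 0 := by
    have : ∑ a, ∑ b, ∑ c, ∑ d, j a b * j c d * (2 * j c a * t b d)
        = -2 * ∑ b, ∑ d, j b d * t b d := by
      rw [swap, Finset.mul_sum]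
      refine Finset.sum_congr rfl fun b _ => ?_
      have h1 (c : ι) : ∑ a, ∑ d, j a b * j c d * (2 * j c a * t b d)
          = (∑ a, j c a * j a b) * ∑ d, 2 * (j c d * t b d) := by
        simp only [Finset.sum_mul]
        simp only [Finset.mul_sum]
        exact Finset.sum_congr rfl fun a _ => Finset.sum_congr rfl fun d _ => by ring
      simp only [h1, hj2]
      simp [Finset.mul_sum]
    rw [this, hjt, mul_zero]
  have main : ∑ a, ∑ b, ∑ c, ∑ d, (j a b * j c d * R a b c d + j a b * j c d * R b c a d
      + j a b * j c d * R c a b d)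
      = ∑ a, ∑ b, ∑ c, ∑ d, (j a b * j c d * (2 * j a b * t c d)
      + j a b * j c d * (2 * j b c * t a d) + j a b * j c d * (2 * j c a * t b d)) := by
    refine Finset.sum_congr rfl fun a _ => Finset.sum_congr rfl fun b _ =>
        Finset.sum_congr rfl fun c _ => Finset.sum_congr rfl fun d _ => ?_
    rw [← mul_add, ← mul_add, bianchi]
    ring
  simp only [Finset.sum_add_distrib, S1, S2, B1, B2, B3] at main
  linarith

end CliffordIdentities
end CRSpin

/-! ### The contact form, `dθ` and the Levi metric. -/

namespace CRSpin

open Bundle VectorField Filter FiberBundle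
open scoped Manifold ContDiff Topology

noncomputable section PseudohermitianGeometry

variable {n : ℕ} {M : Type*} [TopologicalSpace M]
  [ChartedSpace (EuclideanSpace ℝ (Fin (2 * n + 1))) M] [IsManifold (𝓡 (2 * n + 1)) ∞ M]

/-- Differentiability of a vector field at a point. -/
abbrev DiffFieldAt (X : VField n M) (x : M) : Prop :=
  MDifferentiableAt (𝓡 (2 * n + 1)) (𝓡 (2 * n + 1)).tangent
    (fun y => (⟨y, X y⟩ : TangentBundle (𝓡 (2 * n + 1)) M)) x

/-- Smoothness of a vector field at a point. -/
abbrev SmoothFieldAt (X : VField n M) (x : M) : Prop :=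
  ContMDiffAt (𝓡 (2 * n + 1)) (𝓡 (2 * n + 1)).tangent ∞
    (fun y => (⟨y, X y⟩ : TangentBundle (𝓡 (2 * n + 1)) M)) x

theorem SmoothFieldOn.contMDiffAt {X : VField n M} {U : Set M} (hX : SmoothFieldOn X U)
    (hU : IsOpen U) {x : M} (hx : x ∈ U) : SmoothFieldAt X x :=
  ContMDiffOn.contMDiffAt hX (hU.mem_nhds hx)

theorem SmoothFieldOn.mdifferentiableAt {X : VField n M} {U : Set M} (hX : SmoothFieldOn X U)
    (hU : IsOpen U) {x : M} (hx : x ∈ U) : DiffFieldAt X x :=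
  (hX.contMDiffAt hU hx).mdifferentiableAt (by simp)

theorem SmoothFieldOn.mlieBracket {X Y : VField n M} {U : Set M} (hU : IsOpen U)
    (hX : SmoothFieldOn X U) (hY : SmoothFieldOn Y U) :
    SmoothFieldOn (mlieBracket (𝓡 (2 * n + 1)) X Y) U := fun _ hx =>
  (contMDiffAt_mlieBracket (hX.contMDiffAt hU hx) (hY.contMDiffAt hU hx)).contMDiffWithinAt

theorem SmoothFieldOn.mvfderiv {F : Type*} [NormedAddCommGroup F] [NormedSpace ℝ F]
    {f : M → F} {X : VField n M} {U : Set M} (hX : SmoothFieldOn X U) (hU : IsOpen U)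
    (hf : ContMDiffOn (𝓡 (2 * n + 1)) 𝓘(ℝ, F) ∞ f U) :
    ContMDiffOn (𝓡 (2 * n + 1)) 𝓘(ℝ, F) ∞ (fun y => mvfderiv (𝓡 (2 * n + 1)) f y (X y)) U :=
  fun _ hx => (contMDiffAt_mvfderiv_apply (hf.contMDiffAt (hU.mem_nhds hx))
    (hX.contMDiffAt hU hx)).contMDiffWithinAt

theorem exists_smoothFieldOn_ext {x : M} (u : TangentSpace (𝓡 (2 * n + 1)) x) :
    ∃ U, IsOpen U ∧ x ∈ U ∧ SmoothFieldOn (ext u) U := by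
  obtain ⟨s, hs, h⟩ := exists_contMDiffOn_extend (k := ∞) (𝓡 (2 * n + 1))
    (EuclideanSpace ℝ (Fin (2 * n + 1))) u
  obtain ⟨U, hUs, hU, hx⟩ := mem_nhds_iff.1 hs
  exact ⟨U, hU, hx, h.mono hUs⟩

@[simp] theorem ext_self {x : M} (u : TangentSpace (𝓡 (2 * n + 1)) x) : ext u x = u :=
  extend_apply_self ..

theorem mdifferentiableAt_ext {x : M} (u : TangentSpace (𝓡 (2 * n + 1)) x) :
    DiffFieldAt (ext u) x := mdifferentiableAt_extend ..

namespace PseudohermitianStructure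

variable (S : PseudohermitianStructure n M)

/-- The structure controls `θ` only on smooth fields, whereas the tensoriality criterion tests
fields that are merely differentiable at a point. Expansion in a smooth local frame bridges the gap.
-/
theorem mdifferentiableAt_θ {Y : VField n M} {x : M} (hY : DiffFieldAt Y x) :
    MDifferentiableAt (𝓡 (2 * n + 1)) 𝓘(ℝ, ℝ) (fun y => S.θ y (Y y)) x := by
  let t := trivializationAt (EuclideanSpace ℝ (Fin (2 * n + 1))) (TangentSpace (𝓡 (2 * n + 1)) : M → Type _) x
  have hx : x ∈ t.baseSet := FiberBundle.mem_baseSet_trivializationAt _ _ x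
  let b := Module.Basis.ofVectorSpace ℝ (EuclideanSpace ℝ (Fin (2 * n + 1)))
  let c := t.localFrameCoeff (𝓡 (2 * n + 1)) b
  have h1 := t.eventually_eq_localFrame_sum_coeff_smul (I := 𝓡 (2 * n + 1)) (s := Y) b hx
  have h2 : (fun y => ∑ i, c i y (Y y) • S.θ y (t.localFrame b i y)) =ᶠ[𝓝 x] fun y => S.θ y (Y y) := by
    filter_upwards [h1] with y hy
    conv_rhs => rw [hy]
    simp [c]
  suffices h3 : ∀ i ∈ Finset.univ, MDifferentiableAt (𝓡 (2 * n + 1)) 𝓘(ℝ, ℝ)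
      (fun y => c i y (Y y) • S.θ y (t.localFrame b i y)) x from
    (MDifferentiableAt.sum h3).congr_of_eventuallyEq (h2.symm.trans (by simp [Finset.sum_fn]))
  intro i _
  have hc : MDifferentiableAt (𝓡 (2 * n + 1)) 𝓘(ℝ, ℝ) (fun y => c i y (Y y)) x :=
    mdifferentiableAt_localFrameCoeff b hx hY i
  have hs : MDifferentiableAt (𝓡 (2 * n + 1)) 𝓘(ℝ, ℝ) (fun y => S.θ y (t.localFrame b i y)) x :=
    ((S.smooth_θ _ t.open_baseSet _ (t.contMDiffOn_localFrame_baseSet ∞ b i)).contMDiffAt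
      (t.open_baseSet.mem_nhds hx)).mdifferentiableAt (by simp)
  exact hc.mul hs

/-- `X (θ Y) - Y (θ X) - θ [X, Y]` for vector fields `X`, `Y`. -/
def fieldExtDeriv (X Y : VField n M) (x : M) : ℝ :=
  mvfderiv (𝓡 (2 * n + 1)) (fun y => S.θ y (Y y)) x (X x)
    - mvfderiv (𝓡 (2 * n + 1)) (fun y => S.θ y (X y)) x (Y x)
    - S.θ x (mlieBracket (𝓡 (2 * n + 1)) X Y x)

theorem fieldExtDeriv_swap (X Y : VField n M) (x : M) :
    S.fieldExtDeriv X Y x = -S.fieldExtDeriv Y X x := by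
  simp only [fieldExtDeriv]
  rw [mlieBracket_swap_apply, map_neg]
  ring

theorem fieldExtDeriv_tensorialAt_left {Y : VField n M} {x : M} :
    TensorialAt (𝓡 (2 * n + 1)) (EuclideanSpace ℝ (Fin (2 * n + 1)))
      (fun X => S.fieldExtDeriv X Y x) x where
  smul {f X} hf hX := by
    have h1 : (fun y => S.θ y ((f • X) y)) = f • fun y => S.θ y (X y) := by
      funext y; simp
    simp only [fieldExtDeriv, h1, mlieBracket_smul_left hf hX,
      mvfderiv_smul hf (S.mdifferentiableAt_θ hX)]
    simp
    ring
  add {X X'} hX hX' := by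
    have h1 : (fun y => S.θ y ((X + X') y)) = (fun y => S.θ y (X y)) + fun y => S.θ y (X' y) := by
      funext y; simp
    simp only [fieldExtDeriv, h1, mlieBracket_add_left hX hX',
      mvfderiv_add (S.mdifferentiableAt_θ hX) (S.mdifferentiableAt_θ hX')]
    simp
    ring

theorem fieldExtDeriv_tensorialAt_right {X : VField n M} {x : M} :
    TensorialAt (𝓡 (2 * n + 1)) (EuclideanSpace ℝ (Fin (2 * n + 1)))
      (fun Y => S.fieldExtDeriv X Y x) x where
  smul {f Y} hf hY := by
    simp only [S.fieldExtDeriv_swap X]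
    rw [S.fieldExtDeriv_tensorialAt_left.smul hf hY, smul_neg]
  add {Y Y'} hY hY' := by
    simp only [S.fieldExtDeriv_swap X]
    rw [S.fieldExtDeriv_tensorialAt_left.add hY hY', neg_add]

/-- The exterior derivative of `θ` as a continuous bilinear form. -/
def dθ (x : M) : TangentSpace (𝓡 (2 * n + 1)) x →L[ℝ] TangentSpace (𝓡 (2 * n + 1)) x →L[ℝ] ℝ :=
  TensorialAt.mkHom₂ (fun X Y => S.fieldExtDeriv X Y x) x
    (fun _ _ => S.fieldExtDeriv_tensorialAt_left) (fun _ _ => S.fieldExtDeriv_tensorialAt_right)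

theorem dθ_apply {X Y : VField n M} {x : M} (hX : DiffFieldAt X x) (hY : DiffFieldAt Y x) :
    S.dθ x (X x) (Y x) = S.fieldExtDeriv X Y x :=
  TensorialAt.mkHom₂_apply _ _ hX hY

/-- The definition of `extDeriv₁` uses a chosen extension of the two vectors. Tensoriality makes the
value independent of it, so `dθ` may be computed with any fields, and bilinearity becomes available.
-/
theorem extDeriv₁_eq (x : M) (u v : TangentSpace (𝓡 (2 * n + 1)) x) :
    extDeriv₁ S.θ x u v = S.dθ x u v := by
  have h := S.dθ_apply (mdifferentiableAt_ext u) (mdifferentiableAt_ext v)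
  rw [ext_self, ext_self] at h
  rw [h, extDeriv₁, fieldExtDeriv, ext_self, ext_self]

theorem dθ_swap (x : M) (u v : TangentSpace (𝓡 (2 * n + 1)) x) : S.dθ x u v = -S.dθ x v u := by
  have h := S.fieldExtDeriv_swap (ext u) (ext v) x
  rw [← S.dθ_apply (mdifferentiableAt_ext u) (mdifferentiableAt_ext v),
    ← S.dθ_apply (mdifferentiableAt_ext v) (mdifferentiableAt_ext u)] at h
  simpa using h

theorem levi_eq (x : M) (u v : TangentSpace (𝓡 (2 * n + 1)) x) :
    S.levi x u v = (1 / 2) * S.dθ x u (S.J x v) := by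
  rw [levi, extDeriv₁_eq]

theorem levi_add_left (x : M) (u u' v : TangentSpace (𝓡 (2 * n + 1)) x) :
    S.levi x (u + u') v = S.levi x u v + S.levi x u' v := by
  simp [levi_eq]; ring

theorem levi_sub_left (x : M) (u u' v : TangentSpace (𝓡 (2 * n + 1)) x) :
    S.levi x (u - u') v = S.levi x u v - S.levi x u' v := by
  simp [levi_eq]; ring

theorem levi_smul_left (x : M) (c : ℝ) (u v : TangentSpace (𝓡 (2 * n + 1)) x) :
    S.levi x (c • u) v = c * S.levi x u v := by
  simp [levi_eq]; ring

theorem levi_neg_left (x : M) (u v : TangentSpace (𝓡 (2 * n + 1)) x) :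
    S.levi x (-u) v = -S.levi x u v := by
  simp [levi_eq]

theorem levi_neg_right (x : M) (u v : TangentSpace (𝓡 (2 * n + 1)) x) :
    S.levi x u (-v) = -S.levi x u v := by
  simp [levi_eq]

theorem levi_sum_left {ι : Type*} (s : Finset ι) (x : M) (u : ι → TangentSpace (𝓡 (2 * n + 1)) x)
    (v : TangentSpace (𝓡 (2 * n + 1)) x) :
    S.levi x (∑ i ∈ s, u i) v = ∑ i ∈ s, S.levi x (u i) v := by
  simp [levi_eq, Finset.mul_sum]

variable {S} {T : VField n M}

theorem IsReebField.dθ_left (hT : S.IsReebField T) (x : M) (v : TangentSpace (𝓡 (2 * n + 1)) x) :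
    S.dθ x (T x) v = 0 := by
  rw [← extDeriv₁_eq]; exact hT.contract x v

theorem IsReebField.levi_left (hT : S.IsReebField T) (x : M) (v : TangentSpace (𝓡 (2 * n + 1)) x) :
    S.levi x (T x) v = 0 := by
  rw [levi_eq, hT.dθ_left, mul_zero]

theorem IsReebField.exists_horizontalOn (hT : S.IsReebField T) {x : M}
    {u : TangentSpace (𝓡 (2 * n + 1)) x} (hu : S.θ x u = 0) :
    ∃ U, IsOpen U ∧ x ∈ U ∧ ∃ X : VField n M, S.HorizontalOn X U ∧ X x = u := by
  obtain ⟨U, hU, hx, h⟩ := exists_smoothFieldOn_ext u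
  -- Subtracting the Reeb component makes the extension horizontal; at `x` nothing is subtracted,
  -- since `θ u = 0`.
  refine ⟨U, hU, hx, ext u - (fun y => S.θ y (ext u y)) • T, ⟨?_, fun y _ => ?_⟩, ?_⟩
  · exact ContMDiffOn.sub_section h ((S.smooth_θ U hU _ h).smul_section
      (ContMDiffOn.mono hT.smooth (Set.subset_univ _)))
  · simp [hT.theta]
  · simp [hu]

theorem HorizontalOn.J {X : VField n M} {U : Set M} (hU : IsOpen U) (hX : S.HorizontalOn X U) :
    S.HorizontalOn (fun y => S.J y (X y)) U :=
  ⟨S.smooth_J U hU X hX.1 hX.2, fun y hy => S.J_mem y _ (hX.2 y hy)⟩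

theorem HorizontalOn.θ_eventually {X : VField n M} {U : Set M} (hU : IsOpen U)
    (hX : S.HorizontalOn X U) {x : M} (hx : x ∈ U) :
    (fun y => S.θ y (X y)) =ᶠ[𝓝 x] fun _ => 0 := by
  filter_upwards [hU.mem_nhds hx] using hX.2

theorem HorizontalOn.dθ_apply {X Y : VField n M} {U : Set M} (hU : IsOpen U)
    (hX : S.HorizontalOn X U) (hY : S.HorizontalOn Y U) {x : M} (hx : x ∈ U) :
    S.dθ x (X x) (Y x) = -S.θ x (mlieBracket (𝓡 (2 * n + 1)) X Y x) := by
  rw [S.dθ_apply (hX.1.mdifferentiableAt hU hx) (hY.1.mdifferentiableAt hU hx), fieldExtDeriv,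
    mvfderiv_congr (hX.θ_eventually hU hx), mvfderiv_congr (hY.θ_eventually hU hx), mvfderiv_const]
  simp

/-- On sections of `ξ`, `dθ(X, Y) = -θ [X, Y]`, so this is the half of integrability that puts `[X,
Y] - [JX, JY]` in `ξ`. Symmetry of the Levi metric and skewness of `J` follow from it. -/
theorem IsReebField.dθ_J (hT : S.IsReebField T) {x : M} {u v : TangentSpace (𝓡 (2 * n + 1)) x}
    (hu : S.θ x u = 0) (hv : S.θ x v = 0) : S.dθ x (S.J x u) (S.J x v) = S.dθ x u v := by
  obtain ⟨U, hU, hxU, X, hX, rfl⟩ := hT.exists_horizontalOn hu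
  obtain ⟨V, hV, hxV, Y, hY, rfl⟩ := hT.exists_horizontalOn hv
  have hUV := hU.inter hV
  have hx : x ∈ U ∩ V := ⟨hxU, hxV⟩
  replace hX : S.HorizontalOn X (U ∩ V) :=
    ⟨ContMDiffOn.mono hX.1 Set.inter_subset_left, fun y hy => hX.2 y hy.1⟩
  replace hY : S.HorizontalOn Y (U ∩ V) :=
    ⟨ContMDiffOn.mono hY.1 Set.inter_subset_right, fun y hy => hY.2 y hy.2⟩
  have h := (S.integrable _ hUV X Y hX.1 hY.1 hX.2 hY.2 x hx).1
  have h1 := (hX.J hUV).dθ_apply hUV (hY.J hUV) hx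
  have h2 := hX.dθ_apply hUV hY hx
  rw [map_sub] at h
  linarith

theorem IsReebField.levi_symm (hT : S.IsReebField T) {x : M} {u v : TangentSpace (𝓡 (2 * n + 1)) x}
    (hu : S.θ x u = 0) (hv : S.θ x v = 0) : S.levi x u v = S.levi x v u := by
  rw [levi_eq, levi_eq, ← hT.dθ_J hu (S.J_mem x v hv), S.J_sq x v hv, map_neg, S.dθ_swap x v]

theorem IsReebField.levi_J (hT : S.IsReebField T) {x : M} {u v : TangentSpace (𝓡 (2 * n + 1)) x}
    (hu : S.θ x u = 0) (hv : S.θ x v = 0) : S.levi x (S.J x u) (S.J x v) = S.levi x u v := by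
  rw [levi_eq, levi_eq, hT.dθ_J hu (S.J_mem x v hv)]

theorem IsReebField.levi_J_left (hT : S.IsReebField T) {x : M}
    {u v : TangentSpace (𝓡 (2 * n + 1)) x} (hu : S.θ x u = 0) (hv : S.θ x v = 0) :
    S.levi x (S.J x u) v = -S.levi x u (S.J x v) := by
  rw [← hT.levi_J hu (S.J_mem x v hv), S.J_sq x v hv, levi_neg_right, neg_neg]

/-- The expansion of a tangent vector in an orthonormal basis of `ξ` and the Reeb field. -/
theorem IsReebField.sum_levi_smul (hT : S.IsReebField T) {ι : Type*} [Fintype ι] [DecidableEq ι]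
    (hι : Fintype.card ι = 2 * n) {x : M} {e : ι → TangentSpace (𝓡 (2 * n + 1)) x}
    (he : ∀ a, S.θ x (e a) = 0) (ho : ∀ a b, S.levi x (e a) (e b) = if a = b then 1 else 0)
    (v : TangentSpace (𝓡 (2 * n + 1)) x) :
    v = ∑ a, S.levi x v (e a) • e a + S.θ x v • T x := by
  let f : Option ι → TangentSpace (𝓡 (2 * n + 1)) x := fun a => a.elim (T x) e
  have hf (c : Option ι → ℝ) : ∑ a, c a • f a = ∑ a, c (some a) • e a + c none • T x := by
    exact (Fintype.sum_option _).trans (add_comm _ _)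
  have hθ (c : Option ι → ℝ) : S.θ x (∑ a, c a • f a) = c none := by
    rw [hf]; simp [he, hT.theta]
  have hl (c : Option ι → ℝ) (b : ι) : S.levi x (∑ a, c a • f a) (e b) = c (some b) := by
    rw [hf]; simp [levi_add_left, levi_sum_left, levi_smul_left, ho, hT.levi_left]
  -- The coefficients of a combination are recovered by pairing with `e b` and by `θ`, since `T` is
  -- null for both slots involved. A dimension count then shows that the family spans.
  have hli : LinearIndependent ℝ f := by
    rw [Fintype.linearIndependent_iff]
    intro c hc a
    cases a with
    | none => rw [← hθ c, hc, map_zero]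
    | some b => rw [← hl c b, hc]; simp [levi_eq]
  have : FiniteDimensional ℝ (TangentSpace (𝓡 (2 * n + 1)) x) :=
    inferInstanceAs (FiniteDimensional ℝ (EuclideanSpace ℝ (Fin (2 * n + 1))))
  have hspan := hli.span_eq_top_of_card_eq_finrank' (by
    rw [Fintype.card_option, hι]
    exact (finrank_euclideanSpace_fin (𝕜 := ℝ) (n := 2 * n + 1)).symm)
  have hv : v ∈ Submodule.span ℝ (Set.range f) := by rw [hspan]; trivial
  obtain ⟨c, rfl⟩ := (Submodule.mem_span_range_iff_exists_fun ℝ).1 hv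
  simp only [hl, hθ]
  exact hf c

theorem IsReebField.levi_eq_sum (hT : S.IsReebField T) {ι : Type*} [Fintype ι] [DecidableEq ι]
    (hι : Fintype.card ι = 2 * n) {x : M} {e : ι → TangentSpace (𝓡 (2 * n + 1)) x}
    (he : ∀ a, S.θ x (e a) = 0) (ho : ∀ a b, S.levi x (e a) (e b) = if a = b then 1 else 0)
    (v : TangentSpace (𝓡 (2 * n + 1)) x) {w : TangentSpace (𝓡 (2 * n + 1)) x} (hw : S.θ x w = 0) :
    S.levi x v w = ∑ a, S.levi x v (e a) * S.levi x w (e a) := by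
  conv_lhs => rw [hT.sum_levi_smul hι he ho v]
  rw [levi_add_left, levi_sum_left, levi_smul_left, hT.levi_left, mul_zero, add_zero]
  exact Finset.sum_congr rfl fun a _ => by rw [levi_smul_left, hT.levi_symm (he a) hw]

theorem HorizontalOn.levi {X Y : VField n M} {U : Set M} (hU : IsOpen U) (hX : SmoothFieldOn X U)
    (hY : S.HorizontalOn Y U) :
    ContMDiffOn (𝓡 (2 * n + 1)) 𝓘(ℝ, ℝ) ∞ (fun y => S.levi y (X y) (Y y)) U := by
  have hJ := hY.J hU
  have h1 := hX.mvfderiv hU (S.smooth_θ U hU _ hJ.1)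
  have h2 := hJ.1.mvfderiv hU (S.smooth_θ U hU _ hX)
  have h3 := S.smooth_θ U hU _ (SmoothFieldOn.mlieBracket hU hX hJ.1)
  refine (contMDiffOn_const (c := (1 / 2 : ℝ)).mul ((h1.sub h2).sub h3)).congr fun y hy => ?_
  rw [levi_eq, S.dθ_apply (Y := fun y => S.J y (Y y)) (hX.mdifferentiableAt hU hy)
    (hJ.1.mdifferentiableAt hU hy)]
  rfl

end PseudohermitianStructure
end PseudohermitianGeometry
end CRSpin

/-! ### Frames of `ξ`: torsion, structure equation and Bianchi identity. -/

namespace CRSpin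

open Bundle VectorField Filter FiberBundle
open scoped Manifold ContDiff Topology

noncomputable section AdaptedFrames

variable {n : ℕ} {M : Type*} [TopologicalSpace M]
  [ChartedSpace (EuclideanSpace ℝ (Fin (2 * n + 1))) M] [IsManifold (𝓡 (2 * n + 1)) ∞ M]

namespace PseudohermitianStructure

variable {S : PseudohermitianStructure n M} {T : VField n M}
  {cov : CovariantDerivative (𝓡 (2 * n + 1)) (EuclideanSpace ℝ (Fin (2 * n + 1)))
    (TangentSpace (𝓡 (2 * n + 1)) : M → Type _)}
  {e : Fin (2 * n) → VField n M} {U : Set M}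

variable (S T cov e U) in
/-- A local orthonormal frame `e` of `ξ` over `U`, together with the Reeb field and the
Tanaka-Webster connection. -/
structure AdaptedFrame : Prop where
  reeb : S.IsReebField T
  tanakaWebster : S.IsTanakaWebster T cov
  isOpen : IsOpen U
  horizontal : ∀ a, S.HorizontalOn (e a) U
  orthonormal : ∀ x ∈ U, ∀ a b, S.levi x (e a x) (e b x) = if a = b then 1 else 0

variable (S cov e) in
/-- The connection coefficients `⟨∇_v e_c, e_d⟩`. -/
def connCoeff (c d : Fin (2 * n)) (x : M) (v : TangentSpace (𝓡 (2 * n + 1)) x) : ℝ :=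
  S.levi x (cov (e c) x v) (e d x)

variable (S cov e) in
/-- The curvature coefficients `⟨R(e_a, e_b) e_c, e_d⟩`. -/
def curvCoeff (x : M) (a b c d : Fin (2 * n)) : ℝ :=
  S.levi x (fieldCurvature cov (e a) (e b) (e c) x) (e d x)

variable (S e) in
/-- The matrix of `J`. -/
def jCoeff (x : M) (a b : Fin (2 * n)) : ℝ := S.levi x (S.J x (e a x)) (e b x)

variable (S T cov e) in
/-- The matrix of the pseudohermitian torsion `τ = 𝕋(T, ·)`. -/
def torsionCoeff (x : M) (a b : Fin (2 * n)) : ℝ :=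
  S.levi x (cov.torsion x (T x) (e a x)) (e b x)

theorem connCoeff_add (c d : Fin (2 * n)) (x : M) (v w : TangentSpace (𝓡 (2 * n + 1)) x) :
    connCoeff S cov e c d x (v + w) = connCoeff S cov e c d x v + connCoeff S cov e c d x w := by
  rw [connCoeff, map_add, levi_add_left]; rfl

namespace AdaptedFrame

theorem smooth_reeb (h : AdaptedFrame S T cov e U) : SmoothFieldOn T U :=
  ContMDiffOn.mono h.reeb.smooth (Set.subset_univ _)

theorem expand (h : AdaptedFrame S T cov e U) {x : M} (hx : x ∈ U)
    (v : TangentSpace (𝓡 (2 * n + 1)) x) :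
    v = ∑ a, S.levi x v (e a x) • e a x + S.θ x v • T x :=
  h.reeb.sum_levi_smul (Fintype.card_fin _) (fun a => (h.horizontal a).2 x hx)
    (h.orthonormal x hx) v

theorem expand_of_horizontal (h : AdaptedFrame S T cov e U) {x : M} (hx : x ∈ U)
    {v : TangentSpace (𝓡 (2 * n + 1)) x} (hv : S.θ x v = 0) :
    ∑ a, S.levi x v (e a x) • e a x = v := by
  have h1 := h.expand hx v
  rw [hv, zero_smul, add_zero] at h1
  exact h1.symm

theorem levi_eq_sum (h : AdaptedFrame S T cov e U) {x : M} (hx : x ∈ U)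
    (v : TangentSpace (𝓡 (2 * n + 1)) x) {w : TangentSpace (𝓡 (2 * n + 1)) x}
    (hw : S.θ x w = 0) :
    S.levi x v w = ∑ a, S.levi x v (e a x) * S.levi x w (e a x) :=
  h.reeb.levi_eq_sum (Fintype.card_fin _) (fun a => (h.horizontal a).2 x hx)
    (h.orthonormal x hx) v hw

theorem θ_frame (h : AdaptedFrame S T cov e U) {x : M} (hx : x ∈ U) (a : Fin (2 * n)) :
    S.θ x (e a x) = 0 := (h.horizontal a).2 x hx

theorem θ_cov (h : AdaptedFrame S T cov e U) {x : M} (hx : x ∈ U) {X : VField n M}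
    (hX : S.HorizontalOn X U) (v : TangentSpace (𝓡 (2 * n + 1)) x) : S.θ x (cov X x v) = 0 :=
  h.tanakaWebster.horizontal U h.isOpen X hX x hx v

theorem connCoeff_swap (h : AdaptedFrame S T cov e U) {x : M} (hx : x ∈ U) (c d : Fin (2 * n))
    (v : TangentSpace (𝓡 (2 * n + 1)) x) :
    connCoeff S cov e c d x v = -connCoeff S cov e d c x v := by
  have h1 := h.tanakaWebster.metric U h.isOpen (e c) (e d) (h.horizontal c) (h.horizontal d) x hx v
  have h2 : (fun y => S.levi y (e c y) (e d y)) =ᶠ[𝓝 x] fun _ => if c = d then (1 : ℝ) else 0 := by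
    filter_upwards [h.isOpen.mem_nhds hx] with y hy using h.orthonormal y hy c d
  rw [mvfderiv_congr h2, mvfderiv_const] at h1
  have h3 := h.reeb.levi_symm (h.θ_frame hx c) (h.θ_cov hx (h.horizontal d) v)
  simp only [connCoeff]
  rw [h3] at h1
  have h4 : (0 : TangentSpace (𝓡 (2 * n + 1)) x →L[ℝ] ℝ) v = 0 := rfl
  rw [h4] at h1
  linarith

theorem cov_frame (h : AdaptedFrame S T cov e U) {x : M} (hx : x ∈ U) (c : Fin (2 * n))
    (v : TangentSpace (𝓡 (2 * n + 1)) x) :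
    cov (e c) x v = ∑ d, connCoeff S cov e c d x v • e d x :=
  (h.expand_of_horizontal hx (h.θ_cov hx (h.horizontal c) v)).symm

theorem jCoeff_swap (h : AdaptedFrame S T cov e U) {x : M} (hx : x ∈ U) (a b : Fin (2 * n)) :
    jCoeff S e x a b = -jCoeff S e x b a := by
  rw [jCoeff, h.reeb.levi_J_left (h.θ_frame hx a) (h.θ_frame hx b),
    h.reeb.levi_symm (h.θ_frame hx a) (S.J_mem x _ (h.θ_frame hx b))]
  rfl

theorem jCoeff_mul (h : AdaptedFrame S T cov e U) {x : M} (hx : x ∈ U) (a b : Fin (2 * n)) :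
    ∑ c, jCoeff S e x a c * jCoeff S e x c b = if a = b then -1 else 0 := by
  have h1 := h.levi_eq_sum hx (S.J x (e a x)) (S.J_mem x _ (h.θ_frame hx b))
  rw [h.reeb.levi_J (h.θ_frame hx a) (h.θ_frame hx b), h.orthonormal x hx] at h1
  have h2 : ∑ c, jCoeff S e x a c * jCoeff S e x c b
      = -∑ c, S.levi x (S.J x (e a x)) (e c x) * S.levi x (S.J x (e b x)) (e c x) := by
    rw [← Finset.sum_neg_distrib]
    exact Finset.sum_congr rfl fun c _ => by rw [h.jCoeff_swap hx c b]; simp only [jCoeff]; ring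
  rw [h2, ← h1]
  split_ifs <;> simp

theorem dθ_frame (h : AdaptedFrame S T cov e U) {x : M} (hx : x ∈ U) (a b : Fin (2 * n)) :
    S.dθ x (e a x) (e b x) = 2 * jCoeff S e x a b := by
  rw [jCoeff, levi_eq, h.reeb.dθ_J (h.θ_frame hx a) (h.θ_frame hx b)]; ring

theorem torsionCoeff_swap (h : AdaptedFrame S T cov e U) {x : M} (hx : x ∈ U)
    (a b : Fin (2 * n)) : torsionCoeff S T cov e x a b = torsionCoeff S T cov e x b a :=
  h.tanakaWebster.torsion_symm x _ _ (h.θ_frame hx a) (h.θ_frame hx b)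

/-- Both covariant derivatives are annihilated by `θ`, and `θ [T, e_a] = -dθ(T, e_a) = 0`. -/
theorem θ_torsion (h : AdaptedFrame S T cov e U) {x : M} (hx : x ∈ U) (a : Fin (2 * n)) :
    S.θ x (cov.torsion x (T x) (e a x)) = 0 := by
  have dT := h.smooth_reeb.mdifferentiableAt h.isOpen hx
  have de := (h.horizontal a).1.mdifferentiableAt h.isOpen hx
  have h1 := S.dθ_apply dT de
  have h2 : (fun y => S.θ y (T y)) = fun _ => 1 := funext h.reeb.theta
  rw [h.reeb.dθ_left, fieldExtDeriv, mvfderiv_congr ((h.horizontal a).θ_eventually h.isOpen hx), h2,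
    mvfderiv_const, mvfderiv_const] at h1
  rw [cov.torsion_apply dT de, map_sub, map_sub, h.θ_cov hx (h.horizontal a),
    h.tanakaWebster.reeb_parallel]
  simpa using h1

theorem torsionCoeff_anticomm (h : AdaptedFrame S T cov e U) {x : M} (hx : x ∈ U)
    (a b : Fin (2 * n)) :
    ∑ c, jCoeff S e x a c * torsionCoeff S T cov e x c b
      = -∑ c, torsionCoeff S T cov e x a c * jCoeff S e x c b := by
  have h1 : ∑ c, jCoeff S e x a c * torsionCoeff S T cov e x c b
      = S.levi x (cov.torsion x (T x) (S.J x (e a x))) (e b x) := by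
    conv_rhs => rw [← h.expand_of_horizontal hx (S.J_mem x _ (h.θ_frame hx a))]
    simp only [map_sum, map_smul, levi_sum_left, levi_smul_left]
    rfl
  rw [h1, h.tanakaWebster.torsion_J x _ (h.θ_frame hx a), levi_neg_left,
    h.reeb.levi_J_left (h.θ_torsion hx a) (h.θ_frame hx b),
    h.levi_eq_sum hx _ (S.J_mem x _ (h.θ_frame hx b)), neg_neg, ← Finset.sum_neg_distrib]
  exact Finset.sum_congr rfl fun c _ => by
    rw [h.jCoeff_swap hx c b]; simp only [jCoeff, torsionCoeff]; ring

/-- Anticommutation with `J` and cyclicity of the trace give `tr (t j j) = -tr (j t j) = -tr (t j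
j)`, while `j j = -1`. -/
theorem torsionCoeff_trace (h : AdaptedFrame S T cov e U) {x : M} (hx : x ∈ U) :
    ∑ a, torsionCoeff S T cov e x a a = 0 := by
  set j := jCoeff S e x
  set t := torsionCoeff S T cov e x
  have h1 (a : Fin (2 * n)) : ∑ b, ∑ c, t a b * (j b c * j c a) = -t a a := by
    simp only [← Finset.mul_sum, j, h.jCoeff_mul hx]
    simp
  have h2 (a c : Fin (2 * n)) : ∑ b, t a b * (j b c * j c a) = -∑ b, j a b * t b c * j c a := by
    rw [← Finset.sum_mul, h.torsionCoeff_anticomm hx, neg_mul, neg_neg, Finset.sum_mul]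
    exact Finset.sum_congr rfl fun b _ => by ring
  have h3 : ∑ a, ∑ b, ∑ c, t a b * (j b c * j c a) = -∑ a, ∑ c, ∑ b, j a b * t b c * j c a := by
    rw [← Finset.sum_neg_distrib]
    refine Finset.sum_congr rfl fun a _ => ?_
    rw [Finset.sum_comm, ← Finset.sum_neg_distrib]
    exact Finset.sum_congr rfl fun c _ => h2 a c
  have h4 : ∑ a, ∑ c, ∑ b, j a b * t b c * j c a = ∑ b, ∑ c, ∑ a, t b c * (j c a * j a b) := by
    have h5 (a : Fin (2 * n)) : ∑ c, ∑ b, j a b * t b c * j c a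
        = ∑ b, ∑ c, t b c * (j c a * j a b) := by
      rw [Finset.sum_comm]
      exact Finset.sum_congr rfl fun b _ => Finset.sum_congr rfl fun c _ => by ring
    simp only [h5]
    rw [Finset.sum_comm]
    exact Finset.sum_congr rfl fun b _ => Finset.sum_comm
  simp only [h1] at h3 h4
  rw [h4] at h3
  simp only [Finset.sum_neg_distrib] at h3
  linarith

theorem torsion_frame (h : AdaptedFrame S T cov e U) {x : M} (hx : x ∈ U) {X Y : VField n M}
    (hX : S.HorizontalOn X U) (hY : S.HorizontalOn Y U) :
    cov Y x (X x) - cov X x (Y x) = mlieBracket (𝓡 (2 * n + 1)) X Y x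
      - S.θ x (mlieBracket (𝓡 (2 * n + 1)) X Y x) • T x := by
  have h1 := h.tanakaWebster.torsion_horizontal x _ _ (hX.2 x hx) (hY.2 x hx)
  rw [extDeriv₁_eq, hX.dθ_apply h.isOpen hY hx, cov.torsion_apply
    (hX.1.mdifferentiableAt h.isOpen hx) (hY.1.mdifferentiableAt h.isOpen hx)] at h1
  rw [sub_eq_iff_eq_add] at h1
  rw [h1]
  module

theorem mono (h : AdaptedFrame S T cov e U) {V : Set M} (hV : IsOpen V) (hVU : V ⊆ U) :
    AdaptedFrame S T cov e V where
  reeb := h.reeb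
  tanakaWebster := h.tanakaWebster
  isOpen := hV
  horizontal a := ⟨ContMDiffOn.mono (h.horizontal a).1 hVU, fun x hx => (h.horizontal a).2 x (hVU hx)⟩
  orthonormal x hx := h.orthonormal x (hVU hx)

/-- The torsion of two horizontal vectors is a multiple of `T`, which the Levi metric does not see.
Only the Reeb component of `v` contributes. -/
theorem levi_torsion (h : AdaptedFrame S T cov e U) {x : M} (hx : x ∈ U) (a d : Fin (2 * n))
    (v : TangentSpace (𝓡 (2 * n + 1)) x) :
    S.levi x (cov.torsion x (e a x) v) (e d x) = -S.θ x v * torsionCoeff S T cov e x a d := by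
  conv_lhs => rw [h.expand hx v]
  have h1 (b : Fin (2 * n)) : S.levi x (cov.torsion x (e a x) (e b x)) (e d x) = 0 := by
    rw [h.tanakaWebster.torsion_horizontal x _ _ (h.θ_frame hx a) (h.θ_frame hx b),
      levi_smul_left, h.reeb.levi_left, mul_zero]
  simp only [map_add, map_sum, map_smul, levi_add_left, levi_sum_left, levi_smul_left, h1]
  rw [cov.torsion_antisymm (e a x), levi_neg_left]
  simp [torsionCoeff]

variable [T2Space M]

theorem smooth_cov (h : AdaptedFrame S T cov e U) {X Y : VField n M} (hX : SmoothFieldOn X U)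
    (hY : SmoothFieldOn Y U) : SmoothFieldOn (fun y => cov X y (Y y)) U :=
  contMDiffOn_cov h.tanakaWebster.smooth h.isOpen hX hY

theorem horizontal_cov (h : AdaptedFrame S T cov e U) {X Y : VField n M}
    (hX : S.HorizontalOn X U) (hY : SmoothFieldOn Y U) :
    S.HorizontalOn (fun y => cov X y (Y y)) U :=
  ⟨h.smooth_cov hX.1 hY, fun _ hx => h.θ_cov hx hX _⟩

theorem smooth_connCoeff (h : AdaptedFrame S T cov e U) {X : VField n M} (hX : SmoothFieldOn X U)
    (c d : Fin (2 * n)) :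
    ContMDiffOn (𝓡 (2 * n + 1)) 𝓘(ℝ, ℝ) ∞ (fun y => connCoeff S cov e c d y (X y)) U :=
  HorizontalOn.levi h.isOpen (h.smooth_cov (h.horizontal c).1 hX) (h.horizontal d)

/-- The second structure equation. -/
theorem mvfderiv_connCoeff (h : AdaptedFrame S T cov e U) {X Y : VField n M}
    (hX : SmoothFieldOn X U) (hY : SmoothFieldOn Y U) {x : M} (hx : x ∈ U) (c d : Fin (2 * n)) :
    mvfderiv (𝓡 (2 * n + 1)) (fun y => connCoeff S cov e c d y (Y y)) x (X x)
        - mvfderiv (𝓡 (2 * n + 1)) (fun y => connCoeff S cov e c d y (X y)) x (Y x)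
        - connCoeff S cov e c d x (mlieBracket (𝓡 (2 * n + 1)) X Y x)
      = S.levi x (fieldCurvature cov X Y (e c) x) (e d x)
        + ∑ f, (connCoeff S cov e c f x (Y x) * connCoeff S cov e d f x (X x)
          - connCoeff S cov e c f x (X x) * connCoeff S cov e d f x (Y x)) := by
  -- Metric compatibility is applied to the pair `∇_A e_c`, `e_d`; the products of connection
  -- coefficients come from differentiating `e_d`.
  have key {A : VField n M} (hA : SmoothFieldOn A U) (v : TangentSpace (𝓡 (2 * n + 1)) x) :
      mvfderiv (𝓡 (2 * n + 1)) (fun y => connCoeff S cov e c d y (A y)) x v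
        = S.levi x (cov (fun y => cov (e c) y (A y)) x v) (e d x)
          + ∑ f, connCoeff S cov e c f x (A x) * connCoeff S cov e d f x v := by
    have hs := h.levi_eq_sum hx (cov (e c) x (A x)) (h.θ_cov hx (h.horizontal d) v)
    exact (h.tanakaWebster.metric U h.isOpen _ (e d) (h.horizontal_cov (h.horizontal c) hA)
      (h.horizontal d) x hx v).trans (congrArg _ hs)
  rw [key hY, key hX, fieldCurvature, levi_sub_left, levi_sub_left, Finset.sum_sub_distrib]
  simp only [connCoeff]
  ring

theorem θ_fieldCurvature (h : AdaptedFrame S T cov e U) {X Y Z : VField n M}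
    (hX : SmoothFieldOn X U) (hY : SmoothFieldOn Y U) (hZ : S.HorizontalOn Z U) {x : M}
    (hx : x ∈ U) : S.θ x (fieldCurvature cov X Y Z x) = 0 := by
  rw [fieldCurvature, map_sub, map_sub, h.θ_cov hx (h.horizontal_cov hZ hY),
    h.θ_cov hx (h.horizontal_cov hZ hX), h.θ_cov hx hZ]
  simp

theorem levi_fieldCurvature_swap (h : AdaptedFrame S T cov e U) {X Y : VField n M}
    (hX : SmoothFieldOn X U) (hY : SmoothFieldOn Y U) {x : M} (hx : x ∈ U) (c d : Fin (2 * n)) :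
    S.levi x (fieldCurvature cov X Y (e c) x) (e d x)
      = -S.levi x (fieldCurvature cov X Y (e d) x) (e c x) := by
  have key {A : VField n M} (v : TangentSpace (𝓡 (2 * n + 1)) x) :
      mvfderiv (𝓡 (2 * n + 1)) (fun y => connCoeff S cov e c d y (A y)) x v
        = -mvfderiv (𝓡 (2 * n + 1)) (fun y => connCoeff S cov e d c y (A y)) x v := by
    have h1 : (fun y => connCoeff S cov e c d y (A y))
        =ᶠ[𝓝 x] -fun y => connCoeff S cov e d c y (A y) := by
      filter_upwards [h.isOpen.mem_nhds hx] with y hy using h.connCoeff_swap hy c d _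
    rw [mvfderiv_congr h1, mvfderiv_neg]
    rfl
  have h1 := h.mvfderiv_connCoeff hX hY hx c d
  have h2 := h.mvfderiv_connCoeff hX hY hx d c
  rw [key, key, h.connCoeff_swap hx c d] at h1
  have h3 : ∑ f, (connCoeff S cov e c f x (Y x) * connCoeff S cov e d f x (X x)
        - connCoeff S cov e c f x (X x) * connCoeff S cov e d f x (Y x))
      = -∑ f, (connCoeff S cov e d f x (Y x) * connCoeff S cov e c f x (X x)
        - connCoeff S cov e d f x (X x) * connCoeff S cov e c f x (Y x)) := by
    rw [← Finset.sum_neg_distrib]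
    exact Finset.sum_congr rfl fun f _ => by ring
  rw [h3] at h1
  linarith

/-- Tensoriality in the third slot, applied to the expansion of `Z` in the frame and `T`. The Reeb
component disappears because `T` is parallel. -/
theorem fieldCurvature_expand (h : AdaptedFrame S T cov e U) {X Y Z : VField n M} {x : M}
    (hx : x ∈ U) (hX : SmoothFieldAt X x) (hY : SmoothFieldAt Y x) {V : Set M} (hV : IsOpen V)
    (hxV : x ∈ V) (hZ : SmoothFieldOn Z V) :
    fieldCurvature cov X Y Z x
      = ∑ c, S.levi x (Z x) (e c x) • fieldCurvature cov X Y (e c) x := by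
  have hUV := h.isOpen.inter hV
  have hx' : x ∈ U ∩ V := ⟨hx, hxV⟩
  have h' := h.mono hUV Set.inter_subset_left
  replace hZ : SmoothFieldOn Z (U ∩ V) := ContMDiffOn.mono hZ Set.inter_subset_right
  let f : Option (Fin (2 * n)) → VField n M := fun a => a.elim T e
  let k : Option (Fin (2 * n)) → M → ℝ := fun a =>
    a.elim (fun y => S.θ y (Z y)) fun c y => S.levi y (Z y) (e c y)
  have hf : ∀ a, SmoothFieldOn (f a) (U ∩ V) := by
    rintro (_ | a)
    · exact h'.smooth_reeb
    · exact (h'.horizontal a).1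
  have hk : ∀ a, ContMDiffOn (𝓡 (2 * n + 1)) 𝓘(ℝ, ℝ) ∞ (k a) (U ∩ V) := by
    rintro (_ | a)
    · exact S.smooth_θ _ hUV _ hZ
    · exact HorizontalOn.levi hUV hZ (h'.horizontal a)
  have hexp : ∀ y ∈ U ∩ V, Z y = ∑ a, k a y • f a y := by
    intro y hy
    have h1 := h'.expand hy (Z y)
    exact h1.trans ((add_comm _ _).trans (Fintype.sum_option fun a => k a y • f a y).symm)
  have hcov := h.tanakaWebster.smooth
  rw [fieldCurvature_congr cov hUV hZ hx' hexp
    (mdifferentiableAt_cov hcov hUV hZ hx' (hX.mdifferentiableAt (by simp)))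
    (mdifferentiableAt_cov hcov hUV hZ hx' (hY.mdifferentiableAt (by simp))),
    fieldCurvature_sum hcov hUV hk hf hx' hX hY]
  have hT0 : fieldCurvature cov X Y T x = 0 := by
    have h0 (A : VField n M) : (fun y => cov T y (A y)) = 0 :=
      funext fun y => h.tanakaWebster.reeb_parallel y _
    have h1 : cov 0 = 0 := cov.zero
    rw [fieldCurvature, h0, h0, h1, h.tanakaWebster.reeb_parallel]
    simp
  refine (Fintype.sum_option _).trans ?_
  have h0 : k none x • fieldCurvature cov X Y (f none) x = 0 :=
    (congrArg (k none x • ·) hT0).trans (smul_zero _)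
  exact (congrArg (· + _) h0).trans (zero_add _)

/-- Since `J` is parallel on sections of `ξ`, it commutes with the curvature, and it is skew for the
Levi metric. -/
theorem curvCoeff_J (h : AdaptedFrame S T cov e U) {x : M} (hx : x ∈ U) (a b c d : Fin (2 * n)) :
    ∑ f, jCoeff S e x c f * curvCoeff S cov e x a b f d
      = -∑ f, jCoeff S e x d f * curvCoeff S cov e x a b c f := by
  have he (a) := (h.horizontal a).1
  have hJ := (h.horizontal c).J h.isOpen
  have h1 := h.fieldCurvature_expand hx ((he a).contMDiffAt h.isOpen hx)
    ((he b).contMDiffAt h.isOpen hx) h.isOpen hx hJ.1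
  have key (A B : Fin (2 * n)) : cov (fun y => cov (fun y => S.J y (e c y)) y (e A y)) x (e B x)
      = S.J x (cov (fun y => cov (e c) y (e A y)) x (e B x)) := by
    rw [← h.tanakaWebster.J_parallel U h.isOpen _ (h.horizontal_cov (h.horizontal c) (he A)) x hx]
    rw [cov_congr cov ((h.smooth_cov hJ.1 (he A)).mdifferentiableAt h.isOpen hx)]
    filter_upwards [h.isOpen.mem_nhds hx] with y hy
      using h.tanakaWebster.J_parallel U h.isOpen _ (h.horizontal c) y hy _
  have h2 : fieldCurvature cov (e a) (e b) (fun y => S.J y (e c y)) x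
      = S.J x (fieldCurvature cov (e a) (e b) (e c) x) := by
    rw [fieldCurvature, fieldCurvature, map_sub, map_sub, key, key,
      h.tanakaWebster.J_parallel U h.isOpen _ (h.horizontal c) x hx]
  rw [h2] at h1
  have h3 := congrArg (fun v => S.levi x v (e d x)) h1
  simp only [levi_sum_left, levi_smul_left] at h3
  have h0 := h.θ_fieldCurvature (he a) (he b) (h.horizontal c) hx
  rw [h.reeb.levi_J_left h0 (h.θ_frame hx d),
    h.levi_eq_sum hx _ (S.J_mem x _ (h.θ_frame hx d))] at h3
  simp only [jCoeff, curvCoeff]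
  rw [← h3, neg_inj]
  exact Finset.sum_congr rfl fun f _ => mul_comm ..

/-- One third of the Bianchi identity: the torsion equation for `e_b`, `e_c` is differentiated along
`e_a`. Cyclic summation turns the left side into curvatures and the double brackets into the Jacobi
identity. -/
theorem levi_second_derivative (h : AdaptedFrame S T cov e U) {x : M} (hx : x ∈ U)
    (a b c d : Fin (2 * n)) :
    S.levi x (cov (fun y => cov (e c) y (e b y)) x (e a x)
        - cov (fun y => cov (e b) y (e c y)) x (e a x)
        - cov (e a) x (mlieBracket (𝓡 (2 * n + 1)) (e b) (e c) x)) (e d x)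
      = S.levi x (mlieBracket (𝓡 (2 * n + 1)) (e a) (mlieBracket (𝓡 (2 * n + 1)) (e b) (e c)) x)
          (e d x)
        + 2 * jCoeff S e x b c * torsionCoeff S T cov e x a d := by
  have he (a) := (h.horizontal a).1
  set W : VField n M := mlieBracket (𝓡 (2 * n + 1)) (e b) (e c) with hW
  have sW : SmoothFieldOn W U := SmoothFieldOn.mlieBracket h.isOpen (he b) (he c)
  have dW := sW.mdifferentiableAt h.isOpen hx
  have dT := h.smooth_reeb.mdifferentiableAt h.isOpen hx
  have dk := ((S.smooth_θ U h.isOpen W sW).contMDiffAt (h.isOpen.mem_nhds hx)).mdifferentiableAt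
    (by simp)
  have d1 := (h.smooth_cov (he c) (he b)).mdifferentiableAt h.isOpen hx
  have d2 := (h.smooth_cov (he b) (he c)).mdifferentiableAt h.isOpen hx
  -- The torsion equation holds on a neighbourhood and so may be differentiated. The vertical term
  -- contributes only a multiple of `T`, as `T` is parallel, and pairs to zero with `e_d`.
  have h1 : cov ((fun y => cov (e b) y (e c y)) + W) x
      = cov ((fun y => cov (e c) y (e b y)) + (fun y => S.θ y (W y)) • T) x := by
    refine cov_congr cov (mdifferentiableAt_add_section d2 dW) ?_
    filter_upwards [h.isOpen.mem_nhds hx] with y hy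
    have h2 := h.torsion_frame hy (h.horizontal b) (h.horizontal c)
    rw [sub_eq_iff_eq_add] at h2
    simp only [Pi.add_apply, Pi.smul_apply']
    rw [h2, ← hW]
    module
  rw [cov.isCovariantDerivativeOn.add (s := Set.univ) d2 dW,
    cov.isCovariantDerivativeOn.add (s := Set.univ) d1 (dk.smul_section dT),
    cov.isCovariantDerivativeOn.leibniz (s := Set.univ) dT dk] at h1
  have h2 := congrArg (fun L => S.levi x (L (e a x)) (e d x)) h1
  simp only [_root_.add_apply, _root_.smul_apply, ContinuousLinearMap.smulRight_apply,
    levi_add_left, levi_smul_left, h.tanakaWebster.reeb_parallel, h.reeb.levi_left] at h2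
  have h3 : S.levi x (0 : TangentSpace (𝓡 (2 * n + 1)) x) (e d x) = 0 := by simp [levi_eq]
  rw [h3] at h2
  -- The derivative of the bracket `W` along `e_a` is exchanged for that of `e_a` along `W`. The
  -- torsion of `e_a` and `W` sees only `θ W = -dθ(e_b, e_c)`, hence the term `2 j t`.
  have h4 := cov.torsion_apply ((he a).mdifferentiableAt h.isOpen hx) dW
  have h5 := h.levi_torsion hx a d (W x)
  rw [h4, levi_sub_left, levi_sub_left, hW, neg_mul, ← neg_mul,
    ← (h.horizontal b).dθ_apply h.isOpen (h.horizontal c) hx, h.dθ_frame hx, ← hW] at h5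
  rw [levi_sub_left, levi_sub_left]
  linarith

/-- The first Bianchi identity. -/
theorem bianchi (h : AdaptedFrame S T cov e U) {x : M} (hx : x ∈ U) (a b c d : Fin (2 * n)) :
    curvCoeff S cov e x a b c d + curvCoeff S cov e x b c a d + curvCoeff S cov e x c a b d
      = 2 * jCoeff S e x a b * torsionCoeff S T cov e x c d
        + 2 * jCoeff S e x b c * torsionCoeff S T cov e x a d
        + 2 * jCoeff S e x c a * torsionCoeff S T cov e x b d := by
  have h1 := h.levi_second_derivative hx a b c d
  have h2 := h.levi_second_derivative hx b c a d
  have h3 := h.levi_second_derivative hx c a b d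
  have : IsManifold (𝓡 (2 * n + 1)) (minSmoothness ℝ 3) M := by
    simp only [minSmoothness_of_isRCLikeNormedField]
    exact IsManifold.of_le (n := ∞) ENat.LEInfty.out
  have m2 : (2 : ℕ∞ω) ≤ ∞ := ENat.LEInfty.out
  have he (a) := ((h.horizontal a).1.contMDiffAt h.isOpen hx).of_le
    (m := minSmoothness ℝ 2) (by simpa using m2)
  have hJ := leibniz_identity_mlieBracket_apply (he a) (he b) (he c)
  have sw : mlieBracket (𝓡 (2 * n + 1)) (e b) (mlieBracket (𝓡 (2 * n + 1)) (e a) (e c)) x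
      = -mlieBracket (𝓡 (2 * n + 1)) (e b) (mlieBracket (𝓡 (2 * n + 1)) (e c) (e a)) x := by
    have h4 := mlieBracket_const_smul_right (c := (-1 : ℝ)) (V := e b)
      ((SmoothFieldOn.mlieBracket h.isOpen (h.horizontal c).1
        (h.horizontal a).1).mdifferentiableAt h.isOpen hx)
    rw [mlieBracket_swap (V := e a), ← neg_one_smul ℝ (mlieBracket (𝓡 (2 * n + 1)) (e c) (e a)), h4,
      neg_one_smul]
  rw [mlieBracket_swap_apply (V := mlieBracket (𝓡 (2 * n + 1)) (e a) (e b)), sw] at hJ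
  rw [hJ, levi_add_left, levi_neg_left, levi_neg_left] at h1
  simp only [levi_sub_left] at h1 h2 h3
  simp only [curvCoeff, fieldCurvature, levi_sub_left]
  linarith

end AdaptedFrame
end PseudohermitianStructure
end AdaptedFrames
end CRSpin

/-! ### The spin connection in a frame and its curvature. -/

namespace CRSpin

open Bundle VectorField Filter FiberBundle
open scoped Manifold ContDiff Topology

noncomputable section SpinorFields

theorem mvfderiv_sum {E : Type*} [NormedAddCommGroup E] [NormedSpace ℝ E]
    {H : Type*} [TopologicalSpace H] {I : ModelWithCorners ℝ E H}
    {M : Type*} [TopologicalSpace M] [ChartedSpace H M]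
    {F : Type*} [NormedAddCommGroup F] [NormedSpace ℝ F] {ι : Type*} {s : Finset ι}
    {f : ι → M → F} {x : M} (hf : ∀ a ∈ s, MDifferentiableAt I 𝓘(ℝ, F) (f a) x)
    (v : TangentSpace I x) :
    mvfderiv I (fun y => ∑ a ∈ s, f a y) x v = ∑ a ∈ s, mvfderiv I (f a) x v := by
  classical
  suffices h : MDifferentiableAt I 𝓘(ℝ, F) (fun y => ∑ a ∈ s, f a y) x ∧
      mvfderiv I (fun y => ∑ a ∈ s, f a y) x v = ∑ a ∈ s, mvfderiv I (f a) x v from h.2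
  induction s using Finset.induction_on with
  | empty =>
    simp only [Finset.sum_empty]
    exact ⟨mdifferentiableAt_const, by rw [mvfderiv_const]; rfl⟩
  | insert a s ha ih =>
    obtain ⟨h1, h2⟩ := ih fun b hb => hf b (Finset.mem_insert_of_mem hb)
    have h3 := hf a (Finset.mem_insert_self a s)
    simp only [Finset.sum_insert ha]
    refine ⟨h3.add h1, ?_⟩
    rw [← h2]
    exact congrArg (fun L => L v) (mvfderiv_add h3 h1)

theorem gamma_isCliffordSystem {n : ℕ} : IsCliffordSystem (gamma (n := n)) := fun a b => by
  rw [gamma_anticomm]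
  split_ifs
  · exact LinearMap.ext fun f => funext fun s => by simp
  · rfl

variable {n : ℕ} {M : Type*} [TopologicalSpace M]
  [ChartedSpace (EuclideanSpace ℝ (Fin (2 * n + 1))) M]

theorem mvfderiv_end_apply (A : Module.End ℂ (Spinor n)) {ψ : M → Spinor n} {x : M}
    (hψ : MDifferentiableAt (𝓡 (2 * n + 1)) 𝓘(ℝ, Spinor n) ψ x)
    (v : TangentSpace (𝓡 (2 * n + 1)) x) :
    mvfderiv (𝓡 (2 * n + 1)) (fun y => A (ψ y)) x v = A (mvfderiv (𝓡 (2 * n + 1)) ψ x v) :=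
  mvfderiv_clm_comp (LinearMap.toContinuousLinearMap (A.restrictScalars ℝ)) hψ v

theorem contMDiffAt_end_apply (A : Module.End ℂ (Spinor n)) {ψ : M → Spinor n} {x : M}
    (hψ : ContMDiffAt (𝓡 (2 * n + 1)) 𝓘(ℝ, Spinor n) ∞ ψ x) :
    ContMDiffAt (𝓡 (2 * n + 1)) 𝓘(ℝ, Spinor n) ∞ (fun y => A (ψ y)) x :=
  (LinearMap.toContinuousLinearMap (A.restrictScalars ℝ)).contMDiff.contMDiffAt.comp x hψ

/-- Separating the scalar entries from the constant endomorphisms `gamma a * gamma b` lets the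
product rule apply when both `m` and `ψ` vary. -/
theorem spinOf_apply {m : Fin (2 * n) → Fin (2 * n) → ℝ} (ψ : Spinor n) :
    spinOf gamma m ψ = ∑ a, ∑ b, m a b • ((1 / 4 : ℝ) • (gamma a * gamma b)) ψ := by
  simp only [spinOf, Finset.smul_sum, LinearMap.sum_apply, LinearMap.smul_apply]
  exact Finset.sum_congr rfl fun a _ => Finset.sum_congr rfl fun b _ => smul_comm ..

theorem contMDiffAt_spinOf_apply {m : M → Fin (2 * n) → Fin (2 * n) → ℝ} {ψ : M → Spinor n} {x : M}
    (hm : ∀ a b, ContMDiffAt (𝓡 (2 * n + 1)) 𝓘(ℝ, ℝ) ∞ (fun y => m y a b) x)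
    (hψ : ContMDiffAt (𝓡 (2 * n + 1)) 𝓘(ℝ, Spinor n) ∞ ψ x) :
    ContMDiffAt (𝓡 (2 * n + 1)) 𝓘(ℝ, Spinor n) ∞ (fun y => spinOf gamma (m y) (ψ y)) x := by
  simp only [spinOf_apply]
  exact contMDiffAt_finsetSum fun a _ => contMDiffAt_finsetSum fun b _ =>
    (hm a b).smul (contMDiffAt_end_apply _ hψ)

theorem mvfderiv_spinOf_apply {m : M → Fin (2 * n) → Fin (2 * n) → ℝ} {ψ : M → Spinor n} {x : M}
    (hm : ∀ a b, ContMDiffAt (𝓡 (2 * n + 1)) 𝓘(ℝ, ℝ) ∞ (fun y => m y a b) x)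
    (hψ : ContMDiffAt (𝓡 (2 * n + 1)) 𝓘(ℝ, Spinor n) ∞ ψ x)
    (v : TangentSpace (𝓡 (2 * n + 1)) x) :
    mvfderiv (𝓡 (2 * n + 1)) (fun y => spinOf gamma (m y) (ψ y)) x v
      = spinOf gamma (fun a b => mvfderiv (𝓡 (2 * n + 1)) (fun y => m y a b) x v) (ψ x)
        + spinOf gamma (m x) (mvfderiv (𝓡 (2 * n + 1)) ψ x v) := by
  have dm (a b) := (hm a b).mdifferentiableAt (by simp)
  have dψ := hψ.mdifferentiableAt (by simp)
  have dA (A : Module.End ℂ (Spinor n)) := (contMDiffAt_end_apply A hψ).mdifferentiableAt (by simp)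
  have key (a b : Fin (2 * n)) (A : Module.End ℂ (Spinor n)) :
      mvfderiv (𝓡 (2 * n + 1)) (fun y => m y a b • A (ψ y)) x v
        = m x a b • A (mvfderiv (𝓡 (2 * n + 1)) ψ x v)
          + mvfderiv (𝓡 (2 * n + 1)) (fun y => m y a b) x v • A (ψ x) := by
    rw [← mvfderiv_end_apply A dψ]
    exact congrArg (fun L => L v) (mvfderiv_smul (dm a b) (dA A))
  simp only [spinOf_apply]
  rw [mvfderiv_sum]
  swap
  · exact fun a _ => ContMDiffAt.mdifferentiableAt (n := ∞) (contMDiffAt_finsetSum fun b _ =>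
      (hm a b).smul (contMDiffAt_end_apply _ hψ)) (by simp)
  simp only [← Finset.sum_add_distrib]
  refine Finset.sum_congr rfl fun a _ => ?_
  rw [mvfderiv_sum]
  swap
  · exact fun b _ => ((hm a b).smul (contMDiffAt_end_apply _ hψ)).mdifferentiableAt (by simp)
  refine Finset.sum_congr rfl fun b _ => ?_
  rw [key, add_comm]

theorem spinOf_add {m m' : Fin (2 * n) → Fin (2 * n) → ℝ} :
    spinOf (gamma (n := n)) (fun a b => m a b + m' a b) = spinOf gamma m + spinOf gamma m' := by
  simp only [spinOf, add_smul, Finset.sum_add_distrib, smul_add]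

theorem spinOf_sub {m m' : Fin (2 * n) → Fin (2 * n) → ℝ} :
    spinOf (gamma (n := n)) (fun a b => m a b - m' a b) = spinOf gamma m - spinOf gamma m' := by
  simp only [spinOf, sub_smul, Finset.sum_sub_distrib, smul_sub]

theorem spinOf_smul {c : ℝ} {m : Fin (2 * n) → Fin (2 * n) → ℝ} :
    spinOf (gamma (n := n)) (fun a b => c * m a b) = c • spinOf gamma m := by
  simp only [spinOf, mul_smul, Finset.smul_sum, smul_comm _ c]

variable [IsManifold (𝓡 (2 * n + 1)) ∞ M]

namespace PseudohermitianStructure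

variable {S : PseudohermitianStructure n M} {T : VField n M}
  {cov : CovariantDerivative (𝓡 (2 * n + 1)) (EuclideanSpace ℝ (Fin (2 * n + 1)))
    (TangentSpace (𝓡 (2 * n + 1)) : M → Type _)}
  {e : Fin (2 * n) → VField n M} {U : Set M}

variable (S cov e) in
/-- The spin connection in the frame `e`. -/
def spinNabla (X : VField n M) (ψ : M → Spinor n) (y : M) : Spinor n :=
  mvfderiv (𝓡 (2 * n + 1)) ψ y (X y)
    + spinOf gamma (fun c d => connCoeff S cov e c d y (X y)) (ψ y)

theorem spinNabla_add_field (X Y : VField n M) (ψ : M → Spinor n) (x : M) :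
    spinNabla S cov e (X + Y) ψ x = spinNabla S cov e X ψ x + spinNabla S cov e Y ψ x := by
  simp only [spinNabla, Pi.add_apply, map_add, connCoeff_add, spinOf_add, LinearMap.add_apply]
  abel

theorem spinNabla_smul_field (c : ℝ) (X : VField n M) (ψ : M → Spinor n) (x : M) :
    spinNabla S cov e (c • X) ψ x = c • spinNabla S cov e X ψ x := by
  have h (a b : Fin (2 * n)) : connCoeff S cov e a b x (c • X x) = c * connCoeff S cov e a b x (X x) := by
    simp only [connCoeff, map_smul, levi_smul_left]
  simp only [spinNabla, Pi.smul_apply, map_smul, h, spinOf_smul, LinearMap.smul_apply, smul_add]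

theorem spinNabla_sum_field {ι : Type*} (s : Finset ι) (c : ι → ℝ) (X : ι → VField n M)
    (ψ : M → Spinor n) (x : M) :
    spinNabla S cov e (∑ a ∈ s, c a • X a) ψ x = ∑ a ∈ s, c a • spinNabla S cov e (X a) ψ x := by
  classical
  induction s using Finset.induction_on with
  | empty => simpa using spinNabla_smul_field (S := S) (cov := cov) (e := e) 0 0 ψ x
  | insert a s ha ih =>
    rw [Finset.sum_insert ha, Finset.sum_insert ha, spinNabla_add_field, spinNabla_smul_field, ih]

theorem spinNabla_congr_field {X Y : VField n M} {x : M} (h : X x = Y x) (ψ : M → Spinor n) :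
    spinNabla S cov e X ψ x = spinNabla S cov e Y ψ x := by
  simp only [spinNabla, h]

theorem spinNabla_congr {X : VField n M} {ψ ψ' : M → Spinor n} {x : M} (h : ψ =ᶠ[𝓝 x] ψ') :
    spinNabla S cov e X ψ x = spinNabla S cov e X ψ' x := by
  simp only [spinNabla, mvfderiv_congr h, h.eq_of_nhds]

theorem spinNabla_sum {ι : Type*} {s : Finset ι} {X : VField n M} {ψ : ι → M → Spinor n} {x : M}
    (hψ : ∀ a ∈ s, MDifferentiableAt (𝓡 (2 * n + 1)) 𝓘(ℝ, Spinor n) (ψ a) x) :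
    spinNabla S cov e X (fun y => ∑ a ∈ s, ψ a y) x = ∑ a ∈ s, spinNabla S cov e X (ψ a) x := by
  simp only [spinNabla, mvfderiv_sum hψ, map_sum, Finset.sum_add_distrib]

namespace AdaptedFrame

/-- The spin connection is compatible with Clifford multiplication. -/
theorem spinNabla_gamma (h : AdaptedFrame S T cov e U) {x : M} (hx : x ∈ U) (X : VField n M)
    (b : Fin (2 * n)) {ψ : M → Spinor n}
    (hψ : MDifferentiableAt (𝓡 (2 * n + 1)) 𝓘(ℝ, Spinor n) ψ x) :
    spinNabla S cov e X (fun y => gamma b (ψ y)) x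
      = gamma b (spinNabla S cov e X ψ x)
        + ∑ c, connCoeff S cov e b c x (X x) • gamma c (ψ x) := by
  have h1 := congrArg (fun A => A (ψ x)) (gamma_isCliffordSystem.spinOf_mul
    (fun c d => h.connCoeff_swap hx c d (X x)) b)
  simp only [Module.End.mul_apply, LinearMap.add_apply, LinearMap.sum_apply,
    LinearMap.smul_apply] at h1
  rw [spinNabla, mvfderiv_end_apply _ hψ, h1, spinNabla, map_add, add_assoc]

variable [T2Space M]

theorem contMDiffOn_spinNabla (h : AdaptedFrame S T cov e U) {X : VField n M}
    (hX : SmoothFieldOn X U) {ψ : M → Spinor n}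
    (hψ : ContMDiffOn (𝓡 (2 * n + 1)) 𝓘(ℝ, Spinor n) ∞ ψ U) :
    ContMDiffOn (𝓡 (2 * n + 1)) 𝓘(ℝ, Spinor n) ∞ (spinNabla S cov e X ψ) U := fun _ hx =>
  (((hX.mvfderiv h.isOpen hψ).contMDiffAt (h.isOpen.mem_nhds hx)).add
    (contMDiffAt_spinOf_apply (fun a b => (h.smooth_connCoeff hX a b).contMDiffAt
      (h.isOpen.mem_nhds hx)) (hψ.contMDiffAt (h.isOpen.mem_nhds hx)))).contMDiffWithinAt

/-- The curvature of the spin connection. -/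
theorem spinNabla_commutator (h : AdaptedFrame S T cov e U) {X Y : VField n M}
    (hX : SmoothFieldOn X U) (hY : SmoothFieldOn Y U) {ψ : M → Spinor n}
    (hψ : ContMDiffOn (𝓡 (2 * n + 1)) 𝓘(ℝ, Spinor n) ∞ ψ U) {x : M} (hx : x ∈ U) :
    spinNabla S cov e X (spinNabla S cov e Y ψ) x - spinNabla S cov e Y (spinNabla S cov e X ψ) x
      = spinNabla S cov e (mlieBracket (𝓡 (2 * n + 1)) X Y) ψ x
        + spinOf gamma (fun c d => S.levi x (fieldCurvature cov X Y (e c) x) (e d x)) (ψ x) := by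
  have sψ := hψ.contMDiffAt (h.isOpen.mem_nhds hx)
  -- The two cross terms, with one derivative of `ψ` and one connection matrix, are interchanged by
  -- swapping `A` and `B`, so they drop out of the commutator.
  have key {A B : VField n M} (hA : SmoothFieldOn A U) (hB : SmoothFieldOn B U) :
      spinNabla S cov e A (spinNabla S cov e B ψ) x
        = mvfderiv (𝓡 (2 * n + 1)) (fun y => mvfderiv (𝓡 (2 * n + 1)) ψ y (B y)) x (A x)
          + spinOf gamma (fun c d => mvfderiv (𝓡 (2 * n + 1))
              (fun y => connCoeff S cov e c d y (B y)) x (A x)) (ψ x)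
          + spinOf gamma (fun c d => connCoeff S cov e c d x (B x))
              (mvfderiv (𝓡 (2 * n + 1)) ψ x (A x))
          + spinOf gamma (fun c d => connCoeff S cov e c d x (A x))
              (mvfderiv (𝓡 (2 * n + 1)) ψ x (B x))
          + (spinOf gamma (fun c d => connCoeff S cov e c d x (A x))
              * spinOf gamma (fun c d => connCoeff S cov e c d x (B x))) (ψ x) := by
    have sc (c d) := (h.smooth_connCoeff hB c d).contMDiffAt (h.isOpen.mem_nhds hx)
    have s1 := (hB.mvfderiv h.isOpen hψ).contMDiffAt (h.isOpen.mem_nhds hx)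
    have s2 := contMDiffAt_spinOf_apply sc sψ
    have h1 : mvfderiv (𝓡 (2 * n + 1)) (spinNabla S cov e B ψ) x (A x)
        = mvfderiv (𝓡 (2 * n + 1)) (fun y => mvfderiv (𝓡 (2 * n + 1)) ψ y (B y)) x (A x)
          + mvfderiv (𝓡 (2 * n + 1))
            (fun y => spinOf gamma (fun c d => connCoeff S cov e c d y (B y)) (ψ y)) x (A x) :=
      congrArg (fun L => L (A x)) (mvfderiv_add (s1.mdifferentiableAt (by simp))
        (s2.mdifferentiableAt (by simp)))
    rw [spinNabla, h1, mvfderiv_spinOf_apply sc sψ]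
    simp only [spinNabla, map_add, Module.End.mul_apply]
    abel
  have hc := congrArg (fun A => A (ψ x)) (gamma_isCliffordSystem.spinOf_commutator
    (M := fun c d => connCoeff S cov e c d x (X x)) (N := fun c d => connCoeff S cov e c d x (Y x))
    (fun c d => h.connCoeff_swap hx c d (X x)))
  -- The second structure equation under `spinOf`. Its quadratic term is the commutator of the two
  -- connection matrices in the reversed order of `spinOf_commutator`, with skewness turning `d f`
  -- into `f d`.
  have hs : spinOf gamma (fun c d => mvfderiv (𝓡 (2 * n + 1))
          (fun y => connCoeff S cov e c d y (Y y)) x (X x)) (ψ x)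
        - spinOf gamma (fun c d => mvfderiv (𝓡 (2 * n + 1))
          (fun y => connCoeff S cov e c d y (X y)) x (Y x)) (ψ x)
        - spinOf gamma (fun c d => connCoeff S cov e c d x (mlieBracket (𝓡 (2 * n + 1)) X Y x)) (ψ x)
      = spinOf gamma (fun c d => S.levi x (fieldCurvature cov X Y (e c) x) (e d x)) (ψ x)
        - spinOf gamma (fun c d => ∑ f, (connCoeff S cov e c f x (Y x) * connCoeff S cov e f d x (X x)
          - connCoeff S cov e c f x (X x) * connCoeff S cov e f d x (Y x))) (ψ x) := by
    simp only [← LinearMap.sub_apply, ← spinOf_sub]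
    congr 2
    funext c d
    rw [h.mvfderiv_connCoeff hX hY hx, sub_eq_add_neg, ← Finset.sum_neg_distrib]
    congr 1
    exact Finset.sum_congr rfl fun f _ => by
      rw [h.connCoeff_swap hx d f, h.connCoeff_swap hx d f]; ring
  have hb := mvfderiv_mlieBracket sψ (hX.contMDiffAt h.isOpen hx) (hY.contMDiffAt h.isOpen hx)
  rw [key hX hY, key hY hX, spinNabla, ← hb]
  simp only [LinearMap.sub_apply] at hc
  rw [← hc] at hs
  linear_combination hs

end AdaptedFrame
end PseudohermitianStructure
end SpinorFields
end CRSpin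

/-! ### The Weitzenböck formula in a frame. -/

namespace CRSpin

open Bundle VectorField Filter FiberBundle
open scoped Manifold ContDiff Topology

noncomputable section WeitzenboeckFormula

/-- The symmetric part of `X` contracts to minus its trace, and the skew part is left as a
commutator; this separates the Laplacian from the curvature. -/
theorem IsCliffordSystem.sum_apply {ι V : Type*} [Fintype ι] [DecidableEq ι] [AddCommGroup V]
    [Module ℂ V] {g : ι → Module.End ℂ V} (hg : IsCliffordSystem g) (X : ι → ι → V) :
    ∑ a, ∑ b, g a (g b (X a b))
      = -∑ a, X a a + (1 / 2 : ℝ) • ∑ a, ∑ b, g a (g b (X a b - X b a)) := by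
  have h1 (a b : ι) : g a (g b (X b a)) = -g b (g a (X b a)) - if a = b then (2 : ℝ) • X b a else 0 := by
    have h := congrArg (fun A => A (X b a)) (hg.mul_swap a b)
    simp only [Module.End.mul_apply, LinearMap.add_apply, LinearMap.neg_apply] at h
    rw [h]
    split_ifs <;> simp [sub_eq_add_neg]
  have h2 : ∑ a, ∑ b, g a (g b (X b a))
      = -∑ a, ∑ b, g a (g b (X a b)) - (2 : ℝ) • ∑ a, X a a := by
    simp only [h1, Finset.sum_sub_distrib, Finset.sum_neg_distrib, Finset.sum_ite_eq,
      Finset.mem_univ, if_true, Finset.smul_sum]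
    rw [Finset.sum_comm]
  simp only [map_sub, Finset.sum_sub_distrib, h2]
  module

variable {n : ℕ} {M : Type*} [TopologicalSpace M]
  [ChartedSpace (EuclideanSpace ℝ (Fin (2 * n + 1))) M] [IsManifold (𝓡 (2 * n + 1)) ∞ M]

namespace PseudohermitianStructure

variable {S : PseudohermitianStructure n M} {T : VField n M}
  {cov : CovariantDerivative (𝓡 (2 * n + 1)) (EuclideanSpace ℝ (Fin (2 * n + 1)))
    (TangentSpace (𝓡 (2 * n + 1)) : M → Type _)}
  {e : Fin (2 * n) → VField n M} {U : Set M}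

variable (S cov e) in
/-- The second derivative `∇²_{e_a, e_b} ψ` in the frame `e`. -/
def spinHessian (ψ : M → Spinor n) (x : M) (a b : Fin (2 * n)) : Spinor n :=
  spinNabla S cov e (e a) (spinNabla S cov e (e b) ψ) x
    - spinNabla S cov e (fun y => cov (e b) y (e a y)) ψ x

variable (S cov e) in
/-- The contact Dirac operator in the frame `e`. -/
def frameDirac (ψ : M → Spinor n) (x : M) : Spinor n :=
  ∑ a, gamma a (spinNabla S cov e (e a) ψ x)

namespace AdaptedFrame

theorem spinNabla_cov (h : AdaptedFrame S T cov e U) {x : M} (hx : x ∈ U) (X : VField n M)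
    (b : Fin (2 * n)) (ψ : M → Spinor n) :
    spinNabla S cov e (fun y => cov (e b) y (X y)) ψ x
      = ∑ c, connCoeff S cov e b c x (X x) • spinNabla S cov e (e c) ψ x := by
  rw [← spinNabla_sum_field]
  refine spinNabla_congr_field ?_ ψ
  rw [Finset.sum_apply]
  exact h.cov_frame hx b (X x)

variable [T2Space M]

theorem frameDirac_frameDirac (h : AdaptedFrame S T cov e U) {ψ : M → Spinor n}
    (hψ : ContMDiffOn (𝓡 (2 * n + 1)) 𝓘(ℝ, Spinor n) ∞ ψ U) {x : M} (hx : x ∈ U) :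
    frameDirac S cov e (frameDirac S cov e ψ) x
      = ∑ a, ∑ b, gamma a (gamma b (spinHessian S cov e ψ x a b)) := by
  have sψ (b) := (h.contMDiffOn_spinNabla (h.horizontal b).1 hψ).contMDiffAt (h.isOpen.mem_nhds hx)
  have dψ (b) := (sψ b).mdifferentiableAt (by simp)
  have dg (b : Fin (2 * n)) := (contMDiffAt_end_apply (gamma b) (sψ b)).mdifferentiableAt (by simp)
  rw [frameDirac]
  refine Finset.sum_congr rfl fun a _ => ?_
  have h1 : spinNabla S cov e (e a) (frameDirac S cov e ψ) x = _ :=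
    spinNabla_sum (ψ := fun b y => gamma b (spinNabla S cov e (e b) ψ y)) fun b _ => dg b
  rw [h1, map_sum, ← sub_eq_zero, ← Finset.sum_sub_distrib]
  simp only [h.spinNabla_gamma hx _ _ (dψ _), spinHessian, h.spinNabla_cov hx, map_sub, map_add,
    map_sum]
  -- The term from differentiating the frame vector inside the inner Dirac operator matches the
  -- correction `∇_{∇_a e_b}` in the Hessian, by skewness of the connection coefficients.
  have h2 : ∑ b, ∑ c, gamma a (connCoeff S cov e b c x (e a x) • gamma c (spinNabla S cov e (e b) ψ x))
      = -∑ b, ∑ c, gamma a (gamma b (connCoeff S cov e b c x (e a x) • spinNabla S cov e (e c) ψ x)) := by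
    rw [Finset.sum_comm, ← Finset.sum_neg_distrib]
    refine Finset.sum_congr rfl fun b _ => ?_
    rw [← Finset.sum_neg_distrib]
    refine Finset.sum_congr rfl fun c _ => ?_
    rw [h.connCoeff_swap hx c b, LinearMap.map_smul_of_tower (gamma b), neg_smul, map_neg]
  rw [Finset.sum_sub_distrib, Finset.sum_add_distrib, Finset.sum_sub_distrib, h2]
  abel

/-- The Ricci identity: `∇_a e_b - ∇_b e_a` exceeds the bracket `[e_a, e_b]` by the torsion `2 j_ab
T`, which is the source of the first-order term in `T`. -/
theorem spinHessian_sub (h : AdaptedFrame S T cov e U) {ψ : M → Spinor n}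
    (hψ : ContMDiffOn (𝓡 (2 * n + 1)) 𝓘(ℝ, Spinor n) ∞ ψ U) {x : M} (hx : x ∈ U)
    (a b : Fin (2 * n)) :
    spinHessian S cov e ψ x a b - spinHessian S cov e ψ x b a
      = spinOf gamma (fun c d => curvCoeff S cov e x a b c d) (ψ x)
        - (2 * jCoeff S e x a b) • spinNabla S cov e T ψ x := by
  have h1 := h.spinNabla_commutator (h.horizontal a).1 (h.horizontal b).1 hψ hx
  have h2 := h.torsion_frame hx (h.horizontal a) (h.horizontal b)
  have h3 := (h.horizontal a).dθ_apply h.isOpen (h.horizontal b) hx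
  rw [h.dθ_frame hx] at h3
  have h4 : spinNabla S cov e (fun y => cov (e b) y (e a y)) ψ x
      = spinNabla S cov e ((fun y => cov (e a) y (e b y)) + (mlieBracket (𝓡 (2 * n + 1)) (e a) (e b)
        + (2 * jCoeff S e x a b) • T)) ψ x := by
    refine spinNabla_congr_field ?_ ψ
    rw [sub_eq_iff_eq_add] at h2
    simp only [Pi.add_apply, Pi.smul_apply]
    rw [h2, h3]
    module
  rw [spinNabla_add_field, spinNabla_add_field, spinNabla_smul_field] at h4
  simp only [spinHessian, curvCoeff]
  rw [h4]
  linear_combination h1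

theorem sum_gamma_curvCoeff (h : AdaptedFrame S T cov e U) {x : M} (hx : x ∈ U) :
    ∑ a, ∑ b, ∑ c, ∑ d, curvCoeff S cov e x a b c d • (gamma a * gamma b * gamma c * gamma d)
      = (2 * ∑ a, ∑ b, curvCoeff S cov e x a b b a) • (1 : Module.End ℂ (Spinor n)) := by
  have he (a) := (h.horizontal a).1
  refine gamma_isCliffordSystem.sum_curvature (w := fun a b => 2 * jCoeff S e x a b)
    (t := torsionCoeff S T cov e x) (fun a b c d => ?_) (fun a b c d => ?_) (fun a b => ?_)
    (h.torsionCoeff_swap hx) (h.torsionCoeff_trace hx) (fun a b => ?_) (h.bianchi hx)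
  · rw [curvCoeff, fieldCurvature_swap, levi_neg_left]; rfl
  · exact h.levi_fieldCurvature_swap (he a) (he b) hx c d
  · rw [h.jCoeff_swap hx]; ring
  · simp only [mul_assoc, mul_left_comm _ (2 : ℝ), ← Finset.mul_sum]
    rw [h.torsionCoeff_anticomm hx]; ring

theorem sum_jCoeff_curvCoeff (h : AdaptedFrame S T cov e U) {x : M} (hx : x ∈ U) :
    ∑ a, ∑ b, ∑ c, ∑ d, jCoeff S e x a b * jCoeff S e x c d * curvCoeff S cov e x a b c d
      = -2 * ∑ a, ∑ b, curvCoeff S cov e x a b b a := by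
  have he (a) := (h.horizontal a).1
  refine sum_curvature_complex (t := torsionCoeff S T cov e x) (fun a b c d => ?_)
    (fun a b c d => ?_) (h.jCoeff_swap hx) (h.torsionCoeff_swap hx) (h.jCoeff_mul hx)
    (h.curvCoeff_J hx) (h.bianchi hx)
  · rw [curvCoeff, fieldCurvature_swap, levi_neg_left]; rfl
  · exact h.levi_fieldCurvature_swap (he a) (he b) hx c d

/-- The constant `1 / 4` is `1 / 2` from skew-symmetrization, times `1 / 4` from `spinOf`, times `2`
from the curvature contraction. In the Reeb term the `1 / 2` cancels the factor of `2 j`. -/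
theorem weitzenboeck (h : AdaptedFrame S T cov e U) {ψ : M → Spinor n}
    (hψ : ContMDiffOn (𝓡 (2 * n + 1)) 𝓘(ℝ, Spinor n) ∞ ψ U) {x : M} (hx : x ∈ U) :
    frameDirac S cov e (frameDirac S cov e ψ) x
      = -∑ a, spinHessian S cov e ψ x a a
        + (1 / 4 * ∑ a, ∑ b, curvCoeff S cov e x a b b a) • ψ x
        - ∑ a, ∑ b, jCoeff S e x a b • gamma a (gamma b (spinNabla S cov e T ψ x)) := by
  have h1 : ∑ a, ∑ b, gamma a (gamma b (spinOf gamma (fun c d => curvCoeff S cov e x a b c d) (ψ x)))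
      = (1 / 2 * ∑ a, ∑ b, curvCoeff S cov e x a b b a) • ψ x := by
    have h2 := congrArg (fun A => (1 / 4 : ℝ) • A (ψ x)) (h.sum_gamma_curvCoeff hx)
    simp only [LinearMap.smul_apply, Module.End.one_apply, smul_smul] at h2
    have h3 : (1 / 4 : ℝ) * (2 * ∑ a, ∑ b, curvCoeff S cov e x a b b a)
        = 1 / 2 * ∑ a, ∑ b, curvCoeff S cov e x a b b a := by ring
    rw [h3] at h2
    rw [← h2]
    simp only [spinOf, LinearMap.smul_apply, LinearMap.sum_apply, Finset.smul_sum, map_sum,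
      LinearMap.map_smul_of_tower, Module.End.mul_apply]
  rw [h.frameDirac_frameDirac hψ hx, gamma_isCliffordSystem.sum_apply]
  simp only [h.spinHessian_sub hψ hx, map_sub, Finset.sum_sub_distrib, h1,
    LinearMap.map_smul_of_tower]
  simp only [mul_smul, ← Finset.smul_sum]
  module

end AdaptedFrame
end PseudohermitianStructure
end WeitzenboeckFormula
end CRSpin

/-! ### The Tanaka–Webster scalar curvature as a real trace. -/

namespace CRSpin

open Bundle VectorField Filter FiberBundle
open scoped Manifold ContDiff Topology

noncomputable section WebsterCurvature

variable {n : ℕ} {M : Type*} [TopologicalSpace M]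
  [ChartedSpace (EuclideanSpace ℝ (Fin (2 * n + 1))) M] [IsManifold (𝓡 (2 * n + 1)) ∞ M]

theorem sum_sum_comm {ι κ B : Type*} [Fintype ι] [Fintype κ] [AddCommMonoid B]
    (f : ι → ι → κ → B) : ∑ a, ∑ b, ∑ c, f a b c = ∑ c, ∑ a, ∑ b, f a b c := by
  rw [Finset.sum_comm (s := Finset.univ (α := κ))]
  exact Finset.sum_congr rfl fun a _ => Finset.sum_comm

namespace PseudohermitianStructure

variable {S : PseudohermitianStructure n M} {T : VField n M}
  {cov : CovariantDerivative (𝓡 (2 * n + 1)) (EuclideanSpace ℝ (Fin (2 * n + 1)))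
    (TangentSpace (𝓡 (2 * n + 1)) : M → Type _)}
  {e : Fin (2 * n) → VField n M} {U : Set M}

namespace AdaptedFrame

/-- The matrix of `J` in terms of a unitary basis. -/
theorem jCoeff_eq_sum (h : AdaptedFrame S T cov e U) {x : M} (hx : x ∈ U)
    {u : Fin n → TangentSpace (𝓡 (2 * n + 1)) x} (hu : S.IsUnitaryBasis x u) (a b : Fin (2 * n)) :
    jCoeff S e x a b = ∑ β, (S.levi x (u β) (e a x) * S.levi x (S.J x (u β)) (e b x)
      - S.levi x (S.J x (u β)) (e a x) * S.levi x (u β) (e b x)) := by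
  have hJ (β) := S.J_mem x _ (hu.horizontal β)
  -- Together `u` and `Ju` form an orthonormal basis of `ξ`, in which `⟨J e_a, e_b⟩` is expanded.
  let f : Fin n ⊕ Fin n → TangentSpace (𝓡 (2 * n + 1)) x := Sum.elim u fun β => S.J x (u β)
  have hf : ∀ a, S.θ x (f a) = 0 := by
    rintro (β | β)
    exacts [hu.horizontal β, hJ β]
  have ho : ∀ a b, S.levi x (f a) (f b) = if a = b then 1 else 0 := by
    rintro (β | β) (γ | γ)
    · simp [f, hu.orthonormal]
    · simp [f, hu.orthogonal_J]
    · have h1 := h.reeb.levi_symm (hJ β) (hu.horizontal γ)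
      rw [hu.orthogonal_J] at h1
      simpa [f] using h1
    · have h1 := h.reeb.levi_J (hu.horizontal β) (hu.horizontal γ)
      rw [hu.orthonormal] at h1
      simpa [f] using h1
  have hc : Fintype.card (Fin n ⊕ Fin n) = 2 * n := by simp; ring
  have ha := h.θ_frame hx a
  have hb := h.θ_frame hx b
  rw [jCoeff, h.reeb.levi_eq_sum hc hf ho (S.J x (e a x)) hb, Fintype.sum_sum_type,
    ← Finset.sum_add_distrib]
  refine Finset.sum_congr rfl fun β _ => ?_
  simp only [f, Sum.elim_inl, Sum.elim_inr]
  rw [h.reeb.levi_J_left ha (hu.horizontal β), h.reeb.levi_J ha (hu.horizontal β),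
    h.reeb.levi_symm (hu.horizontal β) ha, h.reeb.levi_symm (hu.horizontal β) hb,
    h.reeb.levi_symm (hJ β) ha, h.reeb.levi_symm (hJ β) hb]
  ring

variable [T2Space M]

/-- Tensoriality frees `curvature` from its chosen extensions and allows evaluation in the frame. No
horizontality is needed for `w`, whose Reeb component is annihilated. -/
theorem levi_curvature (h : AdaptedFrame S T cov e U) {x : M} (hx : x ∈ U)
    {u v w z : TangentSpace (𝓡 (2 * n + 1)) x} (hu : S.θ x u = 0) (hv : S.θ x v = 0)
    (hz : S.θ x z = 0) :
    S.levi x (curvature cov x u v w) z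
      = ∑ a, ∑ b, ∑ c, ∑ d, S.levi x u (e a x) * S.levi x v (e b x) * S.levi x w (e c x)
          * S.levi x z (e d x) * curvCoeff S cov e x a b c d := by
  obtain ⟨V, hV, hxV, hw⟩ := exists_smoothFieldOn_ext w
  obtain ⟨V₁, hV₁, hxV₁, su⟩ := exists_smoothFieldOn_ext u
  obtain ⟨V₂, hV₂, hxV₂, sv⟩ := exists_smoothFieldOn_ext v
  have he (a) := (h.horizontal a).1
  have de (a) := (he a).mdifferentiableAt h.isOpen hx
  let K (c : Fin (2 * n)) := curvatureHom h.tanakaWebster.smooth h.isOpen (he c) hx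
  have hK (a b c : Fin (2 * n)) : K c (e a x) (e b x) = fieldCurvature cov (e a) (e b) (e c) x :=
    curvatureHom_apply _ _ _ _ (de a) (de b)
  have h1 : curvature cov x u v w = ∑ c, S.levi x w (e c x) • K c u v := by
    have h2 := h.fieldCurvature_expand hx (su.contMDiffAt hV₁ hxV₁) (sv.contMDiffAt hV₂ hxV₂) hV hxV hw
    have h3 (c : Fin (2 * n)) : K c u v = fieldCurvature cov (ext u) (ext v) (e c) x := by
      have h4 := curvatureHom_apply h.tanakaWebster.smooth h.isOpen (he c) hx
        (mdifferentiableAt_ext u) (mdifferentiableAt_ext v)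
      rwa [ext_self, ext_self] at h4
    simp only [h3]
    rw [fieldCurvature, ext_self, ext_self, ext_self] at h2
    exact h2
  have h5 (c : Fin (2 * n)) : K c u v
      = ∑ a, ∑ b, (S.levi x u (e a x) * S.levi x v (e b x)) •
          fieldCurvature cov (e a) (e b) (e c) x := by
    conv_lhs => rw [← h.expand_of_horizontal hx hu, ← h.expand_of_horizontal hx hv]
    simp only [map_sum, map_smul, _root_.sum_apply, _root_.smul_apply, Finset.smul_sum,
      smul_smul, hK]
    rw [Finset.sum_comm]
    simp only [mul_comm]
  rw [h1, h.levi_eq_sum hx _ hz]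
  simp only [h5, levi_sum_left, levi_smul_left, Finset.mul_sum, Finset.sum_mul]
  have reorder (F : Fin (2 * n) → Fin (2 * n) → Fin (2 * n) → Fin (2 * n) → ℝ) :
      ∑ d, ∑ c, ∑ a, ∑ b, F a b c d = ∑ a, ∑ b, ∑ c, ∑ d, F a b c d := by
    simp only [← sum_sum_comm fun a b c => F a b c _]
    rw [Finset.sum_comm]
    exact Finset.sum_congr rfl fun a _ => (sum_sum_comm (F a)).symm
  refine Eq.trans ?_ (reorder _)
  refine Finset.sum_congr rfl fun d _ => Finset.sum_congr rfl fun c _ =>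
    Finset.sum_congr rfl fun a _ => Finset.sum_congr rfl fun b _ => ?_
  rw [curvCoeff]
  ring

theorem levi_curvature_swap_left (h : AdaptedFrame S T cov e U) {x : M} (hx : x ∈ U)
    {u v w z : TangentSpace (𝓡 (2 * n + 1)) x} (hu : S.θ x u = 0) (hv : S.θ x v = 0)
    (hz : S.θ x z = 0) :
    S.levi x (curvature cov x u v w) z = -S.levi x (curvature cov x v u w) z := by
  rw [h.levi_curvature hx hu hv hz, h.levi_curvature hx hv hu hz, Finset.sum_comm]
  simp only [← Finset.sum_neg_distrib]
  refine Finset.sum_congr rfl fun b _ => Finset.sum_congr rfl fun a _ =>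
    Finset.sum_congr rfl fun c _ => Finset.sum_congr rfl fun d _ => ?_
  rw [curvCoeff, curvCoeff, fieldCurvature_swap, levi_neg_left]
  ring

theorem levi_curvature_swap_right (h : AdaptedFrame S T cov e U) {x : M} (hx : x ∈ U)
    {u v w z : TangentSpace (𝓡 (2 * n + 1)) x} (hu : S.θ x u = 0) (hv : S.θ x v = 0)
    (hw : S.θ x w = 0) (hz : S.θ x z = 0) :
    S.levi x (curvature cov x u v w) z = -S.levi x (curvature cov x u v z) w := by
  rw [h.levi_curvature hx hu hv hz, h.levi_curvature hx hu hv hw]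
  simp only [← Finset.sum_neg_distrib]
  refine Finset.sum_congr rfl fun a _ => Finset.sum_congr rfl fun b _ => ?_
  rw [Finset.sum_comm]
  refine Finset.sum_congr rfl fun d _ => Finset.sum_congr rfl fun c _ => ?_
  rw [curvCoeff, curvCoeff,
    h.levi_fieldCurvature_swap (h.horizontal a).1 (h.horizontal b).1 hx]
  ring

theorem levi_curvature_smul (h : AdaptedFrame S T cov e U) {x : M} (hx : x ∈ U) (p q r : ℝ)
    {u v w z : TangentSpace (𝓡 (2 * n + 1)) x} (hu : S.θ x u = 0) (hv : S.θ x v = 0)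
    (hz : S.θ x z = 0) :
    S.levi x (curvature cov x (p • u) (q • v) (r • w)) z
      = p * q * r * S.levi x (curvature cov x u v w) z := by
  rw [h.levi_curvature hx (by simp [hu]) (by simp [hv]) hz, h.levi_curvature hx hu hv hz]
  simp only [levi_smul_left, Finset.mul_sum]
  refine Finset.sum_congr rfl fun a _ => Finset.sum_congr rfl fun b _ =>
    Finset.sum_congr rfl fun c _ => Finset.sum_congr rfl fun d _ => ?_
  ring

theorem websterCurvature_trace (h : AdaptedFrame S T cov e U) {x : M} (hx : x ∈ U)
    {u : Fin n → TangentSpace (𝓡 (2 * n + 1)) x} (hu : ∀ β, S.θ x (u β) = 0) (γ β : Fin n) :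
    S.websterCurvature cov x u γ γ β β
      = ((-1 / 2 * S.levi x (curvature cov x (u β) (S.J x (u β)) (u γ)) (S.J x (u γ)) : ℝ) : ℂ) := by
  have hJ (β) := S.J_mem x _ (hu β)
  have h0 {a b c : TangentSpace (𝓡 (2 * n + 1)) x} (ha : S.θ x a = 0) (hb : S.θ x b = 0)
      (hc : S.θ x c = 0) : S.levi x (curvature cov x a b c) c = 0 := by
    linarith [h.levi_curvature_swap_right hx ha hb hc hc]
  have h1 {a b c : TangentSpace (𝓡 (2 * n + 1)) x} (ha : S.θ x a = 0)
      (hc : S.θ x c = 0) : S.levi x (curvature cov x a a b) c = 0 := by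
    linarith [h.levi_curvature_swap_left (w := b) hx ha ha hc]
  -- Terms with a repeated vector in the first or in the second pair vanish by skewness. Four terms
  -- survive, each equal to the same real number up to sign; with the factor `1 / 8` from the three
  -- frame vectors they give `-1 / 2`, and the result is real.
  simp only [websterCurvature, complexExt, coframe, frameZ, frameZbar, h.levi_curvature_smul hx,
    hu, hJ, h0, h1]
  rw [h.levi_curvature_swap_right hx (hu β) (hJ β) (hJ γ) (hu γ),
    h.levi_curvature_swap_right hx (hJ β) (hu β) (hJ γ) (hu γ),
    h.levi_curvature_swap_left hx (hJ β) (hu β) (hJ γ)]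
  generalize S.levi x (curvature cov x (u β) (S.J x (u β)) (u γ)) (S.J x (u γ)) = q
  apply Complex.ext
  · simp
    ring
  · simp

/-- By the previous lemma `W` is `-1 / 2` times the sum of `⟨R(u_β, Ju_β) u_γ, Ju_γ⟩`. That sum is a
quarter of the double trace of `R` with `J`, which is `-2` times the scalar contraction, whence the
total factor `1 / 4`. -/
theorem websterScalar_eq (h : AdaptedFrame S T cov e U) {x : M} (hx : x ∈ U)
    {u : Fin n → TangentSpace (𝓡 (2 * n + 1)) x} (hu : S.IsUnitaryBasis x u) :
    S.websterScalar cov x u = ((1 / 4 * ∑ a, ∑ b, curvCoeff S cov e x a b b a : ℝ) : ℂ) := by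
  have hJ (β) := S.J_mem x _ (hu.horizontal β)
  set R := curvCoeff S cov e x
  set p : Fin n → Fin (2 * n) → ℝ := fun β a => S.levi x (u β) (e a x) with hp
  set q : Fin n → Fin (2 * n) → ℝ := fun β a => S.levi x (S.J x (u β)) (e a x) with hq
  have hR (a b c d) : R a b c d = -R b a c d := by
    simp only [R, curvCoeff]; rw [fieldCurvature_swap, levi_neg_left]
  have hR' (a b c d) : R a b c d = -R a b d c :=
    h.levi_fieldCurvature_swap (h.horizontal a).1 (h.horizontal b).1 hx c d
  -- Against a skew matrix the two halves of `j = ∑ (u ⊗ Ju - Ju ⊗ u)` contribute equally. This is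
  -- used once for each pair of indices of `R`.
  have key {A : Fin (2 * n) → Fin (2 * n) → ℝ} (hA : ∀ a b, A a b = -A b a) :
      ∑ a, ∑ b, jCoeff S e x a b * A a b = 2 * ∑ β, ∑ a, ∑ b, p β a * q β b * A a b := by
    have h2 : ∑ β, ∑ a, ∑ b, q β a * p β b * A a b = -∑ β, ∑ a, ∑ b, p β a * q β b * A a b := by
      simp only [← Finset.sum_neg_distrib]
      refine Finset.sum_congr rfl fun β _ => ?_
      rw [Finset.sum_comm]
      exact Finset.sum_congr rfl fun a _ => Finset.sum_congr rfl fun b _ => by rw [hA]; ring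
    have h3 : ∑ a, ∑ b, jCoeff S e x a b * A a b
        = ∑ β, ∑ a, ∑ b, (p β a * q β b * A a b - q β a * p β b * A a b) := by
      simp only [h.jCoeff_eq_sum hx hu, Finset.sum_mul]
      rw [sum_sum_comm]
      exact Finset.sum_congr rfl fun β _ => Finset.sum_congr rfl fun a _ =>
        Finset.sum_congr rfl fun b _ => by ring
    rw [h3]
    simp only [Finset.sum_sub_distrib, h2]
    ring
  have h4 : ∑ a, ∑ b, ∑ c, ∑ d, jCoeff S e x a b * jCoeff S e x c d * R a b c d
      = 4 * ∑ β, ∑ γ, S.levi x (curvature cov x (u β) (S.J x (u β)) (u γ)) (S.J x (u γ)) := by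
    have h5 (a b : Fin (2 * n)) : ∑ c, ∑ d, jCoeff S e x a b * jCoeff S e x c d * R a b c d
        = jCoeff S e x a b * (2 * ∑ γ, ∑ c, ∑ d, p γ c * q γ d * R a b c d) := by
      rw [← key (hR' a b)]
      simp only [Finset.mul_sum, mul_assoc]
    simp only [h5]
    rw [key]
    swap
    · intro a b
      simp only [← mul_neg, ← Finset.sum_neg_distrib]
      simp only [hR a b, mul_neg]
    have h6 (β : Fin n) : ∑ a, ∑ b, p β a * q β b * (2 * ∑ γ, ∑ c, ∑ d, p γ c * q γ d * R a b c d)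
        = 2 * ∑ γ, S.levi x (curvature cov x (u β) (S.J x (u β)) (u γ)) (S.J x (u γ)) := by
      simp only [h.levi_curvature hx (hu.horizontal β) (hJ β) (hJ _)]
      rw [← sum_sum_comm]
      simp only [Finset.mul_sum]
      refine Finset.sum_congr rfl fun a _ => Finset.sum_congr rfl fun b _ =>
        Finset.sum_congr rfl fun γ _ => Finset.sum_congr rfl fun c _ =>
        Finset.sum_congr rfl fun d _ => ?_
      simp only [p, q, R]
      ring
    simp only [h6, ← Finset.mul_sum]
    ring
  simp only [websterScalar, websterRicci, h.websterCurvature_trace hx hu.horizontal]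
  rw [h.sum_jCoeff_curvCoeff hx] at h4
  simp only [← Complex.ofReal_sum, ← Finset.mul_sum]
  congr 1
  linarith

end AdaptedFrame
end PseudohermitianStructure
end WebsterCurvature
end CRSpin

/-! ### From the spin structure to the frame computation. -/

namespace CRSpin

open Bundle VectorField Filter FiberBundle
open scoped Manifold ContDiff Topology

noncomputable section SpinStructures

variable {n : ℕ} {M : Type*} [TopologicalSpace M]
  [ChartedSpace (EuclideanSpace ℝ (Fin (2 * n + 1))) M] [IsManifold (𝓡 (2 * n + 1)) ∞ M]

namespace PseudohermitianStructure

variable {S : PseudohermitianStructure n M} {T : VField n M}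
  {cov : CovariantDerivative (𝓡 (2 * n + 1)) (EuclideanSpace ℝ (Fin (2 * n + 1)))
    (TangentSpace (𝓡 (2 * n + 1)) : M → Type _)}

namespace SpinStructure

variable (P : S.SpinStructure)

theorem adaptedFrame (hT : S.IsReebField T) (hcov : S.IsTanakaWebster T cov) (i : P.ι) :
    AdaptedFrame S T cov (P.e i) (P.U i) where
  reeb := hT
  tanakaWebster := hcov
  isOpen := P.isOpen_U i
  horizontal := P.horizontal i
  orthonormal := P.orthonormal i

theorem clifford_eq (i : P.ι) (x : M) (v : TangentSpace (𝓡 (2 * n + 1)) x) :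
    P.clifford i x v = ∑ a, S.levi x v (P.e i a x) • gamma a := by
  rw [clifford, spinRep, CliffordAlgebra.lift_ι_apply]
  rfl

theorem clifford_frame (i : P.ι) {x : M} (hx : x ∈ P.U i) (a : Fin (2 * n)) :
    P.clifford i x (P.e i a x) = gamma a := by
  simp [clifford_eq, P.orthonormal i x hx]

theorem nabla_eq (i : P.ι) {x : M} (hx : x ∈ P.U i) (X : VField n M) (φ : P.ι → M → Spinor n) :
    P.nabla cov X φ i x = spinNabla S cov (P.e i) X (φ i) x := by
  simp only [nabla, connectionForm, P.clifford_frame i hx]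
  rfl

theorem nabla_eventuallyEq (i : P.ι) {x : M} (hx : x ∈ P.U i) (X : VField n M)
    (φ : P.ι → M → Spinor n) :
    P.nabla cov X φ i =ᶠ[𝓝 x] spinNabla S cov (P.e i) X (φ i) := by
  filter_upwards [(P.isOpen_U i).mem_nhds hx] with y hy using P.nabla_eq i hy X φ

theorem dirac_eq (i : P.ι) {x : M} (hx : x ∈ P.U i) (φ : P.ι → M → Spinor n) :
    P.dirac cov φ i x = frameDirac S cov (P.e i) (φ i) x := by
  simp only [dirac, frameDirac, P.clifford_frame i hx, P.nabla_eq i hx]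

/-- The inner operator is differentiated, so its two forms must agree near `x`, not only at `x`;
openness of `U i` provides this. -/
theorem dirac_dirac_eq (i : P.ι) {x : M} (hx : x ∈ P.U i) (φ : P.ι → M → Spinor n) :
    P.dirac cov (P.dirac cov φ) i x
      = frameDirac S cov (P.e i) (frameDirac S cov (P.e i) (φ i)) x := by
  have h : P.dirac cov φ i =ᶠ[𝓝 x] frameDirac S cov (P.e i) (φ i) := by
    filter_upwards [(P.isOpen_U i).mem_nhds hx] with y hy using P.dirac_eq i hy φ
  rw [P.dirac_eq i hx]
  simp only [frameDirac]
  exact Finset.sum_congr rfl fun a _ => congrArg _ (spinNabla_congr h)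

theorem connectionLaplacian_eq (i : P.ι) {x : M} (hx : x ∈ P.U i) (φ : P.ι → M → Spinor n) :
    P.connectionLaplacian cov φ i x = -∑ a, spinHessian S cov (P.e i) (φ i) x a a := by
  simp only [connectionLaplacian, secondDerivative, Pi.sub_apply, P.nabla_eq i hx, spinHessian]
  exact congrArg _ (Finset.sum_congr rfl fun a _ => congrArg (· - _)
    (spinNabla_congr (P.nabla_eventuallyEq i hx _ φ)))

/-- Each product `u_β · Ju_β` is already skew, because the two vectors are orthogonal and the trace
part vanishes. Skew-symmetrizing produces half the contribution of `β` to the matrix of `J`, which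
accounts for the factor `2`. -/
theorem sum_clifford_J (hT : S.IsReebField T) (hcov : S.IsTanakaWebster T cov) (i : P.ι) {x : M}
    (hx : x ∈ P.U i) {u : Fin n → TangentSpace (𝓡 (2 * n + 1)) x} (hu : S.IsUnitaryBasis x u)
    (ψ : Spinor n) :
    (2 : ℂ) • ∑ β, P.clifford i x (u β) (P.clifford i x (S.J x (u β)) ψ)
      = ∑ a, ∑ b, jCoeff S (P.e i) x a b • gamma a (gamma b ψ) := by
  have h := P.adaptedFrame hT hcov i
  set p : Fin n → Fin (2 * n) → ℝ := fun β a => S.levi x (u β) (P.e i a x)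
  set q : Fin n → Fin (2 * n) → ℝ := fun β a => S.levi x (S.J x (u β)) (P.e i a x)
  have h1 (β : Fin n) : P.clifford i x (u β) (P.clifford i x (S.J x (u β)) ψ)
      = (1 / 2 : ℝ) • ∑ a, ∑ b, (p β a * q β b - q β a * p β b) • gamma a (gamma b ψ) := by
    have h2 : P.clifford i x (u β) (P.clifford i x (S.J x (u β)) ψ)
        = ∑ a, ∑ b, gamma a (gamma b ((p β a * q β b) • ψ)) := by
      simp only [clifford_eq, LinearMap.sum_apply, LinearMap.smul_apply, map_sum,
        LinearMap.map_smul_of_tower, mul_smul]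
      exact Finset.sum_comm
    have h3 : ∑ a, p β a * q β a = 0 := by
      rw [← h.levi_eq_sum hx _ (S.J_mem x _ (hu.horizontal β)), hu.orthogonal_J]
    rw [h2, gamma_isCliffordSystem.sum_apply, ← Finset.sum_smul, h3, zero_smul, neg_zero, zero_add]
    simp only [← sub_smul, LinearMap.map_smul_of_tower]
    refine congrArg _ (Finset.sum_congr rfl fun a _ => Finset.sum_congr rfl fun b _ => ?_)
    rw [mul_comm (p β b)]
  have h4 (v : Spinor n) : (2 : ℂ) • v = (2 : ℝ) • v := by
    rw [two_smul, two_smul]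
  simp only [h1, h.jCoeff_eq_sum hx hu, Finset.sum_smul]
  rw [h4, ← Finset.smul_sum, smul_smul, sum_sum_comm]
  norm_num
  rfl

end SpinStructure
end PseudohermitianStructure
end SpinStructures
end CRSpin

open scoped Manifold ContDiff in
theorem mainTheorem5 {n : ℕ} {M : Type*} [TopologicalSpace M] [T2Space M]
    [SecondCountableTopology M] [ChartedSpace (EuclideanSpace ℝ (Fin (2 * n + 1))) M]
    [IsManifold (𝓡 (2 * n + 1)) ∞ M]
    (S : CRSpin.PseudohermitianStructure n M)
    (T : CRSpin.VField n M) (hT : S.IsReebField T)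
    (cov : CovariantDerivative (𝓡 (2 * n + 1)) (EuclideanSpace ℝ (Fin (2 * n + 1)))
      (TangentSpace (𝓡 (2 * n + 1)) : M → Type _))
    (hcov : S.IsTanakaWebster T cov)
    (P : S.SpinStructure) (φ : P.ι → M → CRSpin.Spinor n) (hφ : P.IsSpinorField φ)
    (i : P.ι) (x : M) (hx : x ∈ P.U i)
    (u : Fin n → TangentSpace (𝓡 (2 * n + 1)) x) (hu : S.IsUnitaryBasis x u) :
    P.dirac cov (P.dirac cov φ) i x
      = P.connectionLaplacian cov φ i x + S.websterScalar cov x u • φ i x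
        - (2 : ℂ) • ∑ β, P.clifford i x (u β)
            (P.clifford i x (S.J x (u β)) (P.nabla cov T φ i x)) := by
  have h := P.adaptedFrame hT hcov i
  rw [P.dirac_dirac_eq i hx, h.weitzenboeck (hφ.smooth i) hx, P.connectionLaplacian_eq i hx,
    h.websterScalar_eq hx hu, P.nabla_eq i hx, P.sum_clifford_J hT hcov i hx hu]
  -- The remaining difference is whether the real scalar acts directly or through its image in `ℂ`.
  rfl
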